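/- For $\alpha\in(0,1)$ and a function $f:\mathbb{R}^2\to\mathbb{C}$, where $\mathbb{R}^2$ is identified with $\mathbb{C}$, put $$\|f\|_{\Lambda_\alpha(\mathbb{R}^2)}=\sup_{z_1\ne z_2}\frac{|f(z_1)-f(z_2)|}{|z_1-z_2|^\alpha},$$ and let $\Lambda_\alpha(\mathbb{R}^2)$ be the class of all $f$ with $\|f\|_{\Lambda_\alpha(\mathbb{R}^2)}<\infty$. A normal operator on a complex Hilbert space is a densely defined closed, not necessarily bounded, operator $N$ with $N^*N=NN^*$, and $f(N)=\int_{\mathbb{C}} f\,dE_N$, where $E_N$ is the spectral measure of $N$; the domain of $f(N)$ is $\{x:\int_{\mathbb{C}}|f|^2\,d(E_Nx,x)<\infty\}$. For operators $A$ and $B$ in a Hilbert space, $\|A-B\|$ is the norm of $A-B$ on the common domain if the domains of $A$ and $B$ coincide and $A-B$ is bounded there, and $\|A-B\|=\infty$ otherwise. There exists a positive number $c$ such that for every $\alpha\in(0,1)$, every $f\in\Lambda_\alpha(\mathbb{R}^2)$, and arbitrary (not necessarily bounded) normal operators $N_1$ and $N_2$ on the same complex Hilbert space, $$\|f(N_1)-f(N_2)\|\le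 c\,(1-\alpha)^{-1}\,\|f\|_{\Lambda_\alpha(\mathbb{R}^2)}\,\|N_1-N_2\|^\alpha,$$ where the right-hand side is read as $0$ if $\|f\|_{\Lambda_\alpha(\mathbb{R}^2)}=0$ and $\|N_1-N_2\|=\infty$. In particular, if $\|N_1-N_2\|<\infty$, then $f(N_1)$ and $f(N_2)$ have the same domain and their difference is bounded on it. -/

import Mathlib

open MeasureTheory Filter Topology
open scoped ENNReal InnerProductSpace LinearPMap

noncomputable section

/-- The Hölder seminorm `sup_{z₁ ≠ z₂} |f z₁ - f z₂| / |z₁ - z₂| ^ α` of a function on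
the plane `ℝ² = ℂ`, with values in `[0, ∞]`. -/
def holderSeminorm (α : ℝ) (f : ℂ → ℂ) : ℝ≥0∞ :=
  ⨆ (z₁ : ℂ) (z₂ : ℂ) (_ : z₁ ≠ z₂), ENNReal.ofReal (‖f z₁ - f z₂‖ / ‖z₁ - z₂‖ ^ α)

/-- Membership in the Hölder class `Λ_α(ℝ²)`. -/
def MemHolderClass (α : ℝ) (f : ℂ → ℂ) : Prop :=
  holderSeminorm α f < ∞

theorem MemHolderClass.measurable {α : ℝ} {f : ℂ → ℂ} (hf : MemHolderClass α f) (hα : 0 < α) :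
    Measurable f := by
  have key : ∀ z₁ z₂, ‖f z₁ - f z₂‖ ≤ (holderSeminorm α f).toReal * ‖z₁ - z₂‖ ^ α := by
    intro z₁ z₂
    by_cases h : z₁ = z₂
    · subst h; simp [Real.zero_rpow hα.ne']
    · have h1 : ENNReal.ofReal (‖f z₁ - f z₂‖ / ‖z₁ - z₂‖ ^ α) ≤ holderSeminorm α f :=
        le_iSup_of_le z₁ (le_iSup_of_le z₂ (le_iSup_of_le h le_rfl))
      have h2 : 0 < ‖z₁ - z₂‖ ^ α := Real.rpow_pos_of_pos (norm_pos_iff.2 (sub_ne_zero.2 h)) _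
      rw [← div_le_iff₀ h2]
      exact (ENNReal.ofReal_le_iff_le_toReal hf.ne).1 h1
  refine Continuous.measurable (continuous_iff_continuousAt.2 fun z => ?_)
  refine tendsto_iff_norm_sub_tendsto_zero.2 ?_
  have hlim : Tendsto (fun w : ℂ => (holderSeminorm α f).toReal * ‖w - z‖ ^ α) (𝓝 z) (𝓝 0) := by
    have hc : Continuous fun w : ℂ => (holderSeminorm α f).toReal * ‖w - z‖ ^ α :=
      continuous_const.mul
        ((continuous_id.sub continuous_const).norm.rpow_const fun _ => Or.inr hα.le)
    simpa [Real.zero_rpow hα.ne'] using hc.tendsto z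
  exact squeeze_zero (fun _ => norm_nonneg _) (fun w => key w z) hlim

section Operators

variable {H : Type*} [NormedAddCommGroup H] [InnerProductSpace ℂ H]

open Classical in
/-- `‖A - B‖` for (possibly unbounded) operators: it is `∞` unless the domains of `A` and `B`
coincide and `A - B` is bounded on the common domain, in which case it is the operator norm
of `A - B` on that domain. -/
def opNormSub (A B : H →ₗ.[ℂ] H) : ℝ≥0∞ :=
  if A.domain = B.domain then ⨆ x : (A - B).domain, ‖(A - B) x‖ₑ / ‖(x : H)‖ₑ else ∞

/-- A (not necessarily bounded) normal operator: a densely defined closed operator `N` such that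
`N* N = N N*`, with equality of domains. -/
structure IsNormalOperator [CompleteSpace H] (N : H →ₗ.[ℂ] H) : Prop where
  dense_domain : Dense (N.domain : Set H)
  isClosed : N.IsClosed
  comm : ∀ x z : H, (∃ y, (x, y) ∈ N.graph ∧ (y, z) ∈ N†.graph) ↔
    (∃ y, (x, y) ∈ N†.graph ∧ (y, z) ∈ N.graph)

end Operators

/-- A spectral measure on the Borel sets of `ℂ`: a projection-valued measure, countably additive
in the strong operator topology. -/
structure SpectralMeasure (H : Type*) [NormedAddCommGroup H] [InnerProductSpace ℂ H]
    [CompleteSpace H] where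
  /-- The projection attached to a Borel set (values at other sets are irrelevant). -/
  proj : Set ℂ → H →L[ℂ] H
  isStarProjection : ∀ S, MeasurableSet S → IsStarProjection (proj S)
  proj_univ : proj Set.univ = 1
  proj_inter : ∀ S T, MeasurableSet S → MeasurableSet T → proj (S ∩ T) = proj S * proj T
  hasSum_proj : ∀ S : ℕ → Set ℂ, (∀ n, MeasurableSet (S n)) →
    Pairwise (Function.onFun Disjoint S) →
    ∀ x : H, HasSum (fun n => proj (S n) x) (proj (⋃ n, S n) x)

namespace SpectralMeasure

variable {H : Type*} [NormedAddCommGroup H] [InnerProductSpace ℂ H] [CompleteSpace H]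
variable (E : SpectralMeasure H)

theorem proj_empty : E.proj ∅ = 0 := by
  ext x
  have h := (E.hasSum_proj (fun _ => ∅) (fun _ => MeasurableSet.empty)
    (fun _ _ _ => by simp [Function.onFun]) x).summable
  simpa using (summable_const_iff _).1 h

theorem inner_proj_right {S : Set ℂ} (hS : MeasurableSet S) (x y : H) :
    ⟪x, E.proj S y⟫_ℂ = ⟪E.proj S x, E.proj S y⟫_ℂ := by
  have h := E.isStarProjection S hS
  have h1 : E.proj S (E.proj S y) = E.proj S y := by
    have := congrArg (fun T : H →L[ℂ] H => T y) h.isIdempotentElem.eq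
    simpa using this
  have h2 : ContinuousLinearMap.adjoint (E.proj S) = E.proj S := h.isSelfAdjoint.star_eq
  calc ⟪x, E.proj S y⟫_ℂ = ⟪x, E.proj S (E.proj S y)⟫_ℂ := by rw [h1]
    _ = ⟪ContinuousLinearMap.adjoint (E.proj S) x, E.proj S y⟫_ℂ := by
        rw [ContinuousLinearMap.adjoint_inner_left]
    _ = _ := by rw [h2]

theorem norm_proj_sq {S : Set ℂ} (hS : MeasurableSet S) (x : H) :
    ‖E.proj S x‖ ^ 2 = RCLike.re ⟪x, E.proj S x⟫_ℂ := by
  rw [E.inner_proj_right hS, inner_self_eq_norm_sq]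

theorem inner_proj_of_disjoint {S T : Set ℂ} (hS : MeasurableSet S) (hT : MeasurableSet T)
    (hST : Disjoint S T) (x y : H) : ⟪E.proj S x, E.proj T y⟫_ℂ = 0 := by
  have h2 : ContinuousLinearMap.adjoint (E.proj S) = E.proj S :=
    (E.isStarProjection S hS).isSelfAdjoint.star_eq
  have h3 : E.proj S (E.proj T y) = 0 := by
    have := E.proj_inter S T hS hT
    rw [hST.inter_eq, E.proj_empty] at this
    simpa using (congrArg (fun A : H →L[ℂ] H => A y) this).symm
  rw [← h2, ContinuousLinearMap.adjoint_inner_left, h3, inner_zero_right]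

/-- The scalar measure `S ↦ ‖E(S) x‖² = ⟪E(S) x, x⟫`. -/
def scalarMeasure (x : H) : Measure ℂ :=
  Measure.ofMeasurable (fun S _ => ‖E.proj S x‖ₑ ^ 2) (by simp [E.proj_empty]) (by
    intro S hS hd
    have h := E.hasSum_proj S hS hd x
    have h1 : HasSum (fun n => ‖E.proj (S n) x‖ ^ 2) (‖E.proj (⋃ n, S n) x‖ ^ 2) := by
      rw [E.norm_proj_sq (MeasurableSet.iUnion hS)]
      simp_rw [fun n => E.norm_proj_sq (hS n) x]
      exact (h.mapL (innerSL ℂ x)).mapL RCLike.reCLM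
    have h2 : ∀ T : Set ℂ, ‖E.proj T x‖ₑ ^ 2 = ENNReal.ofReal (‖E.proj T x‖ ^ 2) := fun T => by
      rw [ENNReal.ofReal_pow (norm_nonneg _), ofReal_norm]
    simp_rw [h2]
    rw [← h1.tsum_eq]
    exact ENNReal.ofReal_tsum_of_nonneg (fun _ => by positivity) h1.summable)

theorem scalarMeasure_apply (x : H) {S : Set ℂ} (hS : MeasurableSet S) :
    E.scalarMeasure x S = ‖E.proj S x‖ₑ ^ 2 :=
  Measure.ofMeasurable_apply S hS

/-- The integral `∑ c • E(s = c)` of a simple function. -/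
def simpleIntegral (s : SimpleFunc ℂ ℂ) : H →L[ℂ] H :=
  ∑ c ∈ s.range, c • E.proj (s ⁻¹' {c})

theorem proj_union {S T : Set ℂ} (hS : MeasurableSet S) (hT : MeasurableSet T)
    (hST : Disjoint S T) (x : H) : E.proj (S ∪ T) x = E.proj S x + E.proj T x := by
  classical
  let v : VectorMeasure ℂ H :=
    { measureOf' := fun A => if MeasurableSet A then E.proj A x else 0
      empty' := by simp [E.proj_empty]
      not_measurable' := fun A hA => by simp [hA]
      m_iUnion' := fun A hA hd => by
        simp only [hA, MeasurableSet.iUnion hA, if_true]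
        exact E.hasSum_proj A hA hd x }
  have hv : ∀ A, MeasurableSet A → v A = E.proj A x := fun A hA => if_pos hA
  rw [← hv _ (hS.union hT), ← hv _ hS, ← hv _ hT]
  exact VectorMeasure.of_union hST hS hT

instance (x : H) : IsFiniteMeasure (E.scalarMeasure x) :=
  ⟨by rw [E.scalarMeasure_apply x MeasurableSet.univ]; exact ENNReal.pow_lt_top enorm_lt_top⟩

theorem simpleIntegral_sub (s t : SimpleFunc ℂ ℂ) (x : H) :
    E.simpleIntegral (s - t) x = E.simpleIntegral s x - E.simpleIntegral t x := by
  let T : Set ℂ → ℂ →L[ℝ] H := fun S =>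
    (ContinuousLinearMap.toSpanSingleton ℂ (E.proj S x)).restrictScalars ℝ
  have hT : FinMeasAdditive (E.scalarMeasure x) T := by
    intro S S' hS hS' _ _ hd
    ext c
    simp [T, E.proj_union hS hS' hd x]
  have h : ∀ r : SimpleFunc ℂ ℂ, E.simpleIntegral r x = r.setToSimpleFunc T := fun r => by
    simp [simpleIntegral, SimpleFunc.setToSimpleFunc, T]
  rw [h, h, h]
  exact SimpleFunc.setToSimpleFunc_sub T hT (SimpleFunc.integrable_of_isFiniteMeasure s)
    (SimpleFunc.integrable_of_isFiniteMeasure t)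

theorem enorm_simpleIntegral_sq (s : SimpleFunc ℂ ℂ) (x : H) :
    ‖E.simpleIntegral s x‖ₑ ^ 2 = ∫⁻ z, ‖s z‖ₑ ^ 2 ∂E.scalarMeasure x := by
  have h1 : ‖E.simpleIntegral s x‖ ^ 2 =
      ∑ c ∈ s.range, ‖c • E.proj (s ⁻¹' {c}) x‖ ^ 2 := by
    have h0 : E.simpleIntegral s x = ∑ c ∈ s.range, c • E.proj (s ⁻¹' {c}) x := by
      simp [simpleIntegral]
    rw [h0, ← inner_self_eq_norm_sq (𝕜 := ℂ), sum_inner, map_sum]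
    refine Finset.sum_congr rfl fun c hc => ?_
    rw [inner_sum, Finset.sum_eq_single c]
    · exact inner_self_eq_norm_sq _
    · intro d _ hdc
      rw [inner_smul_left, inner_smul_right, E.inner_proj_of_disjoint
        (s.measurableSet_fiber c) (s.measurableSet_fiber d), mul_zero, mul_zero]
      exact Disjoint.preimage _ (Set.disjoint_singleton.2 hdc.symm)
    · exact fun h => absurd hc h
  have h2 : ∫⁻ z, ‖s z‖ₑ ^ 2 ∂E.scalarMeasure x =
      ∑ c ∈ s.range, ‖c‖ₑ ^ 2 * ‖E.proj (s ⁻¹' {c}) x‖ₑ ^ 2 := by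
    have := SimpleFunc.map_lintegral (μ := E.scalarMeasure x) (fun c : ℂ => ‖c‖ₑ ^ 2) s
    rw [← SimpleFunc.lintegral_eq_lintegral] at this
    simp only [SimpleFunc.coe_map, Function.comp_apply] at this
    rw [this]
    exact Finset.sum_congr rfl fun c _ => by
      rw [E.scalarMeasure_apply x (s.measurableSet_fiber c)]
  have h3 : ∀ y : H, ‖y‖ₑ ^ 2 = ENNReal.ofReal (‖y‖ ^ 2) := fun y => by
    rw [ENNReal.ofReal_pow (norm_nonneg _), ofReal_norm]
  rw [h2, h3, h1, ENNReal.ofReal_sum_of_nonneg fun _ _ => by positivity]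
  exact Finset.sum_congr rfl fun c _ => by rw [← h3, enorm_smul, mul_pow]

/-- A sequence of simple functions converging to `f` pointwise, with `|s_n| ≤ 2 |f|`. -/
def approx (f : ℂ → ℂ) (hf : Measurable f) (n : ℕ) : SimpleFunc ℂ ℂ :=
  SimpleFunc.approxOn f hf Set.univ 0 (Set.mem_univ 0) n

theorem enorm_simpleIntegral (s : SimpleFunc ℂ ℂ) (x : H) :
    ‖E.simpleIntegral s x‖ₑ = eLpNorm s 2 (E.scalarMeasure x) := by
  rw [eLpNorm_eq_lintegral_rpow_enorm_toReal (by simp) (by simp)]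
  simp only [ENNReal.toReal_ofNat, ENNReal.rpow_ofNat]
  rw [← E.enorm_simpleIntegral_sq, ← ENNReal.rpow_natCast, ← ENNReal.rpow_mul]
  norm_num

theorem exists_tendsto_simpleIntegral {f : ℂ → ℂ} (hf : Measurable f) {x : H}
    (hx : MemLp f 2 (E.scalarMeasure x)) :
    ∃ y, Tendsto (fun n => E.simpleIntegral (approx f hf n) x) atTop (𝓝 y) := by
  have hlim : Tendsto (fun n => eLpNorm (⇑(approx f hf n) - f) 2 (E.scalarMeasure x))
      atTop (𝓝 0) :=
    SimpleFunc.tendsto_approxOn_Lp_eLpNorm hf _ (by simp) (by simp) (by simpa using hx.2)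
  refine cauchySeq_tendsto_of_complete (EMetric.cauchySeq_iff.2 fun ε hε => ?_)
  obtain ⟨n₀, hn₀⟩ := eventually_atTop.1
    ((ENNReal.tendsto_nhds_zero.1 hlim) (ε / 3) (by simpa using hε.ne'))
  by_cases hεt : ε = ∞
  · exact ⟨0, fun m _ n _ => by rw [hεt]; exact edist_lt_top _ _⟩
  refine ⟨n₀, fun m hm n hn => ?_⟩
  rw [edist_eq_enorm_sub, ← E.simpleIntegral_sub, E.enorm_simpleIntegral]
  have haes : ∀ k, AEStronglyMeasurable (⇑(approx f hf k) - f) (E.scalarMeasure x) := fun k =>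
    ((approx f hf k).measurable.sub hf).aestronglyMeasurable
  have hsub : ⇑(approx f hf m - approx f hf n) =
      (⇑(approx f hf m) - f) - (⇑(approx f hf n) - f) := by
    rw [SimpleFunc.coe_sub]; abel
  rw [hsub]
  refine (eLpNorm_sub_le (haes m) (haes n) (by norm_num)).trans_lt ?_
  refine (add_le_add (hn₀ m hm) (hn₀ n hn)).trans_lt ?_
  calc ε / 3 + ε / 3 < ε / 3 + ε / 3 + ε / 3 :=
        ENNReal.lt_add_right (by finiteness) (by simpa using hε.ne')
    _ = ε := ENNReal.add_thirds ε

theorem scalarMeasure_add_le (x y : H) :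
    E.scalarMeasure (x + y) ≤ (2 : ℝ≥0∞) • (E.scalarMeasure x + E.scalarMeasure y) := by
  refine Measure.le_iff.2 fun S hS => ?_
  rw [Measure.smul_apply, Measure.add_apply, E.scalarMeasure_apply _ hS,
    E.scalarMeasure_apply _ hS, E.scalarMeasure_apply _ hS, map_add, smul_eq_mul]
  have h3 : ∀ y : H, ‖y‖ₑ ^ 2 = ENNReal.ofReal (‖y‖ ^ 2) := fun y => by
    rw [ENNReal.ofReal_pow (norm_nonneg _), ofReal_norm]
  rw [h3, h3, h3, ← ENNReal.ofReal_add (by positivity) (by positivity),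
    ← ENNReal.ofReal_ofNat, ← ENNReal.ofReal_mul (by norm_num)]
  refine ENNReal.ofReal_le_ofReal ?_
  have h := norm_add_le (E.proj S x) (E.proj S y)
  nlinarith [norm_nonneg (E.proj S x + E.proj S y), sq_nonneg (‖E.proj S x‖ - ‖E.proj S y‖)]

theorem scalarMeasure_smul (c : ℂ) (x : H) :
    E.scalarMeasure (c • x) = ‖c‖ₑ ^ 2 • E.scalarMeasure x := by
  refine Measure.ext fun S hS => ?_
  rw [Measure.smul_apply, E.scalarMeasure_apply _ hS, E.scalarMeasure_apply _ hS, map_smul,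
    enorm_smul, mul_pow, smul_eq_mul]

/-- The (in general unbounded) operator `∫ f dE` for a Borel function `f`. Its domain consists of
all `x` with `∫ |f|² d⟪E x, x⟫ < ∞`, and `(∫ f dE) x` is the limit of `(∫ s_n dE) x` for simple
functions `s_n` that converge to `f` pointwise with `|s_n| ≤ 2 |f|`, hence in
`L²(⟪E x, x⟫)`. -/
def integral (f : ℂ → ℂ) (hf : Measurable f) : H →ₗ.[ℂ] H where
  domain :=
    { carrier := {x | MemLp f 2 (E.scalarMeasure x)}
      zero_mem' := by
        have h : E.scalarMeasure 0 = 0 := Measure.ext fun S hS => by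
          rw [E.scalarMeasure_apply _ hS]; simp
        simp [h]
      add_mem' := fun {x y} hx hy => by
        have hxy : MemLp f 2 (E.scalarMeasure x + E.scalarMeasure y) := by
          refine ⟨hf.aestronglyMeasurable, ?_⟩
          have h : ∀ μ : Measure ℂ, eLpNorm f 2 μ < ∞ ↔ ∫⁻ z, ‖f z‖ₑ ^ (2 : ℝ) ∂μ < ∞ := fun μ => by
            simpa using eLpNorm_lt_top_iff_lintegral_rpow_enorm_lt_top
              (f := f) (μ := μ) (p := 2) (by simp) (by simp)
          rw [h, lintegral_add_measure, ENNReal.add_lt_top]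
          exact ⟨(h _).1 hx.2, (h _).1 hy.2⟩
        exact (hxy.smul_measure (by simp)).mono_measure (E.scalarMeasure_add_le x y)
      smul_mem' := fun c x hx => by
        simp only [Set.mem_ofPred_eq, E.scalarMeasure_smul]
        exact MemLp.smul_measure hx (by finiteness) }
  toFun :=
    { toFun := fun x => (E.exists_tendsto_simpleIntegral hf x.2).choose
      map_add' := fun x y => by
        refine tendsto_nhds_unique (E.exists_tendsto_simpleIntegral hf (x + y).2).choose_spec ?_
        simpa using (E.exists_tendsto_simpleIntegral hf x.2).choose_spec.add
          (E.exists_tendsto_simpleIntegral hf y.2).choose_spec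
      map_smul' := fun c x => by
        refine tendsto_nhds_unique (E.exists_tendsto_simpleIntegral hf (c • x).2).choose_spec ?_
        simpa using (E.exists_tendsto_simpleIntegral hf x.2).choose_spec.const_smul c }

end SpectralMeasure

open Classical in
/-- The function `f(N) = ∫ f dE` of a normal operator `N`, where `E` is the spectral measure of
`N`, i.e. the spectral measure on `ℂ` with `N = ∫ z dE(z)` (it exists and is unique by
the spectral theorem). The value `⊥` is never attained at a normal operator. -/
def borelFunction {H : Type*} [NormedAddCommGroup H] [InnerProductSpace ℂ H] [CompleteSpace H]
    (N : H →ₗ.[ℂ] H) (f : ℂ → ℂ) (hf : Measurable f) : H →ₗ.[ℂ] H :=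
  if h : ∃ E : SpectralMeasure H, N = E.integral (fun z => z) measurable_id
  then h.choose.integral f hf else ⊥

end

/-! Let `δ = ‖N₁ - N₂‖` and round the plane to the square lattice of mesh `δ`. Rounding moves each
normal operator by at most `2δ`, and each of `f(N₁)`, `f(N₂)` by at most a multiple of `‖f‖ δ^α`, so
it is enough to compare functions of two rounded operators, whose difference still has norm at most
`5δ`. With spectral projections `P_k` and `Q_l` of the cells, the difference of the two functions
has blocks `(g k - g l) P_k Q_l`. The real and imaginary parts of the difference of the rounded
operators, divided by `δ`, are bounded operators with blocks `(k.1 - l.1) P_k Q_l` and `(k.2 - l.2)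
P_k Q_l`.

If `h` on `ℤ²` is bounded by `V` and smooth at scale `n` in each coordinate, then `h k - h l` splits
into one divided difference per coordinate, multiplied by that coordinate difference. The divided
differences are Schur multipliers of norm `O(V / n)`: averaging over windows of length `n` factors
them through `ℓ²` (`exists_divDiff_factorization`, `norm_schur_le`).

A Hölder function `g` on the lattice is the telescoping sum of differences of its averages at scales
`2^m`, each bounded by `O(L 2^(mα))` and smooth at scale `2^m`. The lattice has no scales below `1`,
so the bounds form the series `∑ L 2^(m(α - 1)) = O(L / (1 - α))`, which is the source of the factor
`(1 - α)⁻¹` (`norm_sum_sub_le_of_holder`). Undoing the scaling by `δ` gives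
`exists_integral_sub_le`.

The existence of spectral measures is proved separately: with `B = (1 + N*N)⁻¹` and `C = N B`,
Gelfand duality turns `B, C` into continuous functions `b, c` on a compact space, and the spectral
measure of `N` is the image of the representation under `c / b`. -/

noncomputable section

namespace LatticeSchur

/-! ### Schur multipliers for orthogonal families. -/

section Bilinear

variable {H : Type*} [NormedAddCommGroup H] [InnerProductSpace ℂ H]

/-- Pythagoras for a finite orthogonal family with coefficients. -/
theorem norm_sum_smul_sq {ι : Type*} (S : Finset ι) (p : ι → H)
    (hp : ∀ i j, i ≠ j → ⟪p i, p j⟫_ℂ = 0) (c : ι → ℂ) :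
    ‖∑ i ∈ S, c i • p i‖ ^ 2 = ∑ i ∈ S, ‖c i‖ ^ 2 * ‖p i‖ ^ 2 := by
  classical
  induction S using Finset.induction_on with
  | empty => simp
  | insert i S hi ih =>
    rw [Finset.sum_insert hi, Finset.sum_insert hi, ← ih]
    have h : ⟪c i • p i, ∑ j ∈ S, c j • p j⟫_ℂ = 0 := by
      rw [inner_sum]
      refine Finset.sum_eq_zero fun j hj => ?_
      rw [inner_smul_left, inner_smul_right, hp i j (by rintro rfl; exact hi hj)]
      simp
    have := norm_add_sq_eq_norm_sq_add_norm_sq_of_inner_eq_zero _ _ h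
    rw [pow_two, this, norm_smul]
    ring

/-- A matrix that factors through `ℓ²` with bounded rows and columns is a Schur multiplier. -/
theorem norm_schur_le {ι κ ν : Type*} (S : Finset ι) (T : Finset κ) (F : Finset ν)
    (p : ι → H) (q : κ → H) (hp : ∀ i j, i ≠ j → ⟪p i, p j⟫_ℂ = 0)
    (hq : ∀ i j, i ≠ j → ⟪q i, q j⟫_ℂ = 0) {X Y : ℝ} (hX : 0 ≤ X) (hY : 0 ≤ Y)
    (hpY : ∑ k ∈ S, ‖p k‖ ^ 2 ≤ Y ^ 2) (hqX : ∑ l ∈ T, ‖q l‖ ^ 2 ≤ X ^ 2)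
    (K : H →L[ℂ] H) (a : ν → ι → ℂ) (b : ν → κ → ℂ) {A B t : ℝ} (hA : 0 ≤ A) (hB : 0 ≤ B)
    (ht : 0 ≤ t) (haA : ∀ k ∈ S, ∑ n ∈ F, ‖a n k‖ ^ 2 ≤ A)
    (hbB : ∀ l ∈ T, ∑ n ∈ F, ‖b n l‖ ^ 2 ≤ B) (hAB : A * B ≤ t ^ 2) :
    ‖∑ k ∈ S, ∑ l ∈ T, (∑ n ∈ F, a n k * b n l) * ⟪p k, K (q l)⟫_ℂ‖ ≤ t * ‖K‖ * X * Y := by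
  let u : ν → H := fun n => ∑ k ∈ S, (starRingEnd ℂ) (a n k) • p k
  let v : ν → H := fun n => ∑ l ∈ T, b n l • q l
  have hEq : ∑ k ∈ S, ∑ l ∈ T, (∑ n ∈ F, a n k * b n l) * ⟪p k, K (q l)⟫_ℂ
      = ∑ n ∈ F, ⟪u n, K (v n)⟫_ℂ := by
    simp only [u, v, map_sum, sum_inner, inner_sum, map_smul, inner_smul_left, inner_smul_right,
      Complex.conj_conj, Finset.sum_mul]
    simp only [Finset.mul_sum]
    rw [Finset.sum_comm, Finset.sum_comm (s := F)]
    refine Finset.sum_congr rfl fun l _ => ?_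
    rw [Finset.sum_comm]
    exact Finset.sum_congr rfl fun n _ => Finset.sum_congr rfl fun k _ => by ring
  have hu : ∑ n ∈ F, ‖u n‖ ^ 2 ≤ A * Y ^ 2 := by
    have h1 : ∀ n, ‖u n‖ ^ 2 = ∑ k ∈ S, ‖a n k‖ ^ 2 * ‖p k‖ ^ 2 := fun n => by
      simp only [u, norm_sum_smul_sq S p hp, RCLike.norm_conj]
    simp only [h1]
    rw [Finset.sum_comm]
    calc _ ≤ ∑ k ∈ S, A * ‖p k‖ ^ 2 := Finset.sum_le_sum fun k hk => by
          rw [← Finset.sum_mul]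
          exact mul_le_mul_of_nonneg_right (haA k hk) (sq_nonneg _)
      _ ≤ _ := by rw [← Finset.mul_sum]; exact mul_le_mul_of_nonneg_left hpY hA
  have hv : ∑ n ∈ F, ‖v n‖ ^ 2 ≤ B * X ^ 2 := by
    have h1 : ∀ n, ‖v n‖ ^ 2 = ∑ l ∈ T, ‖b n l‖ ^ 2 * ‖q l‖ ^ 2 := fun n => by
      simp only [v, norm_sum_smul_sq T q hq]
    simp only [h1]
    rw [Finset.sum_comm]
    calc _ ≤ ∑ l ∈ T, B * ‖q l‖ ^ 2 := Finset.sum_le_sum fun l hl => by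
          rw [← Finset.sum_mul]
          exact mul_le_mul_of_nonneg_right (hbB l hl) (sq_nonneg _)
      _ ≤ _ := by rw [← Finset.mul_sum]; exact mul_le_mul_of_nonneg_left hqX hB
  rw [hEq]
  have hcs : (∑ n ∈ F, ‖u n‖ * ‖v n‖) ^ 2 ≤ (t * X * Y) ^ 2 :=
    calc _ ≤ (∑ n ∈ F, ‖u n‖ ^ 2) * ∑ n ∈ F, ‖v n‖ ^ 2 := Finset.sum_mul_sq_le_sq_mul_sq ..
      _ ≤ (A * Y ^ 2) * (B * X ^ 2) :=
        mul_le_mul hu hv (Finset.sum_nonneg fun _ _ => sq_nonneg _) (by positivity)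
      _ = (A * B) * (X ^ 2 * Y ^ 2) := by ring
      _ ≤ t ^ 2 * (X ^ 2 * Y ^ 2) := mul_le_mul_of_nonneg_right hAB (by positivity)
      _ = _ := by ring
  have hcs' := abs_le_of_sq_le_sq hcs (by positivity)
  calc ‖∑ n ∈ F, ⟪u n, K (v n)⟫_ℂ‖ ≤ ∑ n ∈ F, ‖K‖ * (‖u n‖ * ‖v n‖) := by
        refine (norm_sum_le _ _).trans (Finset.sum_le_sum fun n _ => ?_)
        refine (norm_inner_le_norm _ _).trans ?_
        calc ‖u n‖ * ‖K (v n)‖ ≤ ‖u n‖ * (‖K‖ * ‖v n‖) := by gcongr; exact K.le_opNorm _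
          _ = _ := by ring
    _ = ‖K‖ * ∑ n ∈ F, ‖u n‖ * ‖v n‖ := by rw [Finset.mul_sum]
    _ ≤ ‖K‖ * (t * X * Y) := by gcongr; exact (le_abs_self _).trans hcs'
    _ = _ := by ring

end Bilinear

/-! ### Divided differences of smooth sequences factor through `ℓ²`. -/

section DividedDifference

/-- The step bound is asked only between `a` and `b`; `norm_divDiff_sub_le` uses a bound that holds
only there. -/
theorem norm_sub_le_of_step {g : ℤ → ℂ} {a b : ℤ} {c : ℝ}
    (h : ∀ i, min a b ≤ i → i < max a b → ‖g (i + 1) - g i‖ ≤ c) :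
    ‖g b - g a‖ ≤ c * |(b : ℝ) - a| := by
  have key : ∀ a b : ℤ, a ≤ b → (∀ i, a ≤ i → i < b → ‖g (i + 1) - g i‖ ≤ c) →
      ‖g b - g a‖ ≤ c * ((b : ℝ) - a) := by
    intro a b hab
    induction b, hab using Int.leInduction with
    | base => intro _; simp
    | succ n hn ih =>
      intro h
      have h1 := ih fun i hi hin => h i hi (by omega)
      have h2 := h n hn (by omega)
      calc ‖g (n + 1) - g a‖ ≤ ‖g (n + 1) - g n‖ + ‖g n - g a‖ := norm_sub_le_norm_sub_add_norm_sub ..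
        _ ≤ c + c * ((n : ℝ) - a) := add_le_add h2 h1
        _ = _ := by push_cast; ring
  rcases le_total a b with hab | hab
  · rw [abs_of_nonneg (by exact_mod_cast sub_nonneg.2 (Int.cast_le.2 hab))]
    exact key a b hab fun i h1 h2 => h i (by simpa [hab] using h1) (by simpa [hab] using h2)
  · rw [abs_sub_comm, norm_sub_rev,
      abs_of_nonneg (by exact_mod_cast sub_nonneg.2 (Int.cast_le.2 hab))]
    exact key b a hab fun i h1 h2 => h i (by simpa [hab] using h1) (by simpa [hab] using h2)

/-- `u` is bounded by `V` and smooth at scale `R`. -/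
structure SmoothAtScale (u : ℤ → ℂ) (V R : ℝ) : Prop where
  bound : ∀ j, ‖u j‖ ≤ V
  diff : ∀ j, ‖u (j + 1) - u j‖ ≤ V / R
  diff₂ : ∀ j, ‖u (j + 2) - 2 * u (j + 1) + u j‖ ≤ V / R ^ 2

/-- The divided difference of a sequence on `ℤ`. -/
def divDiff (u : ℤ → ℂ) (k l : ℤ) : ℂ :=
  -- `divDiff_mul` allows any diagonal value; the forward difference keeps the increments in `l` of
  -- second order up to the diagonal.
  if l = k then u (k + 1) - u k else (u k - u l) / ((k : ℂ) - l)

theorem divDiff_mul (u : ℤ → ℂ) (k l : ℤ) : divDiff u k l * ((k : ℂ) - l) = u k - u l := by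
  unfold divDiff
  split_ifs with h
  · simp [h]
  · exact div_mul_cancel₀ _ (sub_ne_zero.2 (by exact_mod_cast Ne.symm h))

/-- Subtracting `divDiff_mul` at `j + 1` and `j` expresses the increment as a first-order remainder
divided by a distance, which gives it one more order of decay. -/
theorem divDiff_step (u : ℤ → ℂ) (k j : ℤ) :
    (divDiff u k (j + 1) - divDiff u k j) * ((k : ℂ) - j - 1) =
      divDiff u k j - (u (j + 1) - u j) := by
  have h1 := divDiff_mul u k (j + 1)
  have h2 := divDiff_mul u k j
  push_cast at h1
  linear_combination h1 - h2

theorem norm_intCast_sub (k l : ℤ) : ‖(k : ℂ) - l‖ = |(k : ℝ) - l| := by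
  rw [← Int.cast_sub, ← Int.cast_sub, Complex.norm_intCast]

variable {u : ℤ → ℂ} {V R : ℝ}

theorem norm_divDiff_le (hu : SmoothAtScale u V R) (k l : ℤ) : ‖divDiff u k l‖ ≤ V / R := by
  by_cases h : l = k
  · simpa [divDiff, h] using hu.diff k
  · have h0 : 0 < |(k : ℝ) - l| := abs_pos.2 (sub_ne_zero.2 (by exact_mod_cast Ne.symm h))
    rw [divDiff, if_neg h, norm_div, norm_intCast_sub, div_le_iff₀ h0]
    exact norm_sub_le_of_step fun i _ _ => hu.diff i

/-- The divided difference is a mean of first differences between `k` and `l`, and each of them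
deviates from the one at `l` by at most `V / R ^ 2` times the distance. -/
theorem norm_divDiff_sub_le (hu : SmoothAtScale u V R) (hV : 0 ≤ V) (k l : ℤ) :
    ‖divDiff u k l - (u (l + 1) - u l)‖ ≤ V / R ^ 2 * |(k : ℝ) - l| := by
  by_cases h : l = k
  · simp [divDiff, h]
  have h0 : 0 < |(k : ℝ) - l| := abs_pos.2 (sub_ne_zero.2 (by exact_mod_cast Ne.symm h))
  have hc : 0 ≤ V / R ^ 2 := by positivity
  have h1 : ∀ i, ‖(u (i + 1) - u i) - (u (l + 1) - u l)‖ ≤ V / R ^ 2 * |(i : ℝ) - l| := fun i => by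
    refine norm_sub_le_of_step (g := fun i => u (i + 1) - u i) fun i _ _ => ?_
    convert hu.diff₂ i using 2
    rw [show i + 1 + 1 = i + 2 by ring]
    ring
  -- Removing the linear function of slope `u (l + 1) - u l` leaves a sequence whose steps between
  -- `l` and `k` are of second order.
  have h2 := norm_sub_le_of_step (g := fun i => u i - (i : ℂ) * (u (l + 1) - u l)) (a := l) (b := k)
    (c := V / R ^ 2 * |(k : ℝ) - l|) (fun i hi1 hi2 => by
      have : |(i : ℝ) - l| ≤ |(k : ℝ) - l| := by
        rw [← Int.cast_sub, ← Int.cast_sub, ← Int.cast_abs, ← Int.cast_abs, Int.cast_le]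
        rcases le_total l k with hlk | hlk
        · simp only [hlk, min_eq_left, max_eq_right] at hi1 hi2
          rw [abs_of_nonneg (by omega), abs_of_nonneg (by omega)]; omega
        · simp only [hlk, min_eq_right, max_eq_left] at hi1 hi2
          rw [abs_of_nonpos (by omega), abs_of_nonpos (by omega)]; omega
      refine le_trans ?_ ((h1 i).trans (by gcongr))
      apply le_of_eq; congr 1; push_cast; ring)
  rw [← mul_le_mul_iff_left₀ h0]
  refine le_trans (le_of_eq ?_) h2
  rw [← norm_intCast_sub, ← norm_mul, sub_mul, divDiff_mul]
  congr 1; ring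

/-- Near the diagonal the first differences bound the quotient by `V / R`; far from it the numerator
is at most `2 * V`. -/
theorem norm_divDiff_mul_le (hu : SmoothAtScale u V R) (hR : 0 < R) (k j : ℤ) :
    ‖divDiff u k j‖ * (R + |(k : ℝ) - j|) ≤ 4 * V := by
  have hV : 0 ≤ V := (norm_nonneg _).trans (hu.bound 0)
  have h1 : ‖divDiff u k j‖ * R ≤ V := by
    rw [← le_div_iff₀ hR]; exact norm_divDiff_le hu k j
  have h2 : ‖divDiff u k j‖ * |(k : ℝ) - j| ≤ V + V := by
    rw [← norm_intCast_sub, ← norm_mul, divDiff_mul]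
    exact (norm_sub_le _ _).trans (add_le_add (hu.bound _) (hu.bound _))
  linarith

/-- The same two regimes one order higher: second differences near the diagonal, `divDiff_step` far
from it. The centre is `k - 1` because that is where the factor in `divDiff_step` vanishes. -/
theorem norm_divDiff_step_mul_le (hu : SmoothAtScale u V R) (hR : 0 < R) (k j : ℤ) :
    ‖divDiff u k (j + 1) - divDiff u k j‖ * (R + |(k : ℝ) - 1 - j|) ≤ 4 * V / R := by
  have hV : 0 ≤ V := (norm_nonneg _).trans (hu.bound 0)
  have hcast : ‖(k : ℂ) - j - 1‖ = |(k : ℝ) - 1 - j| := by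
    rw [show (k : ℂ) - j - 1 = ((k - 1 : ℤ) : ℂ) - (j : ℤ) by push_cast; ring, norm_intCast_sub]
    push_cast; rfl
  have h2 : ‖divDiff u k (j + 1) - divDiff u k j‖ * |(k : ℝ) - 1 - j| ≤ V / R + V / R := by
    rw [← hcast, ← norm_mul, divDiff_step]
    exact (norm_sub_le _ _).trans (add_le_add (norm_divDiff_le hu k j) (hu.diff j))
  have h1 : ‖divDiff u k (j + 1) - divDiff u k j‖ ≤ 2 * (V / R ^ 2) := by
    -- Here `divDiff_step` carries no information, but by the choice of diagonal value the increment
    -- is exactly a second difference.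
    by_cases h : k = j + 1
    · subst h
      have := hu.diff₂ j
      have h3 : ‖divDiff u (j + 1) (j + 1) - divDiff u (j + 1) j‖ ≤ V / R ^ 2 := by
        refine le_trans (le_of_eq ?_) this
        simp [divDiff, show j + 1 + 1 = j + 2 by ring]
        congr 1; ring
      linarith [norm_nonneg (divDiff u (j + 1) (j + 1) - divDiff u (j + 1) j)]
    · have h0 : (1 : ℝ) ≤ |(k : ℝ) - 1 - j| := by
        have : (1 : ℤ) ≤ |k - 1 - j| := Int.one_le_abs (by omega)
        exact_mod_cast this
      have h3 := norm_divDiff_sub_le hu hV k j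
      rw [← divDiff_step, norm_mul, hcast] at h3
      have h4 : |(k : ℝ) - j| ≤ 2 * |(k : ℝ) - 1 - j| := by
        have := abs_add_le ((k : ℝ) - 1 - j) 1
        rw [abs_one, show (k : ℝ) - 1 - j + 1 = k - j by ring] at this
        linarith
      have h5 : V / R ^ 2 * |(k : ℝ) - j| ≤ V / R ^ 2 * (2 * |(k : ℝ) - 1 - j|) := by gcongr
      have h6 : 0 < |(k : ℝ) - 1 - j| := by linarith
      rw [← mul_le_mul_iff_left₀ h6]
      linarith
  have h7 : ‖divDiff u k (j + 1) - divDiff u k j‖ * R ≤ 2 * (V / R) := by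
    calc _ ≤ 2 * (V / R ^ 2) * R := by gcongr
      _ = _ := by field_simp
  have : 4 * V / R = 4 * (V / R) := by ring
  linarith

/-- Each term is compared with `(R + i)⁻¹ - (R + i + 1)⁻¹`, at the cost of a factor `1 + R⁻¹`, and
the sum telescopes. -/
theorem sum_range_inv_sq_le (hR : 0 < R) (n : ℕ) :
    ∑ i ∈ Finset.range n, ((R + i) ^ 2)⁻¹ ≤ (1 + R⁻¹) * (R⁻¹ - (R + n)⁻¹) := by
  induction n with
  | zero => simp
  | succ n ih =>
    rw [Finset.sum_range_succ]
    have : ((R + n) ^ 2)⁻¹ ≤ (1 + R⁻¹) * ((R + n)⁻¹ - (R + (n + 1 : ℕ))⁻¹) := by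
      have h1 : 0 < R + n := by positivity
      have h2 : (R + n)⁻¹ - (R + (n + 1 : ℕ))⁻¹ = ((R + n) * (R + n + 1))⁻¹ := by
        push_cast; field_simp; ring
      rw [h2, ← div_eq_mul_inv, le_div_iff₀ (by positivity), inv_mul_le_iff₀ (by positivity)]
      have : 0 ≤ R⁻¹ * n := by positivity
      have h3 : R⁻¹ * R = 1 := inv_mul_cancel₀ hR.ne'
      nlinarith [mul_nonneg this h1.le]
    linarith

theorem sum_inv_sq_le (hR : 1 ≤ R) (F : Finset ℤ) (k : ℤ) :
    ∑ j ∈ F, ((R + |(k : ℝ) - j|) ^ 2)⁻¹ ≤ 4 / R := by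
  have hR0 : 0 < R := by linarith
  -- On each side of `k` the distance to `k` determines `j`, so the sum reduces to one over natural
  -- numbers.
  have key : ∀ G : Finset ℤ, Set.InjOn (fun j : ℤ => (k - j).natAbs) G →
      ∑ j ∈ G, ((R + |(k : ℝ) - j|) ^ 2)⁻¹ ≤ 2 / R := by
    intro G hG
    have h1 : ∑ j ∈ G, ((R + |(k : ℝ) - j|) ^ 2)⁻¹ =
        ∑ i ∈ G.image (fun j : ℤ => (k - j).natAbs), ((R + (i : ℝ)) ^ 2)⁻¹ := by
      rw [Finset.sum_image hG]
      refine Finset.sum_congr rfl fun j _ => ?_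
      rw [Nat.cast_natAbs, Int.cast_abs, Int.cast_sub]
    obtain ⟨n, hn⟩ := (G.image (fun j : ℤ => (k - j).natAbs)).exists_nat_subset_range
    rw [h1]
    refine (Finset.sum_le_sum_of_subset_of_nonneg hn fun _ _ _ => by positivity).trans ?_
    refine (sum_range_inv_sq_le hR0 n).trans ?_
    have h2 : R⁻¹ ≤ 1 := inv_le_one_of_one_le₀ hR
    have h3 : 0 ≤ (R + n)⁻¹ := by positivity
    have h4 : 0 < R⁻¹ := by positivity
    rw [div_eq_mul_inv]
    nlinarith
  rw [← Finset.sum_filter_add_sum_filter_not F (fun j => j ≤ k)]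
  have h1 := key (F.filter (fun j => j ≤ k)) (by
    intro i hi j hj hij
    simp only [Finset.coe_filter, Set.mem_ofPred_eq] at hi hj hij
    omega)
  have h2 := key (F.filter (fun j => ¬ j ≤ k)) (by
    intro i hi j hj hij
    simp only [Finset.coe_filter, Set.mem_ofPred_eq] at hi hj hij
    omega)
  have : 4 / R = 2 / R + 2 / R := by ring
  linarith

theorem sum_sq_le_of_mul_le (hR : 1 ≤ R) (F : Finset ℤ) (k : ℤ) {m : ℤ → ℝ} {W : ℝ}
    (hm0 : ∀ j, 0 ≤ m j) (hm : ∀ j, m j * (R + |(k : ℝ) - j|) ≤ W) :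
    ∑ j ∈ F, m j ^ 2 ≤ W ^ 2 * (4 / R) := by
  refine le_trans ?_ (mul_le_mul_of_nonneg_left (sum_inv_sq_le hR F k) (sq_nonneg W))
  rw [Finset.mul_sum]
  refine Finset.sum_le_sum fun j _ => ?_
  have h : 0 < R + |(k : ℝ) - j| := by positivity
  rw [← div_eq_mul_inv, le_div_iff₀ (by positivity), ← mul_pow]
  exact pow_le_pow_left₀ (by have := hm0 j; positivity) (hm j) 2

/-- Representation of a sequence through window averages of itself and of its differences. -/
theorem eq_sum_window (M : ℤ → ℂ) (l : ℤ) (n : ℕ) :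
    n * M l = ∑ i ∈ Finset.range n, M (l + i) -
      ∑ i ∈ Finset.range n, ((n : ℂ) - 1 - i) * (M (l + i + 1) - M (l + i)) := by
  induction n with
  | zero => simp
  | succ n ih =>
    have htel : M (l + n) - M l = ∑ i ∈ Finset.range n, (M (l + i + 1) - M (l + i)) := by
      have := Finset.sum_range_sub (fun i : ℕ => M (l + i)) n
      simp only [Nat.cast_zero, add_zero] at this
      rw [← this]
      refine Finset.sum_congr rfl fun i _ => by push_cast; rw [add_assoc]
    rw [Finset.sum_range_succ, Finset.sum_range_succ]
    have h2 : ∑ i ∈ Finset.range n, (((n + 1 : ℕ) : ℂ) - 1 - i) * (M (l + i + 1) - M (l + i)) =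
        ∑ i ∈ Finset.range n, ((n : ℂ) - 1 - i) * (M (l + i + 1) - M (l + i)) + (M (l + n) - M l) := by
      rw [htel, ← Finset.sum_add_distrib]
      refine Finset.sum_congr rfl fun i _ => by push_cast; ring
    rw [h2]
    push_cast
    linear_combination ih

/-- The divided differences of a family of sequences that are smooth at scale `n` factor
through `ℓ²`. -/
theorem exists_divDiff_factorization {ι : Type*} {n : ℕ} (hn : 1 ≤ n) (w : ι → ℤ → ℂ)
    (hw : ∀ k, SmoothAtScale (w k) V n) (e : ι → ℤ) (D : Finset ℤ) :
    ∃ (F : Finset ℤ) (a a' : ℤ → ι → ℂ) (b b' : ℤ → ℤ → ℂ),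
      (∀ k, ∀ l ∈ D, divDiff (w k) (e k) l =
        ∑ j ∈ F, a j k * b j l + ∑ j ∈ F, a' j k * b' j l) ∧
      (∀ k, ∑ j ∈ F, ‖a j k‖ ^ 2 ≤ 64 * V ^ 2 / n) ∧
      (∀ k, ∑ j ∈ F, ‖a' j k‖ ^ 2 ≤ 64 * V ^ 2 / n ^ 3) ∧
      (∀ l ∈ D, ∑ j ∈ F, ‖b j l‖ ^ 2 ≤ 1 / n) ∧
      (∀ l ∈ D, ∑ j ∈ F, ‖b' j l‖ ^ 2 ≤ n) := by
  classical
  have hn' : (1 : ℝ) ≤ n := by exact_mod_cast hn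
  have hn0 : (n : ℝ) ≠ 0 := by positivity
  have hnC : (n : ℂ) ≠ 0 := by exact_mod_cast hn0
  let win : ℤ → Finset ℤ := fun l => (Finset.range n).image fun i : ℕ => l + (i : ℤ)
  let F := D.biUnion win
  have hwin : ∀ (l : ℤ), l ∈ D → ∀ {β : Type} [AddCommMonoid β] (g : ℤ → β),
      ∑ j ∈ F, (if j ∈ win l then g j else 0) = ∑ i ∈ Finset.range n, g (l + i) := by
    intro l hl β _ g
    rw [Finset.sum_ite_mem, Finset.inter_eq_right.2 (Finset.subset_biUnion_of_mem win hl),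
      Finset.sum_image (fun i _ j _ h => by simpa using h)]
  -- This is `eq_sum_window` divided by `n`: rows carry the divided differences and their
  -- increments, columns carry the window weights. The row sums are `(4V)² · 4/n` and `(4V/n)² ·
  -- 4/n`; a column has `n` nonzero entries at most, equal to `1/n` in the first case and of modulus
  -- at most `1` in the second.
  refine ⟨F, fun j k => divDiff (w k) (e k) j,
    fun j k => divDiff (w k) (e k) (j + 1) - divDiff (w k) (e k) j,
    fun j l => if j ∈ win l then (n : ℂ)⁻¹ else 0,
    fun j l => if j ∈ win l then -((n : ℂ) - 1 - (j - l)) / n else 0, ?_, ?_, ?_, ?_, ?_⟩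
  · intro k l hl
    simp only [mul_ite, mul_zero]
    rw [hwin l hl, hwin l hl]
    have h := eq_sum_window (divDiff (w k) (e k)) l n
    rw [← mul_right_inj' hnC, h, mul_add, Finset.mul_sum, Finset.mul_sum, sub_eq_add_neg,
      ← Finset.sum_neg_distrib]
    congr 1 <;> refine Finset.sum_congr rfl fun i _ => ?_
    · field_simp
    · push_cast; field_simp; ring
  · intro k
    refine (sum_sq_le_of_mul_le hn' F (e k) (fun _ => norm_nonneg _)
      fun j => norm_divDiff_mul_le (hw k) (by positivity) (e k) j).trans (le_of_eq (by ring))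
  · intro k
    refine (sum_sq_le_of_mul_le hn' F (e k - 1) (fun _ => norm_nonneg _)
      fun j => ?_).trans (le_of_eq (?_ : (4 * V / n) ^ 2 * _ = _))
    · push_cast
      exact norm_divDiff_step_mul_le (hw k) (by positivity) (e k) j
    · field_simp; ring
  · intro l hl
    have : ∀ j, ‖(if j ∈ win l then (n : ℂ)⁻¹ else 0)‖ ^ 2 =
        if j ∈ win l then ((n : ℝ)⁻¹) ^ 2 else 0 := fun j => by split_ifs <;> simp
    simp only [this]
    rw [hwin l hl]
    simp only [Finset.sum_const, Finset.card_range, nsmul_eq_mul]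
    apply le_of_eq; field_simp
  · intro l hl
    have : ∀ j, ‖(if j ∈ win l then -((n : ℂ) - 1 - (j - l)) / n else 0)‖ ^ 2 ≤
        if j ∈ win l then (1 : ℝ) else 0 := fun j => by
      split_ifs with h
      · obtain ⟨i, hi, rfl⟩ := Finset.mem_image.1 h
        rw [Finset.mem_range] at hi
        have h1 : -((n : ℂ) - 1 - (((l + i : ℤ) : ℂ) - l)) = -((n - 1 - i : ℤ) : ℂ) := by
          push_cast; ring
        rw [h1, norm_div, norm_neg, Complex.norm_intCast, Complex.norm_natCast]
        have h2 : |((n - 1 - i : ℤ) : ℝ)| ≤ n := by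
          rw [abs_of_nonneg (by exact_mod_cast (by omega : (0:ℤ) ≤ n - 1 - i))]
          push_cast
          have : (0 : ℝ) ≤ i := by positivity
          linarith
        exact pow_le_one₀ (by positivity) (div_le_one_of_le₀ h2 (by positivity))
      · simp
    refine (Finset.sum_le_sum fun j _ => this j).trans ?_
    rw [hwin l hl]
    simp

end DividedDifference

/-! ### Commutator estimates for smooth functions on the lattice. -/

section Lattice

variable {H : Type*} [NormedAddCommGroup H] [InnerProductSpace ℂ H]

theorem norm_sum_divDiff_left_le {ι κ : Type*} (S : Finset ι) (T : Finset κ)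
    (p : ι → H) (q : κ → H) (hp : ∀ i j, i ≠ j → ⟪p i, p j⟫_ℂ = 0)
    (hq : ∀ i j, i ≠ j → ⟪q i, q j⟫_ℂ = 0) {X Y V : ℝ} (hX : 0 ≤ X) (hY : 0 ≤ Y) (hV : 0 ≤ V)
    (hpY : ∑ k ∈ S, ‖p k‖ ^ 2 ≤ Y ^ 2) (hqX : ∑ l ∈ T, ‖q l‖ ^ 2 ≤ X ^ 2)
    (K : H →L[ℂ] H) {n : ℕ} (hn : 1 ≤ n) (w : ι → ℤ → ℂ)
    (hw : ∀ k, SmoothAtScale (w k) V n) (e : ι → ℤ) (d : κ → ℤ) :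
    ‖∑ k ∈ S, ∑ l ∈ T, divDiff (w k) (e k) (d l) * ⟪p k, K (q l)⟫_ℂ‖ ≤
      16 * V / n * ‖K‖ * X * Y := by
  classical
  have hn0 : (n : ℝ) ≠ 0 := by positivity
  obtain ⟨F, a, a', b, b', h, ha, ha', hb, hb'⟩ :=
    exists_divDiff_factorization hn w hw e (T.image d)
  -- Both factorizations have row bound times column bound equal to `64 V² / n² = (8 V / n)²`, so
  -- each contributes `8 V / n`.
  have h1 := norm_schur_le S T F p q hp hq hX hY hpY hqX K a (fun j l => b j (d l))
    (t := 8 * V / n) (by positivity) (by positivity) (by positivity) (fun k _ => ha k)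
    (fun l hl => hb _ (Finset.mem_image_of_mem d hl)) (le_of_eq (by field_simp; ring))
  have h2 := norm_schur_le S T F p q hp hq hX hY hpY hqX K a' (fun j l => b' j (d l))
    (t := 8 * V / n) (by positivity) (by positivity) (by positivity) (fun k _ => ha' k)
    (fun l hl => hb' _ (Finset.mem_image_of_mem d hl)) (le_of_eq (by field_simp; ring))
  have h3 : ∑ k ∈ S, ∑ l ∈ T, divDiff (w k) (e k) (d l) * ⟪p k, K (q l)⟫_ℂ =
      ∑ k ∈ S, ∑ l ∈ T, (∑ j ∈ F, a j k * b j (d l)) * ⟪p k, K (q l)⟫_ℂ +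
      ∑ k ∈ S, ∑ l ∈ T, (∑ j ∈ F, a' j k * b' j (d l)) * ⟪p k, K (q l)⟫_ℂ := by
    rw [← Finset.sum_add_distrib]
    refine Finset.sum_congr rfl fun k _ => ?_
    rw [← Finset.sum_add_distrib]
    refine Finset.sum_congr rfl fun l hl => ?_
    rw [h k _ (Finset.mem_image_of_mem d hl), add_mul]
  rw [h3]
  refine (norm_add_le _ _).trans ((add_le_add h1 h2).trans (le_of_eq (by ring)))

variable [CompleteSpace H]

/-- Complex conjugation of the form exchanges the two families and replaces `K` by its adjoint,
which reduces this to `norm_sum_divDiff_left_le`. -/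
theorem norm_sum_divDiff_right_le {ι κ : Type*} (S : Finset ι) (T : Finset κ)
    (p : ι → H) (q : κ → H) (hp : ∀ i j, i ≠ j → ⟪p i, p j⟫_ℂ = 0)
    (hq : ∀ i j, i ≠ j → ⟪q i, q j⟫_ℂ = 0) {X Y V : ℝ} (hX : 0 ≤ X) (hY : 0 ≤ Y) (hV : 0 ≤ V)
    (hpY : ∑ k ∈ S, ‖p k‖ ^ 2 ≤ Y ^ 2) (hqX : ∑ l ∈ T, ‖q l‖ ^ 2 ≤ X ^ 2)
    (K : H →L[ℂ] H) {n : ℕ} (hn : 1 ≤ n) (w : κ → ℤ → ℂ)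
    (hw : ∀ l, SmoothAtScale (w l) V n) (d : κ → ℤ) (e : ι → ℤ) :
    ‖∑ k ∈ S, ∑ l ∈ T, divDiff (w l) (d l) (e k) * ⟪p k, K (q l)⟫_ℂ‖ ≤
      16 * V / n * ‖K‖ * X * Y := by
  have h := norm_sum_divDiff_left_le T S q p hq hp hY hX hV hqX hpY
    (ContinuousLinearMap.adjoint K) hn (fun l j => (starRingEnd ℂ) (w l j))
    (fun l => ⟨fun j => by simpa using (hw l).bound j, fun j => by
      simpa only [← map_sub, RCLike.norm_conj] using (hw l).diff j, fun j => by
      have := (hw l).diff₂ j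
      rw [← RCLike.norm_conj] at this
      simpa [map_ofNat] using this⟩) d e
  rw [LinearIsometryEquiv.norm_map, ← RCLike.norm_conj] at h
  refine le_trans (le_of_eq ?_) (h.trans (le_of_eq (by ring)))
  congr 1
  rw [map_sum, Finset.sum_comm]
  refine Finset.sum_congr rfl fun k _ => ?_
  rw [map_sum]
  refine Finset.sum_congr rfl fun l _ => ?_
  rw [map_mul, inner_conj_symm, ContinuousLinearMap.adjoint_inner_left]
  congr 1
  unfold divDiff
  split_ifs <;> simp

/-- Commutator-type estimate for a lattice function that is bounded by `V` and smooth at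
scale `n` in both coordinates. -/
theorem norm_sum_sub_le_of_smooth (S T : Finset (ℤ × ℤ))
    (p q : ℤ × ℤ → H) (hp : ∀ i j, i ≠ j → ⟪p i, p j⟫_ℂ = 0)
    (hq : ∀ i j, i ≠ j → ⟪q i, q j⟫_ℂ = 0) {X Y V κ : ℝ} (hX : 0 ≤ X) (hY : 0 ≤ Y) (hV : 0 ≤ V)
    (hpY : ∑ k ∈ S, ‖p k‖ ^ 2 ≤ Y ^ 2) (hqX : ∑ l ∈ T, ‖q l‖ ^ 2 ≤ X ^ 2)
    (K₁ K₂ : H →L[ℂ] H) (hK₁ : ‖K₁‖ ≤ κ) (hK₂ : ‖K₂‖ ≤ κ)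
    (h₁ : ∀ k l, ⟪p k, K₁ (q l)⟫_ℂ = ((k.1 : ℂ) - l.1) * ⟪p k, q l⟫_ℂ)
    (h₂ : ∀ k l, ⟪p k, K₂ (q l)⟫_ℂ = ((k.2 : ℂ) - l.2) * ⟪p k, q l⟫_ℂ)
    {n : ℕ} (hn : 1 ≤ n) (h : ℤ × ℤ → ℂ)
    (hh₁ : ∀ j, SmoothAtScale (fun i => h (i, j)) V n)
    (hh₂ : ∀ i, SmoothAtScale (fun j => h (i, j)) V n) :
    ‖∑ k ∈ S, ∑ l ∈ T, (h k - h l) * ⟪p k, q l⟫_ℂ‖ ≤ 32 * V / n * κ * X * Y := by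
  have e₁ := norm_sum_divDiff_left_le S T p q hp hq hX hY hV hpY hqX K₁ hn
    (fun k i => h (i, k.2)) (fun k => hh₁ k.2) (fun k => k.1) (fun l => l.1)
  have e₂ := norm_sum_divDiff_right_le S T p q hp hq hX hY hV hpY hqX K₂ hn
    (fun l j => h (l.1, j)) (fun l => hh₂ l.1) (fun l => l.2) (fun k => k.2)
  -- The path from `k` to `l` turns at `(l.1, k.2)`. The first leg depends on `k` and `l.1` only,
  -- the second on `l` and `k.2` only, so each is a one-variable divided difference of a family
  -- indexed by one side.
  have e₃ : ∑ k ∈ S, ∑ l ∈ T, (h k - h l) * ⟪p k, q l⟫_ℂ =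
      ∑ k ∈ S, ∑ l ∈ T, divDiff (fun i => h (i, k.2)) k.1 l.1 * ⟪p k, K₁ (q l)⟫_ℂ +
      ∑ k ∈ S, ∑ l ∈ T, divDiff (fun j => h (l.1, j)) l.2 k.2 * ⟪p k, K₂ (q l)⟫_ℂ := by
    rw [← Finset.sum_add_distrib]
    refine Finset.sum_congr rfl fun k _ => ?_
    rw [← Finset.sum_add_distrib]
    refine Finset.sum_congr rfl fun l _ => ?_
    rw [h₁, h₂]
    have f₁ := divDiff_mul (fun i => h (i, k.2)) k.1 l.1
    have f₂ := divDiff_mul (fun j => h (l.1, j)) l.2 k.2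
    simp only [Prod.mk.eta] at f₁ f₂
    linear_combination (-⟪p k, q l⟫_ℂ) * f₁ + ⟪p k, q l⟫_ℂ * f₂
  rw [e₃]
  refine (norm_add_le _ _).trans ((add_le_add e₁ e₂).trans ?_)
  have : ∀ c : ℝ, c ≤ κ → 16 * V / n * c * X * Y ≤ 16 * V / n * κ * X * Y := fun c hc => by gcongr
  linarith [this _ hK₁, this _ hK₂, show 32 * V / n * κ * X * Y =
    16 * V / n * κ * X * Y + 16 * V / n * κ * X * Y by ring]

end Lattice

end LatticeSchur
end

noncomputable section

namespace LatticeSchur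

/-! ### Smoothing of Hölder functions on the lattice at scale `n`. -/

section Averages

/-- Hölder condition on the lattice with respect to the sup norm. -/
def LatticeHolder (L α : ℝ) (g : ℤ × ℤ → ℂ) : Prop :=
  ∀ k l, ‖g k - g l‖ ≤ L * ‖k - l‖ ^ α

/-- The average of `g` over `n` consecutive points in the direction `e`. -/
def dirAvg (e : ℤ × ℤ) (n : ℕ) (g : ℤ × ℤ → ℂ) (k : ℤ × ℤ) : ℂ :=
  (n : ℂ)⁻¹ * ∑ a ∈ Finset.range n, g (k + a • e)

variable {L α : ℝ} {g : ℤ × ℤ → ℂ} {e : ℤ × ℤ} {n : ℕ}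

theorem dirAvg_one (e : ℤ × ℤ) (g : ℤ × ℤ → ℂ) : dirAvg e 1 g = g := by
  ext k; simp [dirAvg]

theorem dirAvg_comm (e e' : ℤ × ℤ) (n : ℕ) (g : ℤ × ℤ → ℂ) :
    dirAvg e n (dirAvg e' n g) = dirAvg e' n (dirAvg e n g) := by
  ext k
  simp only [dirAvg, ← Finset.mul_sum]
  rw [Finset.sum_comm]
  simp only [add_right_comm]

theorem norm_avg_le {n : ℕ} (hn : 1 ≤ n) {v : ℕ → ℂ} {c : ℝ} (hv : ∀ a < n, ‖v a‖ ≤ c) :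
    ‖(n : ℂ)⁻¹ * ∑ a ∈ Finset.range n, v a‖ ≤ c := by
  have hn0 : (0 : ℝ) < n := by exact_mod_cast hn
  rw [norm_mul, norm_inv, Complex.norm_natCast, inv_mul_le_iff₀ hn0]
  refine (norm_sum_le_of_le _ fun a ha => hv a (Finset.mem_range.1 ha)).trans ?_
  simp

theorem LatticeHolder.dirAvg (hg : LatticeHolder L α g) (e : ℤ × ℤ) (hn : 1 ≤ n) :
    LatticeHolder L α (dirAvg e n g) := by
  intro k l
  simp only [LatticeSchur.dirAvg]
  rw [← mul_sub, ← Finset.sum_sub_distrib]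
  refine norm_avg_le hn fun a _ => ?_
  simpa using hg (k + a • e) (l + a • e)

theorem LatticeHolder.norm_add_smul_sub_le (hg : LatticeHolder L α g) (hL : 0 ≤ L) (hα : 0 ≤ α)
    (he : ‖e‖ ≤ 1) {a : ℕ} (ha : a ≤ n) (k : ℤ × ℤ) : ‖g (k + a • e) - g k‖ ≤ L * (n : ℝ) ^ α := by
  refine (hg _ _).trans ?_
  rw [add_sub_cancel_left]
  have : ‖a • e‖ ≤ n := by
    refine (norm_nsmul_le).trans ?_
    calc (a : ℝ) * ‖e‖ ≤ a * 1 := by gcongr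
      _ ≤ n := by rw [mul_one]; exact_mod_cast ha
  gcongr

theorem LatticeHolder.norm_dirAvg_sub_le (hg : LatticeHolder L α g) (hL : 0 ≤ L) (hα : 0 ≤ α)
    (he : ‖e‖ ≤ 1) (hn : 1 ≤ n) (k : ℤ × ℤ) :
    ‖LatticeSchur.dirAvg e n g k - g k‖ ≤ L * (n : ℝ) ^ α := by
  have hn0 : (n : ℂ) ≠ 0 := by exact_mod_cast (by omega : n ≠ 0)
  have : LatticeSchur.dirAvg e n g k - g k =
      (n : ℂ)⁻¹ * ∑ a ∈ Finset.range n, (g (k + a • e) - g k) := by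
    simp [LatticeSchur.dirAvg, mul_sub, hn0]
  rw [this]
  exact norm_avg_le hn fun a ha => hg.norm_add_smul_sub_le hL hα he ha.le k

/-- The two windows overlap except at their ends: a unit step of the average is a step of length
`n`, divided by `n`. -/
theorem dirAvg_step (e : ℤ × ℤ) (n : ℕ) (g : ℤ × ℤ → ℂ) (k : ℤ × ℤ) :
    dirAvg e n g (k + e) - dirAvg e n g k = (n : ℂ)⁻¹ * (g (k + n • e) - g k) := by
  simp only [dirAvg]
  rw [← mul_sub, ← Finset.sum_sub_distrib]
  have := Finset.sum_range_sub (fun a : ℕ => g (k + a • e)) n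
  simp only [zero_smul, add_zero] at this
  rw [← this]
  congr 1
  refine Finset.sum_congr rfl fun a _ => ?_
  rw [add_smul, one_smul, add_assoc, add_comm e]

theorem LatticeHolder.norm_dirAvg_step_le (hg : LatticeHolder L α g) (hL : 0 ≤ L) (hα : 0 ≤ α)
    (he : ‖e‖ ≤ 1) (k : ℤ × ℤ) :
    ‖LatticeSchur.dirAvg e n g (k + e) - LatticeSchur.dirAvg e n g k‖ ≤ L * (n : ℝ) ^ α / n := by
  rw [dirAvg_step, norm_mul, norm_inv, Complex.norm_natCast, div_eq_inv_mul]
  gcongr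
  exact hg.norm_add_smul_sub_le hL hα he le_rfl k

/-- Each average turns one unit difference into a difference of length `n` divided by `n`. Two
averages in one direction are therefore needed to control second differences. -/
theorem LatticeHolder.norm_dirAvg_dirAvg_step₂_le (hg : LatticeHolder L α g) (hL : 0 ≤ L)
    (hα : 0 ≤ α) (he : ‖e‖ ≤ 1) (k : ℤ × ℤ) :
    ‖LatticeSchur.dirAvg e n (LatticeSchur.dirAvg e n g) (k + e + e) -
      2 * LatticeSchur.dirAvg e n (LatticeSchur.dirAvg e n g) (k + e) +
      LatticeSchur.dirAvg e n (LatticeSchur.dirAvg e n g) k‖ ≤ 2 * (L * (n : ℝ) ^ α / n ^ 2) := by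
  set G := LatticeSchur.dirAvg e n g
  have h : LatticeSchur.dirAvg e n G (k + e + e) - 2 * LatticeSchur.dirAvg e n G (k + e) +
      LatticeSchur.dirAvg e n G k = (n : ℂ)⁻¹ * ((n : ℂ)⁻¹ *
        ((g (k + n • e + n • e) - g (k + n • e)) - (g (k + n • e) - g k))) := by
    have h1 := dirAvg_step e n G (k + e)
    have h2 := dirAvg_step e n G k
    have h3 := dirAvg_step e n g (k + n • e)
    have h4 := dirAvg_step e n g k
    rw [mul_sub, ← h3, ← h4]
    rw [add_right_comm k e (n • e)] at h1
    linear_combination h1 - h2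
  rw [h, norm_mul, norm_mul, norm_inv, Complex.norm_natCast]
  have h5 := norm_sub_le (g (k + n • e + n • e) - g (k + n • e)) (g (k + n • e) - g k)
  have h6 := hg.norm_add_smul_sub_le hL hα he (le_refl n) (k + n • e)
  have h7 := hg.norm_add_smul_sub_le hL hα he (le_refl n) k
  calc _ ≤ (n : ℝ)⁻¹ * ((n : ℝ)⁻¹ * (L * (n : ℝ) ^ α + L * (n : ℝ) ^ α)) := by gcongr; linarith
    _ = _ := by ring

/-- The double average over `n` points in both coordinate directions. -/
def smoothing (n : ℕ) (f : ℤ × ℤ → ℂ) : ℤ × ℤ → ℂ :=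
  dirAvg (1, 0) n (dirAvg (1, 0) n (dirAvg (0, 1) n (dirAvg (0, 1) n f)))

/-- Since averages commute, either direction may be taken outermost, where the step estimates apply.
-/
theorem smoothing_eq (n : ℕ) (f : ℤ × ℤ → ℂ) : smoothing n f =
    dirAvg (0, 1) n (dirAvg (0, 1) n (dirAvg (1, 0) n (dirAvg (1, 0) n f))) := by
  unfold smoothing
  rw [dirAvg_comm (1, 0) (0, 1) n (dirAvg (0, 1) n f), dirAvg_comm (1, 0) (0, 1) n f,
    dirAvg_comm (1, 0) (0, 1) n (dirAvg (0, 1) n _), dirAvg_comm (1, 0) (0, 1) n (dirAvg (1, 0) n f)]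

theorem smoothing_one (f : ℤ × ℤ → ℂ) : smoothing 1 f = f := by
  simp [smoothing, dirAvg_one]

theorem norm_e₁ : ‖((1, 0) : ℤ × ℤ)‖ ≤ 1 := by simp [Prod.norm_def]
theorem norm_e₂ : ‖((0, 1) : ℤ × ℤ)‖ ≤ 1 := by simp [Prod.norm_def]

variable {f : ℤ × ℤ → ℂ} (hf : LatticeHolder L α f) (hL : 0 ≤ L) (hα : 0 ≤ α)
include hf hL hα

theorem norm_smoothing_sub_le (hn : 1 ≤ n) (k : ℤ × ℤ) :
    ‖smoothing n f k - f k‖ ≤ 4 * (L * (n : ℝ) ^ α) := by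
  have f1 := hf.dirAvg (0, 1) hn
  have f2 := f1.dirAvg (0, 1) hn
  have f3 := f2.dirAvg (1, 0) hn
  have h0 := hf.norm_dirAvg_sub_le hL hα norm_e₂ hn k
  have h1 := f1.norm_dirAvg_sub_le hL hα norm_e₂ hn k
  have h2 := f2.norm_dirAvg_sub_le hL hα norm_e₁ hn k
  have h3 := f3.norm_dirAvg_sub_le hL hα norm_e₁ hn k
  have t1 := norm_add_le (dirAvg (0, 1) n f k - f k)
    (dirAvg (0, 1) n (dirAvg (0, 1) n f) k - dirAvg (0, 1) n f k)
  have t2 := norm_add_le (dirAvg (1, 0) n (dirAvg (0, 1) n (dirAvg (0, 1) n f)) k -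
    dirAvg (0, 1) n (dirAvg (0, 1) n f) k) (smoothing n f k -
      dirAvg (1, 0) n (dirAvg (0, 1) n (dirAvg (0, 1) n f)) k)
  have t3 := norm_add_le (dirAvg (0, 1) n f k - f k + (dirAvg (0, 1) n (dirAvg (0, 1) n f) k -
    dirAvg (0, 1) n f k)) (dirAvg (1, 0) n (dirAvg (0, 1) n (dirAvg (0, 1) n f)) k -
    dirAvg (0, 1) n (dirAvg (0, 1) n f) k + (smoothing n f k -
      dirAvg (1, 0) n (dirAvg (0, 1) n (dirAvg (0, 1) n f)) k))
  have : smoothing n f k - f k = dirAvg (0, 1) n f k - f k +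
    (dirAvg (0, 1) n (dirAvg (0, 1) n f) k -
    dirAvg (0, 1) n f k) + (dirAvg (1, 0) n (dirAvg (0, 1) n (dirAvg (0, 1) n f)) k -
    dirAvg (0, 1) n (dirAvg (0, 1) n f) k + (smoothing n f k -
      dirAvg (1, 0) n (dirAvg (0, 1) n (dirAvg (0, 1) n f)) k)) := by ring
  rw [this]
  change ‖smoothing n f k - _‖ ≤ _ at h3
  linarith

theorem norm_smoothing_step₁_le (hn : 1 ≤ n) (i j : ℤ) :
    ‖smoothing n f (i + 1, j) - smoothing n f (i, j)‖ ≤ L * (n : ℝ) ^ α / n := by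
  have := (((hf.dirAvg (0, 1) hn).dirAvg (0, 1) hn).dirAvg (1, 0) hn).norm_dirAvg_step_le
    (n := n) hL hα norm_e₁ (i, j)
  unfold smoothing
  simpa using this

theorem norm_smoothing_step₂_le (hn : 1 ≤ n) (i j : ℤ) :
    ‖smoothing n f (i, j + 1) - smoothing n f (i, j)‖ ≤ L * (n : ℝ) ^ α / n := by
  have := (((hf.dirAvg (1, 0) hn).dirAvg (1, 0) hn).dirAvg (0, 1) hn).norm_dirAvg_step_le
    (n := n) hL hα norm_e₂ (i, j)
  rw [smoothing_eq]
  simpa using this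

theorem norm_smoothing_step₁₁_le (hn : 1 ≤ n) (i j : ℤ) :
    ‖smoothing n f (i + 2, j) - 2 * smoothing n f (i + 1, j) + smoothing n f (i, j)‖ ≤
      2 * (L * (n : ℝ) ^ α / n ^ 2) := by
  have := ((hf.dirAvg (0, 1) hn).dirAvg (0, 1) hn).norm_dirAvg_dirAvg_step₂_le
    (n := n) hL hα norm_e₁ (i, j)
  unfold smoothing
  simpa [add_assoc] using this

theorem norm_smoothing_step₂₂_le (hn : 1 ≤ n) (i j : ℤ) :
    ‖smoothing n f (i, j + 2) - 2 * smoothing n f (i, j + 1) + smoothing n f (i, j)‖ ≤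
      2 * (L * (n : ℝ) ^ α / n ^ 2) := by
  have := ((hf.dirAvg (1, 0) hn).dirAvg (1, 0) hn).norm_dirAvg_dirAvg_step₂_le
    (n := n) hL hα norm_e₂ (i, j)
  rw [smoothing_eq]
  simpa [add_assoc] using this

/-- For `α < 1` the factor `n ^ α / n` tends to `0`; this removes the remainder of the telescoping
over scales. -/
theorem norm_smoothing_sub_smoothing_le (hn : 1 ≤ n) (k l : ℤ × ℤ) :
    ‖smoothing n f k - smoothing n f l‖ ≤
      L * (n : ℝ) ^ α / n * (|(k.1 : ℝ) - l.1| + |(k.2 : ℝ) - l.2|) := by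
  have h1 := norm_sub_le_of_step (g := fun i => smoothing n f (i, k.2)) (a := l.1) (b := k.1)
    fun i _ _ => norm_smoothing_step₁_le hf hL hα hn i k.2
  have h2 := norm_sub_le_of_step (g := fun j => smoothing n f (l.1, j)) (a := l.2) (b := k.2)
    fun j _ _ => norm_smoothing_step₂_le hf hL hα hn l.1 j
  have h3 := norm_add_le (smoothing n f (k.1, k.2) - smoothing n f (l.1, k.2))
    (smoothing n f (l.1, k.2) - smoothing n f (l.1, l.2))
  rw [sub_add_sub_cancel] at h3
  linarith

/-- The constant `12` is `4 + 4 · 2`: each smoothing is within `4 L n^α` of `f` at its own scale,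
and `(2n)^α ≤ 2 n^α`. The bounds on differences need less. -/
theorem smoothAtScale_smoothing_sub (hα₁ : α ≤ 1) (hn : 1 ≤ n) :
    (∀ j, SmoothAtScale (fun i => smoothing n f (i, j) - smoothing (2 * n) f (i, j))
      (12 * (L * (n : ℝ) ^ α)) n) ∧
    (∀ i, SmoothAtScale (fun j => smoothing n f (i, j) - smoothing (2 * n) f (i, j))
      (12 * (L * (n : ℝ) ^ α)) n) := by
  have hn2 : 1 ≤ 2 * n := by omega
  have hn0 : (0 : ℝ) < n := by exact_mod_cast hn
  set W := L * (n : ℝ) ^ α with hW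
  have hW0 : 0 ≤ W := by positivity
  have hW2 : L * ((2 * n : ℕ) : ℝ) ^ α ≤ 2 * W := by
    push_cast
    rw [Real.mul_rpow (by norm_num) hn0.le, hW]
    have : (2 : ℝ) ^ α ≤ 2 := by
      simpa using Real.rpow_le_rpow_of_exponent_le (by norm_num : (1 : ℝ) ≤ 2) hα₁
    calc L * (2 ^ α * (n : ℝ) ^ α) ≤ L * (2 * (n : ℝ) ^ α) := by gcongr
      _ = _ := by ring
  have hb : ∀ k, ‖smoothing n f k - smoothing (2 * n) f k‖ ≤ 12 * W := fun k => by
    have h1 := norm_smoothing_sub_le hf hL hα hn k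
    have h2 := norm_smoothing_sub_le hf hL hα hn2 k
    have h3 := norm_sub_le (smoothing n f k - f k) (smoothing (2 * n) f k - f k)
    rw [sub_sub_sub_cancel_right] at h3
    linarith
  have e1 : L * ((2 * n : ℕ) : ℝ) ^ α / (2 * n : ℕ) ≤ W / n := by
    calc _ ≤ 2 * W / (2 * n : ℕ) := by gcongr
      _ = _ := by push_cast; field_simp
  have e2 : L * ((2 * n : ℕ) : ℝ) ^ α / (2 * n : ℕ) ^ 2 ≤ W / n ^ 2 := by
    calc _ ≤ 2 * W / (2 * n : ℕ) ^ 2 := by gcongr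
      _ = W / n ^ 2 / 2 := by push_cast; field_simp
      _ ≤ _ := by linarith [show 0 ≤ W / n ^ 2 by positivity]
  have p1 : 0 ≤ W / n := by positivity
  have p2 : 0 ≤ W / n ^ 2 := by positivity
  have r1 : 12 * W / n = 12 * (W / n) := by ring
  have r2 : 12 * W / n ^ 2 = 12 * (W / n ^ 2) := by ring
  constructor
  · refine fun j => ⟨fun i => hb _, fun i => ?_, fun i => ?_⟩
    · have h1 := norm_smoothing_step₁_le hf hL hα hn i j
      have h2 := norm_smoothing_step₁_le hf hL hα hn2 i j
      have h3 := norm_sub_le (smoothing n f (i + 1, j) - smoothing n f (i, j))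
        (smoothing (2 * n) f (i + 1, j) - smoothing (2 * n) f (i, j))
      rw [sub_sub_sub_comm, r1]
      linarith
    · have h1 := norm_smoothing_step₁₁_le hf hL hα hn i j
      have h2 := norm_smoothing_step₁₁_le hf hL hα hn2 i j
      have h3 := norm_sub_le
        (smoothing n f (i + 2, j) - 2 * smoothing n f (i + 1, j) + smoothing n f (i, j))
        (smoothing (2 * n) f (i + 2, j) - 2 * smoothing (2 * n) f (i + 1, j) +
          smoothing (2 * n) f (i, j))
      rw [r2]
      refine le_trans (le_of_eq ?_) (h3.trans (by linarith))
      congr 1; ring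
  · refine fun i => ⟨fun j => hb _, fun j => ?_, fun j => ?_⟩
    · have h1 := norm_smoothing_step₂_le hf hL hα hn i j
      have h2 := norm_smoothing_step₂_le hf hL hα hn2 i j
      have h3 := norm_sub_le (smoothing n f (i, j + 1) - smoothing n f (i, j))
        (smoothing (2 * n) f (i, j + 1) - smoothing (2 * n) f (i, j))
      rw [sub_sub_sub_comm, r1]
      linarith
    · have h1 := norm_smoothing_step₂₂_le hf hL hα hn i j
      have h2 := norm_smoothing_step₂₂_le hf hL hα hn2 i j
      have h3 := norm_sub_le
        (smoothing n f (i, j + 2) - 2 * smoothing n f (i, j + 1) + smoothing n f (i, j))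
        (smoothing (2 * n) f (i, j + 2) - 2 * smoothing (2 * n) f (i, j + 1) +
          smoothing (2 * n) f (i, j))
      rw [r2]
      refine le_trans (le_of_eq ?_) (h3.trans (by linarith))
      congr 1; ring

end Averages

/-! ### Summation over dyadic scales. -/

section Holder

variable {H : Type*} [NormedAddCommGroup H] [InnerProductSpace ℂ H] [CompleteSpace H]

/-- Bernoulli's inequality for the exponent `1 - α` gives `2 ^ (α - 1) ≤ 1 - (1 - α) / 2`, which
bounds the geometric series. -/
theorem sum_geometric_rpow_le {α : ℝ} (hα₀ : 0 ≤ α) (hα₁ : α < 1) (m : ℕ) :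
    ∑ i ∈ Finset.range m, ((2 : ℝ) ^ (α - 1)) ^ i ≤ 2 * (1 - α)⁻¹ := by
  have hr0 : (0 : ℝ) < 2 ^ (α - 1) := by positivity
  have hr : (2 : ℝ) ^ (α - 1) ≤ 1 - (1 - α) / 2 := by
    have := rpow_one_add_le_one_add_mul_self (s := -1 / 2) (by norm_num) (p := 1 - α)
      (by linarith) (by linarith)
    have h2 : (1 + -1 / 2 : ℝ) ^ (1 - α) = 2 ^ (α - 1) := by
      rw [show (1 + -1 / 2 : ℝ) = 2⁻¹ by norm_num, Real.inv_rpow (by norm_num),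
        ← Real.rpow_neg (by norm_num)]
      congr 1; ring
    rw [h2] at this
    linarith
  have h1 : ∑ i ∈ Finset.range m, ((2 : ℝ) ^ (α - 1)) ^ i ≤ (1 - (2 : ℝ) ^ (α - 1))⁻¹ := by
    rw [← tsum_geometric_of_lt_one hr0.le (by linarith)]
    exact (summable_geometric_of_lt_one hr0.le (by linarith)).sum_le_tsum _
      fun _ _ => by positivity
  refine h1.trans ?_
  have h2 : 0 < (1 - α) / 2 := by linarith
  calc _ ≤ ((1 - α) / 2)⁻¹ := inv_anti₀ h2 (by linarith)
    _ = _ := by rw [inv_div, div_eq_mul_inv]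

/-- Commutator-type estimate for a Hölder function on the lattice. -/
theorem norm_sum_sub_le_of_holder (S T : Finset (ℤ × ℤ))
    (p q : ℤ × ℤ → H) (hp : ∀ i j, i ≠ j → ⟪p i, p j⟫_ℂ = 0)
    (hq : ∀ i j, i ≠ j → ⟪q i, q j⟫_ℂ = 0) {X Y κ : ℝ} (hX : 0 ≤ X) (hY : 0 ≤ Y)
    (hpY : ∑ k ∈ S, ‖p k‖ ^ 2 ≤ Y ^ 2) (hqX : ∑ l ∈ T, ‖q l‖ ^ 2 ≤ X ^ 2)
    (K₁ K₂ : H →L[ℂ] H) (hK₁ : ‖K₁‖ ≤ κ) (hK₂ : ‖K₂‖ ≤ κ)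
    (h₁ : ∀ k l, ⟪p k, K₁ (q l)⟫_ℂ = ((k.1 : ℂ) - l.1) * ⟪p k, q l⟫_ℂ)
    (h₂ : ∀ k l, ⟪p k, K₂ (q l)⟫_ℂ = ((k.2 : ℂ) - l.2) * ⟪p k, q l⟫_ℂ)
    {L α : ℝ} (hL : 0 ≤ L) (hα₀ : 0 ≤ α) (hα₁ : α < 1) {f : ℤ × ℤ → ℂ}
    (hf : LatticeHolder L α f) :
    ‖∑ k ∈ S, ∑ l ∈ T, (f k - f l) * ⟪p k, q l⟫_ℂ‖ ≤ 768 * (1 - α)⁻¹ * L * κ * X * Y := by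
  have hκ : 0 ≤ κ := (norm_nonneg _).trans hK₁
  set r : ℝ := 2 ^ (α - 1) with hr
  have hr0 : 0 < r := by positivity
  have hr1 : r < 1 := Real.rpow_lt_one_of_one_lt_of_neg (by norm_num) (by linarith)
  have hpow : ∀ m : ℕ, (((2 ^ m : ℕ) : ℝ)) ^ α / (2 ^ m : ℕ) = r ^ m := fun m => by
    have h2 : (0 : ℝ) < ((2 ^ m : ℕ) : ℝ) := by positivity
    rw [← Real.rpow_sub_one h2.ne']
    push_cast
    rw [hr, ← Real.rpow_natCast, ← Real.rpow_natCast, ← Real.rpow_mul (by norm_num),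
      ← Real.rpow_mul (by norm_num), mul_comm]
  let Q : (ℤ × ℤ → ℂ) → ℂ := fun h => ∑ k ∈ S, ∑ l ∈ T, (h k - h l) * ⟪p k, q l⟫_ℂ
  have hQsub : ∀ h h' : ℤ × ℤ → ℂ, Q (fun k => h k - h' k) = Q h - Q h' := fun h h' => by
    simp only [Q, ← Finset.sum_sub_distrib]
    exact Finset.sum_congr rfl fun k _ => Finset.sum_congr rfl fun l _ => by ring
  -- The constant is `384 = 32 · 12`, from `norm_sum_sub_le_of_smooth` and
  -- `smoothAtScale_smoothing_sub`.
  have hstep : ∀ m : ℕ, ‖Q (smoothing (2 ^ m) f) - Q (smoothing (2 ^ (m + 1)) f)‖ ≤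
      384 * L * κ * X * Y * r ^ m := fun m => by
    have hn : 1 ≤ 2 ^ m := Nat.one_le_two_pow
    obtain ⟨g1, g2⟩ := smoothAtScale_smoothing_sub hf hL hα₀ hα₁.le hn
    rw [← hQsub, pow_succ']
    refine (norm_sum_sub_le_of_smooth S T p q hp hq hX hY (by positivity) hpY hqX K₁ K₂ hK₁ hK₂
      h₁ h₂ hn (fun k => smoothing (2 ^ m) f k - smoothing (2 * 2 ^ m) f k) g1 g2).trans
      (le_of_eq ?_)
    rw [← hpow]; ring
  -- The telescoping starts at scale `1`, where smoothing is the identity, so only coarse scales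
  -- occur.
  have hsum : ∀ m : ℕ, ‖Q f‖ ≤ 384 * L * κ * X * Y * ∑ i ∈ Finset.range m, r ^ i +
      ‖Q (smoothing (2 ^ m) f)‖ := fun m => by
    induction m with
    | zero => simp [smoothing_one]
    | succ m ih =>
      rw [Finset.sum_range_succ, mul_add]
      have h1 := hstep m
      have h2 := norm_sub_norm_le (Q (smoothing (2 ^ m) f)) (Q (smoothing (2 ^ (m + 1)) f))
      linarith
  have hlim : Tendsto (fun m : ℕ => ‖Q (smoothing (2 ^ m) f)‖) atTop (𝓝 0) := by
    have h1 : Tendsto (fun m : ℕ => Q (smoothing (2 ^ m) f)) atTop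
        (𝓝 (∑ k ∈ S, ∑ l ∈ T, 0 * ⟪p k, q l⟫_ℂ)) := by
      refine tendsto_finsetSum _ fun k _ => tendsto_finsetSum _ fun l _ => ?_
      refine Tendsto.mul_const _ ?_
      refine squeeze_zero_norm (a := fun m : ℕ =>
        L * (|(k.1 : ℝ) - l.1| + |(k.2 : ℝ) - l.2|) * r ^ m) (fun m => ?_) ?_
      · refine (norm_smoothing_sub_smoothing_le hf hL hα₀ Nat.one_le_two_pow k l).trans
          (le_of_eq ?_)
        rw [← hpow]; ring
      · simpa using (tendsto_pow_atTop_nhds_zero_of_lt_one hr0.le hr1).const_mul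
          (L * (|(k.1 : ℝ) - l.1| + |(k.2 : ℝ) - l.2|))
    simpa using h1.norm
  have hfin : ∀ m : ℕ, ‖Q f‖ ≤ 768 * (1 - α)⁻¹ * L * κ * X * Y +
      ‖Q (smoothing (2 ^ m) f)‖ := fun m => by
    refine (hsum m).trans ?_
    have h3 := sum_geometric_rpow_le hα₀ hα₁ m
    have h4 : 0 ≤ 384 * L * κ * X * Y := by positivity
    have h5 := mul_le_mul_of_nonneg_left h3 h4
    linarith
  have := ge_of_tendsto' (hlim.const_add (768 * (1 - α)⁻¹ * L * κ * X * Y)) hfin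
  simpa using this

end Holder

end LatticeSchur
end

noncomputable section

/-! ### Integration with respect to a spectral measure. -/

namespace SpectralMeasure

variable {H : Type*} [NormedAddCommGroup H] [InnerProductSpace ℂ H] [CompleteSpace H]
variable (E : SpectralMeasure H)

theorem mem_integral_domain {f : ℂ → ℂ} {hf : Measurable f} {x : H} :
    x ∈ (E.integral f hf).domain ↔ MemLp f 2 (E.scalarMeasure x) := Iff.rfl

theorem tendsto_approx_integral {f : ℂ → ℂ} (hf : Measurable f) (x : (E.integral f hf).domain) :
    Tendsto (fun n => E.simpleIntegral (approx f hf n) x) atTop (𝓝 (E.integral f hf x)) :=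
  (E.exists_tendsto_simpleIntegral hf x.2).choose_spec

theorem tendsto_eLpNorm_approx {f : ℂ → ℂ} (hf : Measurable f) {x : H}
    (hx : MemLp f 2 (E.scalarMeasure x)) :
    Tendsto (fun n => eLpNorm (⇑(approx f hf n) - f) 2 (E.scalarMeasure x)) atTop (𝓝 0) :=
  SimpleFunc.tendsto_approxOn_Lp_eLpNorm hf _ (by simp) (by simp) (by simpa using hx.2)

/-- `∫ f dE` is the limit of `∫ s_n dE` for any simple functions with `s_n → f` in `L²`. -/
theorem tendsto_integral_of_tendsto_eLpNorm {f : ℂ → ℂ} (hf : Measurable f)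
    (x : (E.integral f hf).domain) {s : ℕ → SimpleFunc ℂ ℂ}
    (hs : Tendsto (fun n => eLpNorm (⇑(s n) - f) 2 (E.scalarMeasure x)) atTop (𝓝 0)) :
    Tendsto (fun n => E.simpleIntegral (s n) x) atTop (𝓝 (E.integral f hf x)) := by
  have h1 := E.tendsto_approx_integral hf x
  have h2 := E.tendsto_eLpNorm_approx hf x.2
  have h3 : Tendsto (fun n => E.simpleIntegral (s n) x - E.simpleIntegral (approx f hf n) x)
      atTop (𝓝 0) := by
    rw [tendsto_zero_iff_enorm_tendsto_zero]
    refine tendsto_of_tendsto_of_tendsto_of_le_of_le tendsto_const_nhds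
      (by simpa using hs.add h2) (fun _ => zero_le) fun n => ?_
    rw [← E.simpleIntegral_sub, E.enorm_simpleIntegral, SimpleFunc.coe_sub,
      show ⇑(s n) - ⇑(approx f hf n) = (⇑(s n) - f) - (⇑(approx f hf n) - f) by abel]
    exact eLpNorm_sub_le ((s n).measurable.sub hf).aestronglyMeasurable
      ((approx f hf n).measurable.sub hf).aestronglyMeasurable (by norm_num)
  simpa using h3.add h1

theorem enorm_integral {f : ℂ → ℂ} (hf : Measurable f) (x : (E.integral f hf).domain) :
    ‖E.integral f hf x‖ₑ = eLpNorm f 2 (E.scalarMeasure x) := by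
  have h1 := (E.tendsto_approx_integral hf x).enorm
  simp only [E.enorm_simpleIntegral] at h1
  refine tendsto_nhds_unique h1 ?_
  have h2 := E.tendsto_eLpNorm_approx hf x.2
  have hm := fun n => ((approx f hf n).measurable.sub hf).aestronglyMeasurable
    (μ := E.scalarMeasure (x : H))
  have hx : eLpNorm f 2 (E.scalarMeasure (x : H)) ≠ ∞ := x.2.2.ne
  refine tendsto_of_tendsto_of_tendsto_of_le_of_le (g := fun n => eLpNorm f 2 (E.scalarMeasure x) -
    eLpNorm (⇑(approx f hf n) - f) 2 (E.scalarMeasure x)) (h := fun n =>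
    eLpNorm f 2 (E.scalarMeasure x) + eLpNorm (⇑(approx f hf n) - f) 2 (E.scalarMeasure x))
    ?_ ?_ (fun n => ?_) fun n => ?_
  · simpa using ENNReal.Tendsto.sub tendsto_const_nhds h2 (Or.inl hx)
  · simpa using h2.const_add (eLpNorm f 2 (E.scalarMeasure (x : H)))
  · rw [tsub_le_iff_right]
    have := eLpNorm_sub_le (p := 2) (approx f hf n).measurable.aestronglyMeasurable (hm n)
      (by norm_num)
    simpa using this
  · have := eLpNorm_add_le (p := 2) (hf.aestronglyMeasurable (μ := E.scalarMeasure (x : H))) (hm n)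
      (by norm_num)
    simpa using this

theorem integral_sub {f g : ℂ → ℂ} (hf : Measurable f) (hg : Measurable g) {x : H}
    (hxf : x ∈ (E.integral f hf).domain) (hxg : x ∈ (E.integral g hg).domain)
    (hx : x ∈ (E.integral (fun z => f z - g z) (hf.sub hg)).domain) :
    E.integral (fun z => f z - g z) (hf.sub hg) ⟨x, hx⟩ =
      E.integral f hf ⟨x, hxf⟩ - E.integral g hg ⟨x, hxg⟩ := by
  have h1 := E.tendsto_approx_integral hf ⟨x, hxf⟩
  have h2 := E.tendsto_approx_integral hg ⟨x, hxg⟩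
  refine tendsto_nhds_unique (E.tendsto_integral_of_tendsto_eLpNorm (hf.sub hg) ⟨x, hx⟩
    (s := fun n => approx f hf n - approx g hg n) ?_) ?_
  · refine tendsto_of_tendsto_of_tendsto_of_le_of_le tendsto_const_nhds
      (by simpa using (E.tendsto_eLpNorm_approx hf hxf).add (E.tendsto_eLpNorm_approx hg hxg))
      (fun _ => zero_le) fun n => ?_
    have : ⇑(approx f hf n - approx g hg n) - (f - g) =
        (⇑(approx f hf n) - f) - (⇑(approx g hg n) - g) := by
      ext z; simp; ring
    change eLpNorm (⇑(approx f hf n - approx g hg n) - (f - g)) 2 _ ≤ _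
    rw [this]
    exact eLpNorm_sub_le ((approx f hf n).measurable.sub hf).aestronglyMeasurable
      ((approx g hg n).measurable.sub hg).aestronglyMeasurable (by norm_num)
  · simpa only [E.simpleIntegral_sub] using h1.sub h2

theorem proj_comm {S T : Set ℂ} (hS : MeasurableSet S) (hT : MeasurableSet T) (x : H) :
    E.proj S (E.proj T x) = E.proj T (E.proj S x) := by
  have h1 := E.proj_inter S T hS hT
  have h2 := E.proj_inter T S hT hS
  rw [Set.inter_comm, h1] at h2
  exact congrArg (fun A : H →L[ℂ] H => A x) h2

theorem inner_proj_left {S : Set ℂ} (hS : MeasurableSet S) (x y : H) :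
    ⟪E.proj S x, y⟫_ℂ = ⟪x, E.proj S y⟫_ℂ := by
  have h2 : ContinuousLinearMap.adjoint (E.proj S) = E.proj S :=
    (E.isStarProjection S hS).isSelfAdjoint.star_eq
  conv_lhs => rw [← h2]
  rw [ContinuousLinearMap.adjoint_inner_left]

theorem scalarMeasure_proj {S : Set ℂ} (hS : MeasurableSet S) (x : H) :
    E.scalarMeasure (E.proj S x) = (E.scalarMeasure x).restrict S := by
  refine Measure.ext fun T hT => ?_
  rw [Measure.restrict_apply hT, E.scalarMeasure_apply _ hT, E.scalarMeasure_apply _ (hT.inter hS),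
    E.proj_inter T S hT hS]
  rfl

theorem proj_mem_integral_domain {f : ℂ → ℂ} (hf : Measurable f) {S : Set ℂ}
    (hS : MeasurableSet S) {x : H} (hx : x ∈ (E.integral f hf).domain) :
    E.proj S x ∈ (E.integral f hf).domain := by
  rw [mem_integral_domain, E.scalarMeasure_proj hS]
  exact MemLp.restrict S hx

theorem simpleIntegral_proj (s : SimpleFunc ℂ ℂ) {S : Set ℂ} (hS : MeasurableSet S) (x : H) :
    E.simpleIntegral s (E.proj S x) = E.proj S (E.simpleIntegral s x) := by
  simp only [simpleIntegral, sum_apply, smul_apply,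
    map_sum, map_smul]
  exact Finset.sum_congr rfl fun c _ => by rw [E.proj_comm (s.measurableSet_fiber c) hS]

theorem integral_proj {f : ℂ → ℂ} (hf : Measurable f) {S : Set ℂ}
    (hS : MeasurableSet S) {x : H} (hx : x ∈ (E.integral f hf).domain) :
    E.integral f hf ⟨E.proj S x, E.proj_mem_integral_domain hf hS hx⟩ =
      E.proj S (E.integral f hf ⟨x, hx⟩) := by
  refine tendsto_nhds_unique (E.tendsto_approx_integral hf _) ?_
  simp only [E.simpleIntegral_proj _ hS]
  exact ((E.proj S).continuous.tendsto _).comp (E.tendsto_approx_integral hf ⟨x, hx⟩)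

theorem simpleIntegral_const (c : ℂ) (x : H) :
    E.simpleIntegral (SimpleFunc.const ℂ c) x = c • x := by
  have h : (SimpleFunc.const ℂ c).range = {c} := SimpleFunc.range_const _ _
  have h' : ⇑(SimpleFunc.const ℂ c) ⁻¹' {c} = Set.univ := by ext z; simp
  rw [simpleIntegral, h, Finset.sum_singleton, h', E.proj_univ]
  simp

/-- The scalar measure of `E.proj S x` is carried by `S`, so `f` is almost everywhere the constant
`c` for it, and constant simple functions approximate `f` exactly. -/
theorem exists_integral_eq_smul_of_eqOn {f : ℂ → ℂ} (hf : Measurable f) {S : Set ℂ}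
    (hS : MeasurableSet S) {c : ℂ} (hc : ∀ z ∈ S, f z = c) (x : H) :
    ∃ h : E.proj S x ∈ (E.integral f hf).domain,
      E.integral f hf ⟨E.proj S x, h⟩ = c • E.proj S x := by
  have hae : f =ᵐ[E.scalarMeasure (E.proj S x)] fun _ => c := by
    rw [E.scalarMeasure_proj hS]
    exact (ae_restrict_mem hS).mono hc
  have h : E.proj S x ∈ (E.integral f hf).domain :=
    (E.mem_integral_domain).2 ((memLp_congr_ae hae).2 (memLp_const c))
  refine ⟨h, tendsto_nhds_unique (E.tendsto_integral_of_tendsto_eLpNorm hf ⟨_, h⟩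
    (s := fun _ => SimpleFunc.const ℂ c) ?_) ?_⟩
  · have : eLpNorm (⇑(SimpleFunc.const ℂ c) - f) 2 (E.scalarMeasure (E.proj S x)) = 0 := by
      rw [eLpNorm_congr_ae (g := 0) (hae.mono fun z hz => by simp [hz])]
      simp
    simp only [this, tendsto_const_nhds]
  · simp [E.simpleIntegral_const]

theorem scalarMeasure_univ (x : H) : E.scalarMeasure x Set.univ = ‖x‖ₑ ^ 2 := by
  rw [E.scalarMeasure_apply x MeasurableSet.univ, E.proj_univ]; rfl

theorem memLp_of_bounded {f : ℂ → ℂ} (hf : Measurable f) {C : ℝ} (hC : ∀ z, ‖f z‖ ≤ C) (x : H) :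
    x ∈ (E.integral f hf).domain :=
  E.mem_integral_domain.2 (MemLp.of_bound hf.aestronglyMeasurable C (ae_of_all _ hC))

theorem norm_integral_le {f : ℂ → ℂ} (hf : Measurable f) {C : ℝ} (hC : ∀ z, ‖f z‖ ≤ C)
    (x : (E.integral f hf).domain) : ‖E.integral f hf x‖ ≤ C * ‖(x : H)‖ := by
  have hC0 : 0 ≤ C := (norm_nonneg _).trans (hC 0)
  have h := eLpNorm_le_of_ae_bound (p := 2) (ae_of_all (E.scalarMeasure (x : H)) hC)
  rw [← E.enorm_integral hf x, E.scalarMeasure_univ, ← ENNReal.rpow_natCast, ← ENNReal.rpow_mul]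
    at h
  norm_num at h
  rw [← ofReal_norm, ← ofReal_norm, ← ENNReal.ofReal_mul (norm_nonneg _),
    ENNReal.ofReal_le_ofReal_iff (by positivity)] at h
  rwa [mul_comm]

/-- `∫ f dE` for a bounded Borel function, as a bounded operator. -/
def boundedIntegral (f : ℂ → ℂ) (hf : Measurable f) {C : ℝ} (hC : ∀ z, ‖f z‖ ≤ C) : H →L[ℂ] H :=
  LinearMap.mkContinuous
    ((E.integral f hf).toFun.comp
      (LinearMap.codRestrict _ LinearMap.id fun x => E.memLp_of_bounded hf hC x)) C
    fun x => E.norm_integral_le hf hC ⟨x, E.memLp_of_bounded hf hC x⟩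

theorem boundedIntegral_apply {f : ℂ → ℂ} (hf : Measurable f) {C : ℝ} (hC : ∀ z, ‖f z‖ ≤ C)
    (x : H) : E.boundedIntegral f hf hC x =
      E.integral f hf ⟨x, E.memLp_of_bounded hf hC x⟩ := rfl

theorem norm_boundedIntegral_le {f : ℂ → ℂ} (hf : Measurable f) {C : ℝ} (hC : ∀ z, ‖f z‖ ≤ C) :
    ‖E.boundedIntegral f hf hC‖ ≤ C :=
  LinearMap.mkContinuous_norm_le _ ((norm_nonneg _).trans (hC 0)) _

/-- If `f - g` is bounded, then `∫ f dE` and `∫ g dE` have the same domain, and they differ by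
a bounded operator. -/
theorem integral_eq_add_boundedIntegral {f g : ℂ → ℂ} (hf : Measurable f) (hg : Measurable g)
    {C : ℝ} (hC : ∀ z, ‖f z - g z‖ ≤ C) {x : H} (hx : x ∈ (E.integral f hf).domain) :
    ∃ h : x ∈ (E.integral g hg).domain, E.integral g hg ⟨x, h⟩ =
      E.integral f hf ⟨x, hx⟩ - E.boundedIntegral (fun z => f z - g z) (hf.sub hg) hC x := by
  have hd := E.memLp_of_bounded (hf.sub hg) hC x
  have h : x ∈ (E.integral g hg).domain := by
    rw [mem_integral_domain] at hx hd ⊢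
    have := hx.sub hd
    convert this using 1
    ext z; simp
  refine ⟨h, ?_⟩
  rw [boundedIntegral_apply, E.integral_sub hf hg hx h]
  abel

theorem hasSum_proj_of_countable {ι : Type*} [Countable ι] [Infinite ι] (S : ι → Set ℂ)
    (hS : ∀ i, MeasurableSet (S i)) (hd : Pairwise (Function.onFun Disjoint S))
    (hU : ⋃ i, S i = Set.univ) (x : H) : HasSum (fun i => E.proj (S i) x) x := by
  obtain ⟨_⟩ := nonempty_denumerable ι
  let e : ℕ ≃ ι := (Denumerable.eqv ι).symm
  have h := E.hasSum_proj (fun n => S (e n)) (fun n => hS _)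
    (fun i j hij => hd (e.injective.ne hij)) x
  have h2 : ⋃ n, S (e n) = Set.univ := by
    rw [← hU]; exact e.surjective.iUnion_comp S
  rw [h2, E.proj_univ] at h
  exact e.hasSum_iff.1 h

end SpectralMeasure
end

noncomputable section

/-! ### Rounding the plane to a lattice of mesh `δ`. -/

section Rounding

/-- The index of the cell of mesh `δ` containing `z`. -/
def cellIndex (δ : ℝ) (z : ℂ) : ℤ × ℤ := (⌊z.re / δ⌋, ⌊z.im / δ⌋)

/-- The corner of the cell of mesh `δ` with index `k`. -/
def cellCorner (δ : ℝ) (k : ℤ × ℤ) : ℂ := δ * ((k.1 : ℂ) + k.2 * Complex.I)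

/-- The cell of mesh `δ` with index `k`. -/
def cell (δ : ℝ) (k : ℤ × ℤ) : Set ℂ := cellIndex δ ⁻¹' {k}

theorem measurable_cellIndex (δ : ℝ) : Measurable (cellIndex δ) :=
  (Int.measurable_floor.comp (Complex.measurable_re.div_const δ)).prodMk
    (Int.measurable_floor.comp (Complex.measurable_im.div_const δ))

theorem measurableSet_cell (δ : ℝ) (k : ℤ × ℤ) : MeasurableSet (cell δ k) :=
  measurable_cellIndex δ (measurableSet_singleton k)

theorem measurable_comp_cellIndex (δ : ℝ) (g : ℤ × ℤ → ℂ) :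
    Measurable fun z => g (cellIndex δ z) :=
  (measurable_of_countable g).comp (measurable_cellIndex δ)

theorem pairwise_disjoint_cell (δ : ℝ) : Pairwise (Function.onFun Disjoint (cell δ)) :=
  fun _ _ h => Disjoint.preimage _ (Set.disjoint_singleton.2 h)

theorem iUnion_cell (δ : ℝ) : ⋃ k, cell δ k = Set.univ := by
  ext z; simp [cell]

theorem abs_sub_floor_mul_le {δ : ℝ} (hδ : 0 < δ) (t : ℝ) : |t - δ * ⌊t / δ⌋| ≤ δ := by
  have h1 := Int.floor_le (t / δ)
  have h2 := Int.lt_floor_add_one (t / δ)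
  rw [le_div_iff₀ hδ] at h1
  rw [div_lt_iff₀ hδ] at h2
  rw [abs_le]
  constructor <;> linarith

theorem norm_sub_cellCorner_le {δ : ℝ} (hδ : 0 < δ) (z : ℂ) :
    ‖z - cellCorner δ (cellIndex δ z)‖ ≤ 2 * δ := by
  refine (Complex.norm_le_abs_re_add_abs_im _).trans ?_
  have h1 := abs_sub_floor_mul_le hδ z.re
  have h2 := abs_sub_floor_mul_le hδ z.im
  have e1 : (z - cellCorner δ (cellIndex δ z)).re = z.re - δ * ⌊z.re / δ⌋ := by
    simp [cellCorner, cellIndex]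
  have e2 : (z - cellCorner δ (cellIndex δ z)).im = z.im - δ * ⌊z.im / δ⌋ := by
    simp [cellCorner, cellIndex]
  rw [e1, e2]
  linarith

theorem norm_cellCorner_sub_le {δ : ℝ} (hδ : 0 < δ) (k l : ℤ × ℤ) :
    ‖cellCorner δ k - cellCorner δ l‖ ≤ 2 * δ * ‖k - l‖ := by
  have e : cellCorner δ k - cellCorner δ l =
      δ * (((k.1 - l.1 : ℤ) : ℂ) + ((k.2 - l.2 : ℤ) : ℂ) * Complex.I) := by
    simp only [cellCorner]; push_cast; ring
  rw [e, norm_mul, Complex.norm_real, Real.norm_of_nonneg hδ.le]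
  have h1 : ‖((k.1 - l.1 : ℤ) : ℂ)‖ ≤ ‖k - l‖ := by
    rw [Complex.norm_intCast]; exact norm_fst_le (k - l)
  have h2 : ‖((k.2 - l.2 : ℤ) : ℂ) * Complex.I‖ ≤ ‖k - l‖ := by
    rw [norm_mul, Complex.norm_I, mul_one, Complex.norm_intCast]; exact norm_snd_le (k - l)
  have h3 := norm_add_le ((k.1 - l.1 : ℤ) : ℂ) (((k.2 - l.2 : ℤ) : ℂ) * Complex.I)
  calc _ ≤ δ * (‖k - l‖ + ‖k - l‖) := by gcongr; linarith
    _ = _ := by ring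

theorem rpow_two_mul_le {α t : ℝ} (hα₁ : α ≤ 1) (ht : 0 ≤ t) :
    (2 * t) ^ α ≤ 2 * t ^ α := by
  rw [Real.mul_rpow (by norm_num) ht]
  have : (2 : ℝ) ^ α ≤ 2 := by
    simpa using Real.rpow_le_rpow_of_exponent_le (by norm_num : (1 : ℝ) ≤ 2) hα₁
  gcongr

theorem latticeHolder_comp_cellCorner {f : ℂ → ℂ} {L α δ : ℝ} (hL : 0 ≤ L) (hα₀ : 0 ≤ α)
    (hα₁ : α ≤ 1) (hδ : 0 < δ) (hf : ∀ z w, ‖f z - f w‖ ≤ L * ‖z - w‖ ^ α) :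
    LatticeSchur.LatticeHolder (2 * L * δ ^ α) α fun k => f (cellCorner δ k) := by
  intro k l
  refine (hf _ _).trans ?_
  have h1 := Real.rpow_le_rpow (norm_nonneg _) (norm_cellCorner_sub_le hδ k l) hα₀
  have h2 := rpow_two_mul_le hα₁ (t := δ * ‖k - l‖) (by positivity)
  rw [Real.mul_rpow hδ.le (norm_nonneg _), ← mul_assoc] at h2
  calc L * ‖cellCorner δ k - cellCorner δ l‖ ^ α ≤ L * (2 * (δ ^ α * ‖k - l‖ ^ α)) := by
        gcongr; exact h1.trans h2
    _ = _ := by ring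

end Rounding

/-! ### From the lattice estimate to normal operators. -/

namespace SpectralMeasure

variable {H : Type*} [NormedAddCommGroup H] [InnerProductSpace ℂ H] [CompleteSpace H]

section Single

variable (E : SpectralMeasure H) {δ : ℝ}

theorem hasSum_proj_cell (δ : ℝ) (x : H) : HasSum (fun k => E.proj (cell δ k) x) x :=
  E.hasSum_proj_of_countable (cell δ) (measurableSet_cell δ) (pairwise_disjoint_cell δ)
    (iUnion_cell δ) x

theorem inner_proj_cell_of_ne {k l : ℤ × ℤ} (h : k ≠ l) (x : H) :
    ⟪E.proj (cell δ k) x, E.proj (cell δ l) x⟫_ℂ = 0 :=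
  E.inner_proj_of_disjoint (measurableSet_cell δ k) (measurableSet_cell δ l)
    (pairwise_disjoint_cell δ h) x x

theorem sum_norm_proj_cell_sq_le (S : Finset (ℤ × ℤ)) (x : H) :
    ∑ k ∈ S, ‖E.proj (cell δ k) x‖ ^ 2 ≤ ‖x‖ ^ 2 := by
  have h : HasSum (fun k => ‖E.proj (cell δ k) x‖ ^ 2) (‖x‖ ^ 2) := by
    have h1 := ((E.hasSum_proj_cell δ x).mapL (innerSL ℂ x)).mapL RCLike.reCLM
    simp only [innerSL_apply_apply, RCLike.reCLM_apply, inner_self_eq_norm_sq] at h1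
    simpa only [E.norm_proj_sq (measurableSet_cell δ _)] using h1
  exact sum_le_hasSum S (fun _ _ => sq_nonneg _) h

theorem norm_sum_proj_cell_le (S : Finset (ℤ × ℤ)) (x : H) :
    ‖∑ k ∈ S, E.proj (cell δ k) x‖ ≤ ‖x‖ := by
  have h := LatticeSchur.norm_sum_smul_sq S (fun k => E.proj (cell δ k) x)
    (fun i j h => E.inner_proj_cell_of_ne h x) fun _ => 1
  simp only [one_smul, norm_one, one_pow, one_mul] at h
  exact le_of_sq_le_sq (h.trans_le (E.sum_norm_proj_cell_sq_le S x)) (norm_nonneg x)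

/-- The difference between the identity function and its rounding to the mesh, integrated. -/
def roundingError (hδ : 0 < δ) : H →L[ℂ] H :=
  E.boundedIntegral (fun z => z - cellCorner δ (cellIndex δ z))
    (measurable_id.sub (measurable_comp_cellIndex δ (cellCorner δ))) (norm_sub_cellCorner_le hδ)

theorem norm_roundingError_le (hδ : 0 < δ) : ‖E.roundingError hδ‖ ≤ 2 * δ :=
  E.norm_boundedIntegral_le _ _

/-- Subtracting the rounding error from the operator leaves the integral of the rounded identity
function, which is scalar on each cell. -/
theorem proj_cell_integral_sub (hδ : 0 < δ) (k : ℤ × ℤ) {w : H}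
    (hw : w ∈ (E.integral (fun z => z) measurable_id).domain) :
    E.proj (cell δ k) (E.integral (fun z => z) measurable_id ⟨w, hw⟩ - E.roundingError hδ w) =
      cellCorner δ k • E.proj (cell δ k) w := by
  obtain ⟨h, he⟩ := E.integral_eq_add_boundedIntegral measurable_id
    (measurable_comp_cellIndex δ (cellCorner δ)) (norm_sub_cellCorner_le hδ) hw
  have h1 := E.integral_proj (measurable_comp_cellIndex δ (cellCorner δ))
    (measurableSet_cell δ k) h
  obtain ⟨_, h2⟩ := E.exists_integral_eq_smul_of_eqOn
    (measurable_comp_cellIndex δ (cellCorner δ)) (measurableSet_cell δ k)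
    (c := cellCorner δ k) (fun z hz => by rw [show cellIndex δ z = k from hz]) w
  rw [← h2, h1, he]
  rfl

/-- Vectors from a cell lie in the domain because the rounded function is constant there and the
identity function is within `2 * δ` of it. -/
theorem exists_integral_proj_cell (hδ : 0 < δ) (k : ℤ × ℤ) (x : H) :
    ∃ h : E.proj (cell δ k) x ∈ (E.integral (fun z => z) measurable_id).domain,
      E.integral (fun z => z) measurable_id ⟨_, h⟩ - E.roundingError hδ (E.proj (cell δ k) x) =
        cellCorner δ k • E.proj (cell δ k) x := by
  obtain ⟨h1, h2⟩ := E.exists_integral_eq_smul_of_eqOn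
    (measurable_comp_cellIndex δ (cellCorner δ)) (measurableSet_cell δ k)
    (c := cellCorner δ k) (fun z hz => by rw [show cellIndex δ z = k from hz]) x
  obtain ⟨h, _⟩ := E.integral_eq_add_boundedIntegral
    (measurable_comp_cellIndex δ (cellCorner δ)) measurable_id (C := 2 * δ)
    (fun z => by rw [norm_sub_rev]; exact norm_sub_cellCorner_le hδ z) h1
  obtain ⟨_, he⟩ := E.integral_eq_add_boundedIntegral measurable_id
    (measurable_comp_cellIndex δ (cellCorner δ)) (norm_sub_cellCorner_le hδ) h
  exact ⟨h, he.symm.trans h2⟩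

theorem proj_cell_integral_comp (g : ℤ × ℤ → ℂ) {x : H}
    (hx : x ∈ (E.integral (fun z => g (cellIndex δ z)) (measurable_comp_cellIndex δ g)).domain)
    (k : ℤ × ℤ) :
    E.proj (cell δ k) (E.integral _ (measurable_comp_cellIndex δ g) ⟨x, hx⟩) =
      g k • E.proj (cell δ k) x := by
  rw [← E.integral_proj (measurable_comp_cellIndex δ g) (measurableSet_cell δ k) hx]
  obtain ⟨_, h2⟩ := E.exists_integral_eq_smul_of_eqOn
    (measurable_comp_cellIndex δ g) (measurableSet_cell δ k)
    (c := g k) (fun z hz => by rw [show cellIndex δ z = k from hz]) x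
  exact h2

/-- The integral of `|g ∘ cellIndex δ|²` is the series of the `‖g k‖ ^ 2 * ‖E.proj (cell δ k) x‖ ^
2`, so uniformly bounded finite sums suffice. -/
theorem mem_integral_comp_domain (g : ℤ × ℤ → ℂ) {x : H} {W : ℝ}
    (h : ∀ S : Finset (ℤ × ℤ), ∑ k ∈ S, ‖g k‖ ^ 2 * ‖E.proj (cell δ k) x‖ ^ 2 ≤ W) :
    x ∈ (E.integral (fun z => g (cellIndex δ z)) (measurable_comp_cellIndex δ g)).domain := by
  refine E.mem_integral_domain.2 ⟨(measurable_comp_cellIndex δ g).aestronglyMeasurable, ?_⟩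
  rw [eLpNorm_lt_top_iff_lintegral_rpow_enorm_lt_top (by simp) (by simp)]
  simp only [ENNReal.toReal_ofNat, ENNReal.rpow_ofNat]
  have h1 : ∫⁻ z, ‖g (cellIndex δ z)‖ₑ ^ 2 ∂E.scalarMeasure x =
      ∫⁻ k, ‖g k‖ₑ ^ 2 ∂(E.scalarMeasure x).map (cellIndex δ) :=
    (lintegral_map (f := fun k => ‖g k‖ₑ ^ 2) (measurable_of_countable _) (measurable_cellIndex δ)).symm
  rw [h1, lintegral_countable', ENNReal.tsum_eq_iSup_sum]
  refine (iSup_le fun S => ?_ : _ ≤ ENNReal.ofReal W).trans_lt ENNReal.ofReal_lt_top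
  refine le_trans (le_of_eq ?_) (ENNReal.ofReal_le_ofReal (h S))
  rw [ENNReal.ofReal_sum_of_nonneg fun _ _ => by positivity]
  refine Finset.sum_congr rfl fun k _ => ?_
  rw [Measure.map_apply (measurable_cellIndex δ) (measurableSet_singleton k),
    show cellIndex δ ⁻¹' {k} = cell δ k from rfl, E.scalarMeasure_apply x (measurableSet_cell δ k), ENNReal.ofReal_mul (by positivity),
    ENNReal.ofReal_pow (norm_nonneg _), ENNReal.ofReal_pow (norm_nonneg _), ofReal_norm,
    ofReal_norm]

end Single

variable (E₁ E₂ : SpectralMeasure H) {δ : ℝ}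

/-- Passage from a bound for the discretized sesquilinear form to the operators. -/
theorem exists_integral_comp_sub_le (g : ℤ × ℤ → ℂ) {C : ℝ}
    (hC : ∀ (S T : Finset (ℤ × ℤ)) (x y : H), ‖∑ k ∈ S, ∑ l ∈ T,
      (g k - g l) * ⟪E₁.proj (cell δ k) y, E₂.proj (cell δ l) x⟫_ℂ‖ ≤ C * ‖x‖ * ‖y‖) {x : H}
    (hx : x ∈ (E₂.integral (fun z => g (cellIndex δ z)) (measurable_comp_cellIndex δ g)).domain) :
    ∃ h : x ∈ (E₁.integral (fun z => g (cellIndex δ z)) (measurable_comp_cellIndex δ g)).domain,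
      ‖E₁.integral _ (measurable_comp_cellIndex δ g) ⟨x, h⟩ -
        E₂.integral _ (measurable_comp_cellIndex δ g) ⟨x, hx⟩‖ ≤ C * ‖x‖ := by
  set v := E₂.integral _ (measurable_comp_cellIndex δ g) ⟨x, hx⟩ with hv
  -- These are the finite cell sums of the expected difference. Bounding them before `x` is known to
  -- lie in the domain for `E₁` is what yields membership.
  have key : ∀ S : Finset (ℤ × ℤ),
      ‖∑ k ∈ S, (g k • E₁.proj (cell δ k) x - E₁.proj (cell δ k) v)‖ ≤ C * ‖x‖ := by
    intro S
    set y := ∑ k ∈ S, (g k • E₁.proj (cell δ k) x - E₁.proj (cell δ k) v) with hy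
    -- The form is tested against `y` itself; as the sum over `l` exhausts the lattice it becomes
    -- `‖y‖ ^ 2`, and one factor `‖y‖` cancels.
    have h1 : HasSum (fun l => ∑ k ∈ S,
        (g k - g l) * ⟪E₁.proj (cell δ k) y, E₂.proj (cell δ l) x⟫_ℂ) ⟪y, y⟫_ℂ := by
      have e : ⟪y, y⟫_ℂ = ∑ k ∈ S, (g k * ⟪E₁.proj (cell δ k) y, x⟫_ℂ -
          ⟪E₁.proj (cell δ k) y, v⟫_ℂ) := by
        conv_lhs => rw [hy]
        rw [← hy, inner_sum]
        refine Finset.sum_congr rfl fun k _ => ?_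
        rw [inner_sub_right, inner_smul_right, E₁.inner_proj_left (measurableSet_cell δ k),
          E₁.inner_proj_left (measurableSet_cell δ k)]
      rw [e]
      refine hasSum_sum fun k _ => ?_
      have a1 := ((E₂.hasSum_proj_cell δ x).mapL (innerSL ℂ (E₁.proj (cell δ k) y))).mul_left (g k)
      have a2 := (E₂.hasSum_proj_cell δ v).mapL (innerSL ℂ (E₁.proj (cell δ k) y))
      have a3 := a1.sub a2
      simp only [innerSL_apply_apply, hv, E₂.proj_cell_integral_comp g hx, inner_smul_right] at a3
      rw [← hv] at a3
      simpa only [sub_mul] using a3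
    have h2 : ‖⟪y, y⟫_ℂ‖ ≤ C * ‖x‖ * ‖y‖ := by
      refine le_of_tendsto (Filter.Tendsto.norm h1) (Eventually.of_forall fun T => ?_)
      rw [Finset.sum_comm]
      exact hC S T x y
    rw [inner_self_eq_norm_sq_to_K, norm_pow, RCLike.norm_ofReal, abs_of_nonneg (norm_nonneg y)]
      at h2
    by_cases hy0 : ‖y‖ = 0
    -- The sign of `C` is not given; the empty sums in `hC` show `0 ≤ C * ‖x‖ * ‖x‖`.
    · have := hC ∅ ∅ x x
      by_cases hx0 : ‖x‖ = 0
      · simp [hy0, hx0]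
      · simp only [Finset.sum_empty, norm_zero] at this
        have hxp : 0 < ‖x‖ := lt_of_le_of_ne (norm_nonneg x) (Ne.symm hx0)
        rw [hy0]
        exact nonneg_of_mul_nonneg_left this hxp
    · have hyp : 0 < ‖y‖ := lt_of_le_of_ne (norm_nonneg y) (Ne.symm hy0)
      rw [pow_two] at h2
      exact le_of_mul_le_mul_right h2 hyp
  have hmem : x ∈ (E₁.integral (fun z => g (cellIndex δ z))
      (measurable_comp_cellIndex δ g)).domain := by
    refine E₁.mem_integral_comp_domain g (W := (C * ‖x‖ + ‖v‖) ^ 2) fun S => ?_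
    rw [← LatticeSchur.norm_sum_smul_sq S (fun k => E₁.proj (cell δ k) x)
      (fun i j h => E₁.inner_proj_cell_of_ne h x) g]
    refine pow_le_pow_left₀ (norm_nonneg _) ?_ 2
    have h1 := key S
    rw [Finset.sum_sub_distrib] at h1
    have h2 := norm_sub_norm_le (∑ k ∈ S, g k • E₁.proj (cell δ k) x)
      (∑ k ∈ S, E₁.proj (cell δ k) v)
    have h3 := E₁.norm_sum_proj_cell_le (δ := δ) S v
    linarith
  refine ⟨hmem, ?_⟩
  have h1 := (E₁.hasSum_proj_cell δ
    (E₁.integral _ (measurable_comp_cellIndex δ g) ⟨x, hmem⟩)).sub (E₁.hasSum_proj_cell δ v)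
  simp only [E₁.proj_cell_integral_comp g hmem] at h1
  exact le_of_tendsto (Filter.Tendsto.norm h1) (Eventually.of_forall key)

/-- The bounded operator that extends the difference of two operators with a common dense
domain. -/
theorem exists_extension_sub {A B : H →ₗ.[ℂ] H} (hdense : Dense (A.domain : Set H))
    (hdom : A.domain = B.domain) (hδ : 0 ≤ δ)
    (hb : ∀ x (h₁ : x ∈ A.domain) (h₂ : x ∈ B.domain), ‖A ⟨x, h₁⟩ - B ⟨x, h₂⟩‖ ≤ δ * ‖x‖) :
    ∃ K : H →L[ℂ] H, ‖K‖ ≤ δ ∧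
      ∀ x (h₁ : x ∈ A.domain) (h₂ : x ∈ B.domain), K x = A ⟨x, h₁⟩ - B ⟨x, h₂⟩ := by
  let D : A.domain →ₗ[ℂ] H := A.toFun - B.toFun.comp (Submodule.inclusion hdom.le)
  have hD : ∀ x : A.domain, ‖D x‖ ≤ δ * ‖A.domain.subtype x‖ :=
    fun x => hb x x.2 (hdom ▸ x.2)
  have hr : DenseRange A.domain.subtype := by
    simpa [DenseRange] using hdense
  refine ⟨D.extendOfNorm A.domain.subtype, ?_, ?_⟩
  · exact LinearMap.opNorm_extendOfNorm_le hr hδ hD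
  · intro x h₁ h₂
    exact LinearMap.extendOfNorm_eq hr ⟨δ, hD⟩ ⟨x, h₁⟩

/-- The difference of the rounded operators extends to a bounded operator whose blocks are
differences of cell corners. Its adjoint has the conjugate blocks, so both coordinate differences
come from bounded operators of norm at most `5`, and `3840 = 768 · 5`. -/
theorem norm_discretized_form_le (hδ : 0 < δ)
    (hdense : Dense ((E₁.integral (fun z => z) measurable_id).domain : Set H))
    (hdom : (E₁.integral (fun z => z) measurable_id).domain =
      (E₂.integral (fun z => z) measurable_id).domain)
    (hb : ∀ x h₁ h₂, ‖E₁.integral (fun z => z) measurable_id ⟨x, h₁⟩ -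
      E₂.integral (fun z => z) measurable_id ⟨x, h₂⟩‖ ≤ δ * ‖x‖)
    {L α : ℝ} (hL : 0 ≤ L) (hα₀ : 0 ≤ α) (hα₁ : α < 1) {g : ℤ × ℤ → ℂ}
    (hg : LatticeSchur.LatticeHolder L α g) (S T : Finset (ℤ × ℤ)) (x y : H) :
    ‖∑ k ∈ S, ∑ l ∈ T,
      (g k - g l) * ⟪E₁.proj (cell δ k) y, E₂.proj (cell δ l) x⟫_ℂ‖ ≤
      3840 * (1 - α)⁻¹ * L * ‖x‖ * ‖y‖ := by
  obtain ⟨K, hK, hKe⟩ := exists_extension_sub hdense hdom hδ.le hb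
  -- This is the bounded difference of the two rounded operators; its norm is at most `δ + 2 * δ + 2
  -- * δ`.
  let K' : H →L[ℂ] H := K - E₁.roundingError hδ + E₂.roundingError hδ
  have hK' : ‖K'‖ ≤ 5 * δ := by
    have h1 := norm_add_le (K - E₁.roundingError hδ) (E₂.roundingError hδ)
    have h2 := norm_sub_le K (E₁.roundingError hδ)
    have h3 := E₁.norm_roundingError_le hδ
    have h4 := E₂.norm_roundingError_le hδ
    change ‖K - E₁.roundingError hδ + E₂.roundingError hδ‖ ≤ _
    linarith
  have hK'e : ∀ w h₁ h₂, K' w =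
      (E₁.integral (fun z => z) measurable_id ⟨w, h₁⟩ - E₁.roundingError hδ w) -
      (E₂.integral (fun z => z) measurable_id ⟨w, h₂⟩ - E₂.roundingError hδ w) := by
    intro w h₁ h₂
    change K w - E₁.roundingError hδ w + E₂.roundingError hδ w = _
    rw [hKe w h₁ h₂]
    abel
  have hblock : ∀ k l, ⟪E₁.proj (cell δ k) y, K' (E₂.proj (cell δ l) x)⟫_ℂ =
      (cellCorner δ k - cellCorner δ l) *
        ⟪E₁.proj (cell δ k) y, E₂.proj (cell δ l) x⟫_ℂ := by
    intro k l
    obtain ⟨h₂, e₂⟩ := E₂.exists_integral_proj_cell hδ l x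
    have h₁ := h₂
    rw [← hdom] at h₁
    rw [hK'e _ h₁ h₂, e₂, inner_sub_right, inner_smul_right,
      E₁.inner_proj_left (measurableSet_cell δ k) y (_ - _),
      E₁.proj_cell_integral_sub hδ k h₁, inner_smul_right,
      ← E₁.inner_proj_left (measurableSet_cell δ k)]
    ring
  -- Moving the adjoint to the left makes `K'` act on a cell vector of `E₁`, so equality of the
  -- domains is needed to evaluate the `E₂` part on it.
  have hblock' : ∀ k l,
      ⟪E₁.proj (cell δ k) y, ContinuousLinearMap.adjoint K' (E₂.proj (cell δ l) x)⟫_ℂ =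
      (starRingEnd ℂ) (cellCorner δ k - cellCorner δ l) *
        ⟪E₁.proj (cell δ k) y, E₂.proj (cell δ l) x⟫_ℂ := by
    intro k l
    obtain ⟨h₁, e₁⟩ := E₁.exists_integral_proj_cell hδ k y
    have h₂ := h₁
    rw [hdom] at h₂
    rw [ContinuousLinearMap.adjoint_inner_right, hK'e _ h₁ h₂, e₁, inner_sub_left, inner_smul_left,
      ← E₂.inner_proj_left (measurableSet_cell δ l) (_ - _),
      E₂.proj_cell_integral_sub hδ l h₂, inner_smul_left,
      E₂.inner_proj_left (measurableSet_cell δ l), map_sub]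
    ring
  have hadj : ‖ContinuousLinearMap.adjoint K'‖ = ‖K'‖ := LinearIsometryEquiv.norm_map _ _
  have hδC : (δ : ℂ) ≠ 0 := by exact_mod_cast hδ.ne'
  -- Real and imaginary parts of `K'` in units of `δ`: their blocks are the coordinate differences
  -- of the cell indices.
  let K₁ : H →L[ℂ] H := (2 * δ : ℂ)⁻¹ • (K' + ContinuousLinearMap.adjoint K')
  let K₂ : H →L[ℂ] H := (2 * δ * Complex.I : ℂ)⁻¹ • (K' - ContinuousLinearMap.adjoint K')
  have hK₁ : ‖K₁‖ ≤ 5 := by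
    have h := norm_add_le K' (ContinuousLinearMap.adjoint K')
    rw [norm_smul, norm_inv, norm_mul, Complex.norm_real, Real.norm_of_nonneg hδ.le,
      inv_mul_le_iff₀ (by simp [hδ])]
    simp only [Complex.norm_ofNat]
    linarith
  have hK₂ : ‖K₂‖ ≤ 5 := by
    have h := norm_sub_le K' (ContinuousLinearMap.adjoint K')
    rw [norm_smul, norm_inv, norm_mul, norm_mul, Complex.norm_I, mul_one, Complex.norm_real,
      Real.norm_of_nonneg hδ.le, inv_mul_le_iff₀ (by simp [hδ])]
    simp only [Complex.norm_ofNat]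
    linarith
  have hconj : ∀ k l, (starRingEnd ℂ) (cellCorner δ k - cellCorner δ l) =
      δ * (((k.1 : ℂ) - l.1) - ((k.2 : ℂ) - l.2) * Complex.I) := fun k l => by
    simp only [cellCorner, map_sub, map_mul, map_add, Complex.conj_ofReal, map_intCast,
      Complex.conj_I]
    ring
  have hsub : ∀ k l, cellCorner δ k - cellCorner δ l =
      δ * (((k.1 : ℂ) - l.1) + ((k.2 : ℂ) - l.2) * Complex.I) := fun k l => by
    simp only [cellCorner]; ring
  refine (LatticeSchur.norm_sum_sub_le_of_holder S T (fun k => E₁.proj (cell δ k) y)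
    (fun l => E₂.proj (cell δ l) x) (fun i j h => E₁.inner_proj_cell_of_ne h y)
    (fun i j h => E₂.inner_proj_cell_of_ne h x) (norm_nonneg x) (norm_nonneg y)
    (E₁.sum_norm_proj_cell_sq_le S y) (E₂.sum_norm_proj_cell_sq_le T x) K₁ K₂ hK₁ hK₂
    (fun k l => ?_) (fun k l => ?_) hL hα₀ hα₁ hg).trans (le_of_eq (by ring))
  · change ⟪E₁.proj (cell δ k) y, (2 * δ : ℂ)⁻¹ • (K' (E₂.proj (cell δ l) x) +
      ContinuousLinearMap.adjoint K' (E₂.proj (cell δ l) x))⟫_ℂ = _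
    rw [inner_smul_right, inner_add_right, hblock, hblock', hconj, hsub]
    field_simp
    ring
  · change ⟪E₁.proj (cell δ k) y, (2 * δ * Complex.I : ℂ)⁻¹ • (K' (E₂.proj (cell δ l) x) -
      ContinuousLinearMap.adjoint K' (E₂.proj (cell δ l) x))⟫_ℂ = _
    rw [inner_smul_right, inner_sub_right, hblock, hblock', hconj, hsub]
    field_simp
    ring

/-- Hölder estimate for functions of two normal operators given by their spectral measures. -/
theorem exists_integral_sub_le (hδ : 0 < δ)
    (hdense : Dense ((E₁.integral (fun z => z) measurable_id).domain : Set H))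
    (hdom : (E₁.integral (fun z => z) measurable_id).domain =
      (E₂.integral (fun z => z) measurable_id).domain)
    (hb : ∀ x h₁ h₂, ‖E₁.integral (fun z => z) measurable_id ⟨x, h₁⟩ -
      E₂.integral (fun z => z) measurable_id ⟨x, h₂⟩‖ ≤ δ * ‖x‖)
    {L α : ℝ} (hL : 0 ≤ L) (hα₀ : 0 ≤ α) (hα₁ : α < 1) {f : ℂ → ℂ} (hfm : Measurable f)
    (hf : ∀ z w, ‖f z - f w‖ ≤ L * ‖z - w‖ ^ α) {x : H} (hx : x ∈ (E₂.integral f hfm).domain) :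
    ∃ h : x ∈ (E₁.integral f hfm).domain,
      ‖E₁.integral f hfm ⟨x, h⟩ - E₂.integral f hfm ⟨x, hx⟩‖ ≤
        7684 * (1 - α)⁻¹ * L * δ ^ α * ‖x‖ := by
  let g : ℤ × ℤ → ℂ := fun k => f (cellCorner δ k)
  have hgm := measurable_comp_cellIndex δ g
  have hfg : ∀ z, ‖f z - g (cellIndex δ z)‖ ≤ 2 * L * δ ^ α := fun z => by
    refine (hf _ _).trans ?_
    have h1 := Real.rpow_le_rpow (norm_nonneg _) (norm_sub_cellCorner_le hδ z) hα₀
    have h2 := rpow_two_mul_le hα₁.le hδ.le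
    calc _ ≤ L * (2 * δ ^ α) := by gcongr; exact h1.trans h2
      _ = _ := by ring
  have hgf : ∀ z, ‖g (cellIndex δ z) - f z‖ ≤ 2 * L * δ ^ α := fun z => by
    rw [norm_sub_rev]; exact hfg z
  obtain ⟨hx₂, e₂⟩ := E₂.integral_eq_add_boundedIntegral hfm hgm hfg hx
  obtain ⟨hx₁, e⟩ := E₁.exists_integral_comp_sub_le E₂ g
    (fun S T x y => E₁.norm_discretized_form_le E₂ hδ hdense hdom hb (by positivity) hα₀ hα₁
      (latticeHolder_comp_cellCorner hL hα₀ hα₁.le hδ hf) S T x y) hx₂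
  obtain ⟨h, e₁⟩ := E₁.integral_eq_add_boundedIntegral hgm hfm hgf hx₁
  refine ⟨h, ?_⟩
  have n₁ := (E₁.boundedIntegral (fun z => g (cellIndex δ z) - f z) (hgm.sub hfm) hgf).le_of_opNorm_le
    (E₁.norm_boundedIntegral_le _ hgf) x
  have n₂ := (E₂.boundedIntegral (fun z => f z - g (cellIndex δ z)) (hfm.sub hgm) hfg).le_of_opNorm_le
    (E₂.norm_boundedIntegral_le _ hfg) x
  set u₁ := E₁.boundedIntegral (fun z => g (cellIndex δ z) - f z) (hgm.sub hfm) hgf x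
  set u₂ := E₂.boundedIntegral (fun z => f z - g (cellIndex δ z)) (hfm.sub hgm) hfg x
  have e₃ : E₁.integral f hfm ⟨x, h⟩ - E₂.integral f hfm ⟨x, hx⟩ =
      (E₁.integral _ hgm ⟨x, hx₁⟩ - E₂.integral _ hgm ⟨x, hx₂⟩) - u₁ - u₂ := by
    rw [e₁, e₂]; abel
  rw [e₃]
  have t₁ := norm_sub_le (E₁.integral _ hgm ⟨x, hx₁⟩ - E₂.integral _ hgm ⟨x, hx₂⟩ - u₁) u₂
  have t₂ := norm_sub_le (E₁.integral _ hgm ⟨x, hx₁⟩ - E₂.integral _ hgm ⟨x, hx₂⟩) u₁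
  -- The constant is `7684 = 2 · 3840 + 2 + 2`: the lattice function has Hölder constant `2 L δ^α`,
  -- and each of the two roundings of `f` costs `2 L δ^α`, absorbed through `1 ≤ (1 - α)⁻¹`.
  have hone : 1 ≤ (1 - α)⁻¹ := (one_le_inv₀ (by linarith)).2 (by linarith)
  have hW : 0 ≤ L * δ ^ α * ‖x‖ := by positivity
  nlinarith [mul_le_mul_of_nonneg_right hone hW]

end SpectralMeasure
end

noncomputable section

/-! ### Borel functional calculus for a representation of `C(X)`. -/

namespace BorelCalculus

open CompactlySupported

theorem eLpNorm_bounded_mul_le {Y : Type*} [MeasurableSpace Y] {μ : Measure Y} {g h : Y → ℂ} {C : ℝ} (hC : ∀ t, ‖g t‖ ≤ C) :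
    eLpNorm (g * h) 2 μ ≤ ENNReal.ofReal C * eLpNorm h 2 μ :=
  eLpNorm_le_mul_eLpNorm_of_ae_le_mul (ae_of_all _ fun t => by
    rw [Pi.mul_apply, norm_mul]; exact mul_le_mul_of_nonneg_right (hC t) (norm_nonneg _)) 2

theorem memLp_bounded_mul {Y : Type*} [MeasurableSpace Y] {μ : Measure Y} {g h : Y → ℂ} (hg : Measurable g) {C : ℝ}
    (hC : ∀ t, ‖g t‖ ≤ C) (hh : MemLp h 2 μ) : MemLp (g * h) 2 μ :=
  ⟨hg.aestronglyMeasurable.mul hh.1, (eLpNorm_bounded_mul_le hC).trans_lt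
    (ENNReal.mul_lt_top ENNReal.ofReal_lt_top hh.2)⟩

variable {X : Type*} [TopologicalSpace X]
variable {H : Type*} [NormedAddCommGroup H] [InnerProductSpace ℂ H] [CompleteSpace H]
variable (ρ : C(X, ℂ) →⋆ₐ[ℂ] (H →L[ℂ] H))

/-- A real continuous function, seen as a complex one. -/
def toComplex (f : X → ℝ) (hf : Continuous f) : C(X, ℂ) :=
  ⟨fun t => (f t : ℂ), Complex.continuous_ofReal.comp hf⟩

theorem inner_map_left (φ : C(X, ℂ)) (x y : H) : ⟪ρ φ x, y⟫_ℂ = ⟪x, ρ (star φ) y⟫_ℂ := by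
  rw [map_star, ContinuousLinearMap.star_eq_adjoint, ContinuousLinearMap.adjoint_inner_right]

theorem map_mul_apply (φ ψ : C(X, ℂ)) (x : H) : ρ (φ * ψ) x = ρ φ (ρ ψ x) := by
  rw [map_mul]; rfl

variable [T2Space X] [CompactSpace X] [MeasurableSpace X] [BorelSpace X]

/-- The positive functional `f ↦ ⟪x, ρ(f) x⟫`. -/
def vectorFunctional (x : H) : C_c(X, ℝ) →ₚ[ℝ] ℝ :=
  PositiveLinearMap.mk₀
    { toFun := fun f => (⟪x, ρ (toComplex f f.continuous) x⟫_ℂ).re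
      map_add' := fun f g => by
        have : toComplex (f + g) (f + g).continuous =
            toComplex f f.continuous + toComplex g g.continuous := by
          ext t; simp [toComplex]
        rw [this, map_add, add_apply, inner_add_right, Complex.add_re]
      map_smul' := fun c f => by
        have : toComplex (c • f) (c • f).continuous = (c : ℂ) • toComplex f f.continuous := by
          ext t; simp [toComplex]
        rw [this, map_smul, smul_apply, inner_smul_right]
        simp }
    fun f hf => by
      -- Positivity: `f` is `star s * s` with `s = √f`, so the functional takes the value `‖ρ s
      -- x‖²`.
      have hc : Continuous fun t => Real.sqrt (f t) := Real.continuous_sqrt.comp f.continuous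
      have : toComplex f f.continuous = star (toComplex _ hc) * toComplex _ hc := by
        ext t
        have h0 : 0 ≤ f t := hf t
        simp only [toComplex, ContinuousMap.coe_mk, ContinuousMap.mul_apply,
          ContinuousMap.star_apply, RCLike.star_def, Complex.conj_ofReal]
        rw [← Complex.ofReal_mul, Real.mul_self_sqrt h0]
      change 0 ≤ (⟪x, ρ (toComplex f f.continuous) x⟫_ℂ).re
      rw [this, map_mul_apply, ← inner_map_left]
      exact inner_self_nonneg (𝕜 := ℂ)

/-- The measure on `X` with `⟪x, ρ(f) x⟫ = ∫ f dμ`. -/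
def vectorMeasure (x : H) : Measure X := RealRMK.rieszMeasure (vectorFunctional ρ x)

instance (x : H) : IsFiniteMeasure (vectorMeasure ρ x) := by
  unfold vectorMeasure; infer_instance

instance (x : H) : (vectorMeasure ρ x).Regular := by
  unfold vectorMeasure; infer_instance

/-- Since `‖ρ φ x‖²` is `⟪x, ρ (star φ * φ) x⟫`, the map `φ ↦ ρ φ x` is isometric for the `L²`
seminorm of the measure of `x`. Density of continuous functions then extends it to `L²`. -/
theorem enorm_map_apply (φ : C(X, ℂ)) (x : H) :
    ‖ρ φ x‖ₑ = eLpNorm φ 2 (vectorMeasure ρ x) := by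
  let f : C_c(X, ℝ) := ⟨⟨fun t => ‖φ t‖ ^ 2, by fun_prop⟩, HasCompactSupport.of_compactSpace _⟩
  have h1 : ∫ t, f t ∂vectorMeasure ρ x = ‖ρ φ x‖ ^ 2 := by
    rw [vectorMeasure, RealRMK.integral_rieszMeasure]
    change (⟪x, ρ (toComplex f f.continuous) x⟫_ℂ).re = _
    have : toComplex f f.continuous = star φ * φ := by
      ext t
      simp only [toComplex, ContinuousMap.coe_mk, ContinuousMap.mul_apply,
        ContinuousMap.star_apply, RCLike.star_def]
      change ((‖φ t‖ ^ 2 : ℝ) : ℂ) = _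
      rw [Complex.conj_mul']; simp
    rw [this, map_mul_apply, ← inner_map_left]
    exact inner_self_eq_norm_sq (𝕜 := ℂ) _
  have hfi : Integrable (fun t => f t) (vectorMeasure ρ x) :=
    f.continuous.integrable_of_hasCompactSupport f.hasCompactSupport
  have h2 := ofReal_integral_eq_lintegral_ofReal hfi (ae_of_all _ fun t => by
    change 0 ≤ ‖φ t‖ ^ 2; positivity)
  rw [h1] at h2
  rw [eLpNorm_eq_lintegral_rpow_enorm_toReal (by simp) (by simp)]
  simp only [ENNReal.toReal_ofNat, ENNReal.rpow_ofNat]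
  have h3 : ∀ t, ENNReal.ofReal (f t) = ‖φ t‖ₑ ^ 2 := fun t => by
    change ENNReal.ofReal (‖φ t‖ ^ 2) = _
    rw [ENNReal.ofReal_pow (norm_nonneg _), ofReal_norm]
  simp only [h3] at h2
  rw [← h2, ENNReal.ofReal_pow (norm_nonneg _), ofReal_norm, ← ENNReal.rpow_natCast,
    ← ENNReal.rpow_mul]
  norm_num

theorem vectorMeasure_univ (x : H) : vectorMeasure ρ x Set.univ = ‖x‖ₑ ^ 2 := by
  have h := enorm_map_apply ρ 1 x
  rw [map_one, eLpNorm_eq_lintegral_rpow_enorm_toReal (by simp) (by simp)] at h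
  simp at h
  rw [h, ← ENNReal.rpow_natCast, ← ENNReal.rpow_mul]
  norm_num

theorem exists_continuous_approx {μ : Measure X} [μ.WeaklyRegular] {g : X → ℂ}
    (hg : MemLp g 2 μ) :
    ∃ φ : ℕ → C(X, ℂ), Tendsto (fun n => eLpNorm (g - ⇑(φ n)) 2 μ) atTop (𝓝 0) := by
  have h : ∀ n : ℕ, ∃ φ : C(X, ℂ), eLpNorm (g - ⇑φ) 2 μ ≤ ((n : ℝ≥0∞) + 1)⁻¹ := fun n => by
    obtain ⟨φ, hφ, _⟩ := hg.exists_boundedContinuous_eLpNorm_sub_le (by simp)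
      (ε := ((n : ℝ≥0∞) + 1)⁻¹) (by simp)
    exact ⟨φ.toContinuousMap, hφ⟩
  choose φ hφ using h
  refine ⟨φ, tendsto_of_tendsto_of_tendsto_of_le_of_le tendsto_const_nhds ?_
    (fun _ => zero_le) hφ⟩
  have := (tendsto_add_atTop_iff_nat 1).2 ENNReal.tendsto_inv_nat_nhds_zero
  simpa using this

theorem exists_borelVec {g : X → ℂ} {x : H} (hg : MemLp g 2 (vectorMeasure ρ x)) :
    ∃ y, ∀ φ : C(X, ℂ), ‖y - ρ φ x‖ₑ ≤ eLpNorm (g - ⇑φ) 2 (vectorMeasure ρ x) := by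
  obtain ⟨φ, hφ⟩ := exists_continuous_approx hg
  have hm : ∀ ψ : C(X, ℂ), AEStronglyMeasurable (g - ⇑ψ) (vectorMeasure ρ x) := fun ψ =>
    hg.1.sub ψ.continuous.aestronglyMeasurable
  have hle : ∀ ψ ψ' : C(X, ℂ), ‖ρ ψ x - ρ ψ' x‖ₑ ≤
      eLpNorm (g - ⇑ψ) 2 (vectorMeasure ρ x) + eLpNorm (g - ⇑ψ') 2 (vectorMeasure ρ x) := by
    intro ψ ψ'
    rw [← sub_apply, ← map_sub, enorm_map_apply, ContinuousMap.coe_sub,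
      show ⇑ψ - ⇑ψ' = (g - ⇑ψ') - (g - ⇑ψ) by abel, add_comm]
    exact eLpNorm_sub_le (hm ψ') (hm ψ) (by norm_num)
  have hc : CauchySeq fun n => ρ (φ n) x := by
    refine EMetric.cauchySeq_iff.2 fun ε hε => ?_
    have hε2 : 0 < ε / 2 := ENNReal.half_pos hε.ne'
    by_cases hεt : ε = ∞
    · exact ⟨0, fun m _ n _ => by rw [hεt]; exact edist_lt_top _ _⟩
    obtain ⟨n₀, hn₀⟩ := eventually_atTop.1 (hφ.eventually_lt_const hε2)
    refine ⟨n₀, fun m hm n hn => ?_⟩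
    rw [edist_eq_enorm_sub]
    refine (hle _ _).trans_lt ((ENNReal.add_lt_add (hn₀ m hm) (hn₀ n hn)).trans_eq ?_)
    exact ENNReal.add_halves ε
  obtain ⟨y, hy⟩ := cauchySeq_tendsto_of_complete hc
  refine ⟨y, fun ψ => ?_⟩
  have h1 : Tendsto (fun n => ‖ρ (φ n) x - ρ ψ x‖ₑ) atTop (𝓝 ‖y - ρ ψ x‖ₑ) :=
    (hy.sub_const _).enorm
  have h2 : Tendsto (fun n => eLpNorm (g - ⇑(φ n)) 2 (vectorMeasure ρ x) +
      eLpNorm (g - ⇑ψ) 2 (vectorMeasure ρ x)) atTop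
      (𝓝 (eLpNorm (g - ⇑ψ) 2 (vectorMeasure ρ x))) := by
    simpa using hφ.add_const (eLpNorm (g - ⇑ψ) 2 (vectorMeasure ρ x))
  exact le_of_tendsto_of_tendsto' h1 h2 fun n => hle _ _

open Classical in
/-- The vector `g(ρ) x` for a function `g` that is square integrable with respect to the
measure of `x`. -/
def borelVec (g : X → ℂ) (x : H) : H :=
  if h : MemLp g 2 (vectorMeasure ρ x) then (exists_borelVec ρ h).choose else 0

variable {ρ}

theorem enorm_borelVec_sub_le {g : X → ℂ} {x : H} (hg : MemLp g 2 (vectorMeasure ρ x))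
    (φ : C(X, ℂ)) : ‖borelVec ρ g x - ρ φ x‖ₑ ≤ eLpNorm (g - ⇑φ) 2 (vectorMeasure ρ x) := by
  rw [borelVec, dif_pos hg]
  exact (exists_borelVec ρ hg).choose_spec φ

theorem tendsto_borelVec {g : X → ℂ} {x : H} (hg : MemLp g 2 (vectorMeasure ρ x))
    {φ : ℕ → C(X, ℂ)}
    (hφ : Tendsto (fun n => eLpNorm (g - ⇑(φ n)) 2 (vectorMeasure ρ x)) atTop (𝓝 0)) :
    Tendsto (fun n => ρ (φ n) x) atTop (𝓝 (borelVec ρ g x)) := by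
  rw [tendsto_iff_edist_tendsto_0]
  refine tendsto_of_tendsto_of_tendsto_of_le_of_le tendsto_const_nhds hφ (fun _ => zero_le)
    fun n => ?_
  rw [edist_comm, edist_eq_enorm_sub]
  exact enorm_borelVec_sub_le hg _

theorem borelVec_coe (φ : C(X, ℂ)) (x : H) : borelVec ρ φ x = ρ φ x := by
  have hφ : MemLp φ 2 (vectorMeasure ρ x) :=
    φ.continuous.memLp_of_hasCompactSupport (HasCompactSupport.of_compactSpace φ)
  have := enorm_borelVec_sub_le hφ φ
  simpa [sub_eq_zero] using this

/-- Approximation by the same continuous functions in several `L²` spaces. -/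
theorem exists_joint_approx {g : X → ℂ} {x y z : H} (hx : MemLp g 2 (vectorMeasure ρ x))
    (hy : MemLp g 2 (vectorMeasure ρ y)) (hz : MemLp g 2 (vectorMeasure ρ z)) :
    ∃ φ : ℕ → C(X, ℂ),
      Tendsto (fun n => eLpNorm (g - ⇑(φ n)) 2 (vectorMeasure ρ x)) atTop (𝓝 0) ∧
      Tendsto (fun n => eLpNorm (g - ⇑(φ n)) 2 (vectorMeasure ρ y)) atTop (𝓝 0) ∧
      Tendsto (fun n => eLpNorm (g - ⇑(φ n)) 2 (vectorMeasure ρ z)) atTop (𝓝 0) := by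
  set ν := vectorMeasure ρ x + vectorMeasure ρ y + vectorMeasure ρ z with hν
  have hg : MemLp g 2 ν := by
    have h2 : ∀ μ : Measure X, eLpNorm g 2 μ < ∞ ↔ ∫⁻ z, ‖g z‖ₑ ^ (2 : ℝ) ∂μ < ∞ := fun μ => by
      simpa using eLpNorm_lt_top_iff_lintegral_rpow_enorm_lt_top
        (f := g) (μ := μ) (p := 2) (by simp) (by simp)
    refine ⟨(hx.1.add_measure hy.1).add_measure hz.1, ?_⟩
    rw [h2, hν, lintegral_add_measure, lintegral_add_measure, ENNReal.add_lt_top,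
      ENNReal.add_lt_top]
    exact ⟨⟨(h2 _).1 hx.2, (h2 _).1 hy.2⟩, (h2 _).1 hz.2⟩
  obtain ⟨φ, hφ⟩ := exists_continuous_approx hg
  have hmono : ∀ μ : Measure X, μ ≤ ν →
      Tendsto (fun n => eLpNorm (g - ⇑(φ n)) 2 μ) atTop (𝓝 0) := fun μ hμ =>
    tendsto_of_tendsto_of_tendsto_of_le_of_le tendsto_const_nhds hφ (fun _ => zero_le)
      fun n => eLpNorm_mono_measure _ hμ
  refine ⟨φ, hmono _ ?_, hmono _ ?_, hmono _ ?_⟩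
  · exact (Measure.le_add_right le_rfl).trans (Measure.le_add_right le_rfl)
  · exact (Measure.le_add_left le_rfl).trans (Measure.le_add_right le_rfl)
  · exact Measure.le_add_left le_rfl

theorem borelVec_add {g : X → ℂ} {x y : H} (hx : MemLp g 2 (vectorMeasure ρ x))
    (hy : MemLp g 2 (vectorMeasure ρ y)) (hxy : MemLp g 2 (vectorMeasure ρ (x + y))) :
    borelVec ρ g (x + y) = borelVec ρ g x + borelVec ρ g y := by
  obtain ⟨φ, h1, h2, h3⟩ := exists_joint_approx hx hy hxy
  refine tendsto_nhds_unique (tendsto_borelVec hxy h3) ?_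
  simpa only [map_add] using (tendsto_borelVec hx h1).add (tendsto_borelVec hy h2)

theorem borelVec_smul {g : X → ℂ} {x : H} (c : ℂ) (hx : MemLp g 2 (vectorMeasure ρ x))
    (hcx : MemLp g 2 (vectorMeasure ρ (c • x))) :
    borelVec ρ g (c • x) = c • borelVec ρ g x := by
  obtain ⟨φ, h1, h2, _⟩ := exists_joint_approx hx hcx hx
  refine tendsto_nhds_unique (tendsto_borelVec hcx h2) ?_
  simpa only [map_smul] using (tendsto_borelVec hx h1).const_smul c

theorem borelVec_sub_fun {g h : X → ℂ} {x : H} (hg : MemLp g 2 (vectorMeasure ρ x))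
    (hh : MemLp h 2 (vectorMeasure ρ x)) :
    borelVec ρ (g - h) x = borelVec ρ g x - borelVec ρ h x := by
  obtain ⟨φ, h1⟩ := exists_continuous_approx hg
  obtain ⟨ψ, h2⟩ := exists_continuous_approx hh
  refine tendsto_nhds_unique (tendsto_borelVec (hg.sub hh) (φ := fun n => φ n - ψ n) ?_) ?_
  · refine tendsto_of_tendsto_of_tendsto_of_le_of_le tendsto_const_nhds
      (by simpa using h1.add h2) (fun _ => zero_le) fun n => ?_
    have : g - h - ⇑(φ n - ψ n) = (g - ⇑(φ n)) - (h - ⇑(ψ n)) := by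
      rw [ContinuousMap.coe_sub]; abel
    simp only [this]
    exact eLpNorm_sub_le (hg.1.sub (φ n).continuous.aestronglyMeasurable)
      (hh.1.sub (ψ n).continuous.aestronglyMeasurable) (by norm_num)
  · simpa only [map_sub, sub_apply] using (tendsto_borelVec hg h1).sub (tendsto_borelVec hh h2)

theorem enorm_borelVec {g : X → ℂ} {x : H} (hg : MemLp g 2 (vectorMeasure ρ x)) :
    ‖borelVec ρ g x‖ₑ = eLpNorm g 2 (vectorMeasure ρ x) := by
  obtain ⟨φ, hφ⟩ := exists_continuous_approx hg
  have h1 := (tendsto_borelVec hg hφ).enorm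
  simp only [enorm_map_apply] at h1
  refine tendsto_nhds_unique h1 ?_
  have hm : ∀ n, AEStronglyMeasurable (g - ⇑(φ n)) (vectorMeasure ρ x) := fun n =>
    hg.1.sub (φ n).continuous.aestronglyMeasurable
  refine tendsto_of_tendsto_of_tendsto_of_le_of_le
    (g := fun n => eLpNorm g 2 (vectorMeasure ρ x) - eLpNorm (g - ⇑(φ n)) 2 (vectorMeasure ρ x))
    (h := fun n => eLpNorm g 2 (vectorMeasure ρ x) + eLpNorm (g - ⇑(φ n)) 2 (vectorMeasure ρ x))
    ?_ ?_ (fun n => ?_) fun n => ?_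
  · simpa using ENNReal.Tendsto.sub tendsto_const_nhds hφ (Or.inl hg.2.ne)
  · simpa using hφ.const_add (eLpNorm g 2 (vectorMeasure ρ x))
  · rw [tsub_le_iff_right]
    have := eLpNorm_add_le (p := 2) (φ n).continuous.aestronglyMeasurable (hm n) (by norm_num)
    simpa using this
  · have := eLpNorm_sub_le (p := 2) hg.1 (hm n) (by norm_num)
    simpa using this

theorem memLp_vectorMeasure_of_bounded {g : X → ℂ} (hg : Measurable g) {C : ℝ}
    (hC : ∀ t, ‖g t‖ ≤ C) (x : H) : MemLp g 2 (vectorMeasure ρ x) :=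
  MemLp.of_bound hg.aestronglyMeasurable C (ae_of_all _ hC)

theorem norm_borelVec_le {g : X → ℂ} (hg : Measurable g) {C : ℝ} (hC : ∀ t, ‖g t‖ ≤ C) (x : H) :
    ‖borelVec ρ g x‖ ≤ C * ‖x‖ := by
  -- On an empty space `C` may be negative, but then the measure of `x` vanishes and `x = 0`.
  by_cases hX : IsEmpty X
  · have h0 : vectorMeasure ρ x Set.univ = 0 := by
      rw [Set.univ_eq_empty_iff.2 hX, measure_empty]
    rw [vectorMeasure_univ] at h0
    have hx : x = 0 := by simpa using h0
    have := enorm_borelVec (memLp_vectorMeasure_of_bounded (ρ := ρ) hg hC x)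
    have h1 : vectorMeasure ρ x = 0 := by
      rw [← Measure.measure_univ_eq_zero, vectorMeasure_univ, hx]; simp
    rw [h1] at this
    simp only [eLpNorm_measure_zero, enorm_eq_zero] at this
    rw [this, norm_zero, hx, norm_zero, mul_zero]
  rw [not_isEmpty_iff] at hX
  obtain ⟨t⟩ := hX
  have hC0 : 0 ≤ C := (norm_nonneg _).trans (hC t)
  have h := eLpNorm_le_of_ae_bound (p := 2) (ae_of_all (vectorMeasure ρ x) hC)
  rw [← enorm_borelVec (memLp_vectorMeasure_of_bounded hg hC x), vectorMeasure_univ,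
    ← ENNReal.rpow_natCast, ← ENNReal.rpow_mul] at h
  norm_num at h
  rw [← ofReal_norm, ← ofReal_norm, ← ENNReal.ofReal_mul (norm_nonneg _),
    ENNReal.ofReal_le_ofReal_iff (by positivity)] at h
  rwa [mul_comm]

variable (ρ) in
/-- The operator `g(ρ)` for a bounded Borel function `g`. -/
def borelOp (g : X → ℂ) (hg : Measurable g) {C : ℝ} (hC : ∀ t, ‖g t‖ ≤ C) : H →L[ℂ] H :=
  LinearMap.mkContinuous
    { toFun := borelVec ρ g
      map_add' := fun x y => borelVec_add (memLp_vectorMeasure_of_bounded hg hC x)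
        (memLp_vectorMeasure_of_bounded hg hC y) (memLp_vectorMeasure_of_bounded hg hC (x + y))
      map_smul' := fun c x => borelVec_smul c (memLp_vectorMeasure_of_bounded hg hC x)
        (memLp_vectorMeasure_of_bounded hg hC (c • x)) } C (norm_borelVec_le hg hC)

/-- One sequence approximating `g` for both `x` and `ρ ψ x` reduces this to multiplicativity of `ρ`,
with no need to identify the measure of `ρ ψ x`. -/
theorem borelVec_map {g : X → ℂ} (hg : Measurable g) {C : ℝ} (hC : ∀ t, ‖g t‖ ≤ C)
    (ψ : C(X, ℂ)) (x : H) : borelVec ρ g (ρ ψ x) = borelVec ρ (g * ⇑ψ) x := by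
  have hm := memLp_vectorMeasure_of_bounded (ρ := ρ) hg hC
  have hψ : MemLp ψ 2 (vectorMeasure ρ x) :=
    ψ.continuous.memLp_of_hasCompactSupport (HasCompactSupport.of_compactSpace ψ)
  obtain ⟨φ, h1, h2, _⟩ := exists_joint_approx (hm x) (hm (ρ ψ x)) (hm x)
  refine tendsto_nhds_unique (tendsto_borelVec (hm _) h2) ?_
  simp only [← map_mul_apply]
  refine tendsto_borelVec (memLp_bounded_mul hg hC hψ) ?_
  refine tendsto_of_tendsto_of_tendsto_of_le_of_le tendsto_const_nhds
    (h := fun n => ENNReal.ofReal ‖ψ‖ * eLpNorm (g - ⇑(φ n)) 2 (vectorMeasure ρ x)) ?_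
    (fun _ => zero_le) fun n => ?_
  · rw [← mul_zero (ENNReal.ofReal ‖ψ‖)]
    exact ENNReal.Tendsto.const_mul h1 (Or.inr ENNReal.ofReal_ne_top)
  · have : g * ⇑ψ - ⇑(φ n * ψ) = ⇑ψ * (g - ⇑(φ n)) := by
      rw [ContinuousMap.coe_mul]; ring
    simp only [this]
    exact eLpNorm_bounded_mul_le ψ.norm_coe_le_norm

theorem borelVec_borelVec {g h : X → ℂ} (hg : Measurable g) {C : ℝ} (hC : ∀ t, ‖g t‖ ≤ C)
    {x : H} (hh : MemLp h 2 (vectorMeasure ρ x)) :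
    borelVec ρ g (borelVec ρ h x) = borelVec ρ (g * h) x := by
  obtain ⟨ψ, hψ⟩ := exists_continuous_approx hh
  have h1 : Tendsto (fun n => borelVec ρ g (ρ (ψ n) x)) atTop
      (𝓝 (borelVec ρ g (borelVec ρ h x))) :=
    ((borelOp ρ g hg hC).continuous.tendsto _).comp (tendsto_borelVec hh hψ)
  refine tendsto_nhds_unique h1 ?_
  simp only [borelVec_map hg hC]
  have hψm : ∀ n, MemLp (ψ n) 2 (vectorMeasure ρ x) := fun n =>
    (ψ n).continuous.memLp_of_hasCompactSupport (HasCompactSupport.of_compactSpace _)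
  rw [tendsto_iff_edist_tendsto_0]
  refine tendsto_of_tendsto_of_tendsto_of_le_of_le tendsto_const_nhds
    (h := fun n => ENNReal.ofReal C * eLpNorm (h - ⇑(ψ n)) 2 (vectorMeasure ρ x)) ?_
    (fun _ => zero_le) fun n => ?_
  · simpa using ENNReal.Tendsto.const_mul hψ (Or.inr ENNReal.ofReal_ne_top)
  · simp only
    rw [edist_comm, edist_eq_enorm_sub, ← borelVec_sub_fun (memLp_bounded_mul hg hC hh)
      (memLp_bounded_mul hg hC (hψm n)), ← mul_sub,
      enorm_borelVec (memLp_bounded_mul hg hC (hh.sub (hψm n)))]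
    exact eLpNorm_bounded_mul_le hC

theorem inner_borelVec_left {g : X → ℂ} (hg : Measurable g) {C : ℝ} (hC : ∀ t, ‖g t‖ ≤ C)
    (hreal : ∀ t, star (g t) = g t) (x y : H) :
    ⟪borelVec ρ g x, y⟫_ℂ = ⟪x, borelVec ρ g y⟫_ℂ := by
  have hm := memLp_vectorMeasure_of_bounded (ρ := ρ) hg hC
  obtain ⟨φ, h1, h2, _⟩ := exists_joint_approx (hm x) (hm y) (hm x)
  have t1 : Tendsto (fun n => ⟪ρ (φ n) x, y⟫_ℂ) atTop (𝓝 ⟪borelVec ρ g x, y⟫_ℂ) :=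
    (tendsto_borelVec (hm x) h1).inner tendsto_const_nhds
  have t2 : Tendsto (fun n => ρ (star (φ n)) y) atTop (𝓝 (borelVec ρ g y)) := by
    refine tendsto_borelVec (hm y) ?_
    convert h2 using 2 with n
    refine eLpNorm_congr_norm_ae (ae_of_all _ fun t => ?_)
    rw [Pi.sub_apply, Pi.sub_apply, ContinuousMap.star_apply, ← hreal t, ← star_sub, norm_star,
      hreal t]
  refine tendsto_nhds_unique t1 ?_
  simp only [inner_map_left]
  exact tendsto_const_nhds.inner t2

end BorelCalculus
end

noncomputable section

/-! ### The spectral measure induced by a Borel function on `X`. -/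

namespace BorelCalculus

theorem measurable_indicator_one {Y : Type*} [MeasurableSpace Y] {S : Set Y} (hS : MeasurableSet S) :
    Measurable (S.indicator (1 : Y → ℂ)) := measurable_one.indicator hS

theorem norm_indicator_one_le {Y : Type*} (S : Set Y) (t : Y) : ‖S.indicator (1 : Y → ℂ) t‖ ≤ 1 := by
  by_cases h : t ∈ S <;> simp [h]

variable {X : Type*} [TopologicalSpace X] [T2Space X] [CompactSpace X] [MeasurableSpace X]
  [BorelSpace X]
variable {H : Type*} [NormedAddCommGroup H] [InnerProductSpace ℂ H] [CompleteSpace H]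
variable {ρ : C(X, ℂ) →⋆ₐ[ℂ] (H →L[ℂ] H)}

theorem borelVec_smul_fun (c : ℂ) {h : X → ℂ} {x : H} (hh : MemLp h 2 (vectorMeasure ρ x)) :
    borelVec ρ (c • h) x = c • borelVec ρ h x := by
  have h1 := borelVec_borelVec (ρ := ρ) (g := ⇑(ContinuousMap.const X c)) measurable_const
    (C := ‖c‖) (fun _ => le_rfl) hh
  have h2 : ContinuousMap.const X c = algebraMap ℂ C(X, ℂ) c := by ext; simp
  rw [borelVec_coe, h2, AlgHomClass.commutes, Algebra.algebraMap_eq_smul_one] at h1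
  rw [← h2] at h1
  exact h1.symm

theorem borelVec_zero_fun (x : H) : borelVec ρ (0 : X → ℂ) x = 0 := by
  have h := borelVec_coe (ρ := ρ) 0 x
  rwa [map_zero] at h

theorem borelVec_add_fun {g h : X → ℂ} {x : H} (hg : MemLp g 2 (vectorMeasure ρ x))
    (hh : MemLp h 2 (vectorMeasure ρ x)) :
    borelVec ρ (g + h) x = borelVec ρ g x + borelVec ρ h x := by
  have := borelVec_sub_fun (hg.add hh) hh
  rw [add_sub_cancel_right] at this
  rw [this, sub_add_cancel]

theorem borelVec_sum_fun {ι : Type*} (s : Finset ι) (g : ι → X → ℂ) {x : H}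
    (hg : ∀ i, MemLp (g i) 2 (vectorMeasure ρ x)) :
    borelVec ρ (∑ i ∈ s, g i) x = ∑ i ∈ s, borelVec ρ (g i) x := by
  classical
  induction s using Finset.induction_on with
  | empty => simp [borelVec_zero_fun]
  | insert i s hi ih =>
    rw [Finset.sum_insert hi, Finset.sum_insert hi,
      borelVec_add_fun (hg i) (memLp_finsetSum' s fun i _ => hg i), ih]

theorem memLp_indicator_one {S : Set X} (hS : MeasurableSet S) (x : H) :
    MemLp (S.indicator (1 : X → ℂ)) 2 (vectorMeasure ρ x) :=
  memLp_vectorMeasure_of_bounded (measurable_indicator_one hS) (norm_indicator_one_le S) x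

theorem enorm_borelVec_indicator_sq {S : Set X} (hS : MeasurableSet S) (x : H) :
    ‖borelVec ρ (S.indicator 1) x‖ₑ ^ 2 = vectorMeasure ρ x S := by
  rw [enorm_borelVec (memLp_indicator_one hS x),
    eLpNorm_eq_lintegral_rpow_enorm_toReal (by simp) (by simp)]
  simp only [ENNReal.toReal_ofNat, ENNReal.rpow_ofNat]
  rw [← ENNReal.rpow_natCast, ← ENNReal.rpow_mul]
  have : ∀ t, ‖S.indicator (1 : X → ℂ) t‖ₑ ^ 2 = S.indicator (1 : X → ℝ≥0∞) t := fun t => by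
    by_cases h : t ∈ S <;> simp [h]
  simp only [this, lintegral_indicator_one hS]
  norm_num

theorem borelVec_indicator_union {S T : Set X} (hS : MeasurableSet S) (hT : MeasurableSet T)
    (hd : Disjoint S T) (x : H) : borelVec ρ ((S ∪ T).indicator 1) x =
      borelVec ρ (S.indicator 1) x + borelVec ρ (T.indicator 1) x := by
  rw [← borelVec_add_fun (memLp_indicator_one hS x) (memLp_indicator_one hT x),
    Set.indicator_union_of_disjoint hd]
  rfl

theorem borelVec_indicator_biUnion {S : ℕ → Set X} (hS : ∀ n, MeasurableSet (S n))
    (hd : Pairwise (Function.onFun Disjoint S)) (F : Finset ℕ) (x : H) :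
    borelVec ρ ((⋃ n ∈ F, S n).indicator 1) x = ∑ n ∈ F, borelVec ρ ((S n).indicator 1) x := by
  classical
  induction F using Finset.induction_on with
  | empty =>
    have : ((⋃ n ∈ (∅ : Finset ℕ), S n).indicator (1 : X → ℂ)) = 0 := by ext; simp
    rw [this, borelVec_zero_fun]; simp
  | insert i F hi ih =>
    rw [Finset.sum_insert hi, ← ih, Finset.set_biUnion_insert, borelVec_indicator_union (hS i)
      (F.measurableSet_biUnion fun n _ => hS n)]
    rw [Set.disjoint_iUnion₂_right]
    exact fun n hn => hd (by rintro rfl; exact hi hn)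

/-- The remainder after finitely many terms is the vector of the remaining union; its squared norm
is the measure of that union, at most the tail of a convergent series. -/
theorem hasSum_borelVec_indicator {S : ℕ → Set X} (hS : ∀ n, MeasurableSet (S n))
    (hd : Pairwise (Function.onFun Disjoint S)) (x : H) :
    HasSum (fun n => borelVec ρ ((S n).indicator 1) x)
      (borelVec ρ ((⋃ n, S n).indicator 1) x) := by
  have hU : ∀ F : Finset ℕ, borelVec ρ ((⋃ n, S n).indicator 1) x -
      ∑ n ∈ F, borelVec ρ ((S n).indicator 1) x =
        borelVec ρ ((⋃ n : {n // n ∉ F}, S n).indicator 1) x := fun F => by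
    rw [← borelVec_indicator_biUnion hS hd, sub_eq_iff_eq_add', ← borelVec_indicator_union
      (F.measurableSet_biUnion fun n _ => hS n) (MeasurableSet.iUnion fun n : {n // n ∉ F} => hS n)]
    · congr 2
      ext t
      simp only [Set.mem_iUnion, Set.mem_union, Subtype.exists, exists_prop]
      constructor
      · rintro ⟨n, hn⟩
        by_cases h : n ∈ F
        · exact Or.inl ⟨n, h, hn⟩
        · exact Or.inr ⟨n, h, hn⟩
      · rintro (⟨n, _, hn⟩ | ⟨n, _, hn⟩) <;> exact ⟨n, hn⟩
    · rw [Set.disjoint_iUnion₂_left]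
      intro n hn
      rw [Set.disjoint_iUnion_right]
      rintro ⟨m, hm⟩
      exact hd (by rintro rfl; exact hm hn)
  have hsum : ∑' n, vectorMeasure ρ x (S n) ≠ ∞ := by
    rw [← measure_iUnion hd hS]; exact measure_ne_top _ _
  have hlim := ENNReal.tendsto_tsum_compl_atTop_zero hsum
  have h0 : Tendsto (fun F : Finset ℕ => ‖borelVec ρ ((⋃ n, S n).indicator 1) x -
      ∑ n ∈ F, borelVec ρ ((S n).indicator 1) x‖ₑ ^ 2) atTop (𝓝 0) := by
    refine tendsto_of_tendsto_of_tendsto_of_le_of_le tendsto_const_nhds hlim (fun _ => zero_le)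
      fun F => ?_
    simp only [hU]
    rw [enorm_borelVec_indicator_sq (MeasurableSet.iUnion fun n : {n // n ∉ F} => hS n)]
    exact measure_iUnion_le _
  have h1 : Tendsto (fun F : Finset ℕ => ‖borelVec ρ ((⋃ n, S n).indicator 1) x -
      ∑ n ∈ F, borelVec ρ ((S n).indicator 1) x‖ₑ) atTop (𝓝 0) := by
    have := (ENNReal.continuous_rpow_const (y := 1 / 2)).tendsto 0 |>.comp h0
    simp only [Function.comp_def, ← ENNReal.rpow_natCast, ← ENNReal.rpow_mul] at this
    norm_num at this
    exact this
  change Tendsto _ _ _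
  rw [SummationFilter.unconditional_filter, tendsto_iff_edist_tendsto_0]
  simpa only [edist_comm, edist_eq_enorm_sub] using h1

open Classical in
variable (ρ) in
/-- The spectral measure on `ℂ` obtained from a representation of `C(X)` and a Borel
function `π` on `X`. -/
def spectralMeasure (π : X → ℂ) (hπ : Measurable π) : SpectralMeasure H where
  proj S := if h : MeasurableSet S then
    borelOp ρ ((π ⁻¹' S).indicator 1) (measurable_indicator_one (hπ h)) (norm_indicator_one_le _)
    else 0
  isStarProjection S hS := by
    rw [dif_pos hS]
    constructor
    · ext x
      change borelVec ρ _ (borelVec ρ _ x) = borelVec ρ _ x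
      rw [borelVec_borelVec (measurable_indicator_one (hπ hS)) (norm_indicator_one_le _)
        (memLp_indicator_one (hπ hS) x)]
      congr 1
      ext t
      by_cases h : t ∈ π ⁻¹' S <;> simp [h]
    · rw [ContinuousLinearMap.isSelfAdjoint_iff_isSymmetric]
      exact fun x y => inner_borelVec_left (measurable_indicator_one (hπ hS))
        (norm_indicator_one_le _) (fun t => by by_cases h : t ∈ π ⁻¹' S <;> simp [h]) x y
  proj_univ := by
    rw [dif_pos MeasurableSet.univ]
    ext x
    change borelVec ρ _ x = x
    have h := borelVec_coe (ρ := ρ) 1 x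
    rw [map_one] at h
    simpa using h
  proj_inter S T hS hT := by
    rw [dif_pos hS, dif_pos hT, dif_pos (hS.inter hT)]
    ext x
    change borelVec ρ _ x = borelVec ρ _ (borelVec ρ _ x)
    rw [borelVec_borelVec (measurable_indicator_one (hπ hS)) (norm_indicator_one_le _)
        (memLp_indicator_one (hπ hT) x), Set.preimage_inter, Set.inter_indicator_one]
  hasSum_proj S hS hd x := by
    simp only [hS, MeasurableSet.iUnion hS, dif_pos, Set.preimage_iUnion]
    exact hasSum_borelVec_indicator (fun n => hπ (hS n)) (fun i j hij => (hd hij).preimage π) x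

variable {π : X → ℂ} (hπ : Measurable π)

theorem spectralMeasure_proj_apply {S : Set ℂ} (hS : MeasurableSet S) (x : H) :
    (spectralMeasure ρ π hπ).proj S x = borelVec ρ ((π ⁻¹' S).indicator 1) x := by
  simp only [spectralMeasure, hS, dif_pos]
  rfl

theorem scalarMeasure_spectralMeasure (x : H) :
    (spectralMeasure ρ π hπ).scalarMeasure x = (vectorMeasure ρ x).map π := by
  refine Measure.ext fun S hS => ?_
  rw [SpectralMeasure.scalarMeasure_apply _ _ hS, spectralMeasure_proj_apply hπ hS,
    enorm_borelVec_indicator_sq (hπ hS), Measure.map_apply hπ hS]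

theorem mem_integral_spectralMeasure_domain {f : ℂ → ℂ} (hf : Measurable f) {x : H} :
    x ∈ ((spectralMeasure ρ π hπ).integral f hf).domain ↔
      MemLp (f ∘ π) 2 (vectorMeasure ρ x) := by
  rw [SpectralMeasure.mem_integral_domain, scalarMeasure_spectralMeasure]
  exact memLp_map_measure_iff hf.aestronglyMeasurable hπ.aemeasurable

theorem simpleIntegral_spectralMeasure (s : SimpleFunc ℂ ℂ) (x : H) :
    (spectralMeasure ρ π hπ).simpleIntegral s x = borelVec ρ (s ∘ π) x := by
  have hs : ⇑s ∘ π = ∑ c ∈ s.range, c • (π ⁻¹' (s ⁻¹' {c})).indicator (1 : X → ℂ) := by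
    ext t
    rw [Finset.sum_apply, Finset.sum_eq_single (s (π t))]
    · simp
    · intro c _ hc
      simp [Ne.symm hc]
    · intro h
      exact absurd (s.mem_range_self _) h
  have hm : ∀ c, MemLp ((π ⁻¹' (s ⁻¹' {c})).indicator (1 : X → ℂ)) 2 (vectorMeasure ρ x) :=
    fun c => memLp_indicator_one (hπ (s.measurableSet_fiber c)) x
  rw [hs, borelVec_sum_fun _ _ fun c => (hm c).const_smul c]
  simp only [SpectralMeasure.simpleIntegral, sum_apply, smul_apply]
  refine Finset.sum_congr rfl fun c _ => ?_
  rw [spectralMeasure_proj_apply hπ (s.measurableSet_fiber c), borelVec_smul_fun c (hm c)]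

theorem integral_spectralMeasure {f : ℂ → ℂ} (hf : Measurable f)
    (x : ((spectralMeasure ρ π hπ).integral f hf).domain) :
    (spectralMeasure ρ π hπ).integral f hf x = borelVec ρ (f ∘ π) x := by
  have hx := (mem_integral_spectralMeasure_domain hπ hf).1 x.2
  refine tendsto_nhds_unique ((spectralMeasure ρ π hπ).tendsto_approx_integral hf x) ?_
  have h := (spectralMeasure ρ π hπ).tendsto_eLpNorm_approx hf x.2
  rw [tendsto_iff_edist_tendsto_0]
  convert h using 2 with n
  have hs : MemLp (SpectralMeasure.approx f hf n ∘ π) 2 (vectorMeasure ρ (x : H)) := by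
    obtain ⟨C, hC⟩ := (SpectralMeasure.approx f hf n).exists_forall_norm_le
    exact memLp_vectorMeasure_of_bounded ((SpectralMeasure.approx f hf n).measurable.comp hπ)
      (fun t => hC (π t)) _
  rw [simpleIntegral_spectralMeasure, edist_eq_enorm_sub, ← borelVec_sub_fun hs hx,
    enorm_borelVec (hs.sub hx), scalarMeasure_spectralMeasure, eLpNorm_map_measure
      ((SpectralMeasure.approx f hf n).measurable.sub hf).aestronglyMeasurable hπ.aemeasurable]
  rfl

end BorelCalculus
end

noncomputable section

universe u

/-! ### Gelfand representation of a commuting pair. -/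

section Gelfand

variable {H : Type u} [NormedAddCommGroup H] [InnerProductSpace ℂ H] [CompleteSpace H]

/-- Two commuting bounded normal operators are simultaneously represented by continuous functions
on a compact Hausdorff space. -/
theorem exists_joint_representation (B C : H →L[ℂ] H) (hB : star B = B)
    (hC : star C * C = C * star C) (hBC : B * C = C * B) :
    ∃ (X : Type u) (_ : TopologicalSpace X) (_ : T2Space X) (_ : CompactSpace X)
      (ρ : C(X, ℂ) →⋆ₐ[ℂ] (H →L[ℂ] H)) (b c : C(X, ℂ)),
      Function.Injective ρ ∧ ρ b = B ∧ ρ c = C := by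
  let S : Set (H →L[ℂ] H) := {B, C}
  let Z := StarSubalgebra.centralizer ℂ S
  -- The double commutant `A` is norm closed. As `B` and `C` commute with each other and with each
  -- other's adjoints, they lie in `Z`; hence `A ⊆ Z` and `A` is commutative.
  let A := StarSubalgebra.centralizer ℂ (Z : Set (H →L[ℂ] H))
  -- Self-adjointness of `B` gives this by taking adjoints, without Fuglede's theorem.
  have hBC' : B * star C = star C * B := by
    have := congrArg star hBC
    rw [star_mul, star_mul, hB] at this
    exact this.symm
  have hSZ : S ⊆ Z := by
    rintro g (rfl | rfl) <;> rw [SetLike.mem_coe, StarSubalgebra.mem_centralizer_iff] <;>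
      rintro g' (rfl | rfl)
    · exact ⟨rfl, by rw [hB]⟩
    · exact ⟨hBC.symm, hBC'.symm⟩
    · exact ⟨hBC, by rw [hB]; exact hBC⟩
    · exact ⟨rfl, hC⟩
  have hSA : S ⊆ A := by
    intro g hg
    rw [SetLike.mem_coe, StarSubalgebra.mem_centralizer_iff]
    intro z hz
    have h1 := (StarSubalgebra.mem_centralizer_iff ℂ).1 hz g hg
    refine ⟨h1.1.symm, ?_⟩
    have := congrArg star h1.2
    simpa [star_mul] using this
  have hcomm : ∀ a b : A, a * b = b * a := by
    rintro ⟨a, ha⟩ ⟨b, hb⟩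
    have hbZ : b ∈ Z := by
      rw [StarSubalgebra.mem_centralizer_iff]
      exact fun g hg => (StarSubalgebra.mem_centralizer_iff ℂ).1 hb g (hSZ hg)
    exact Subtype.ext ((StarSubalgebra.mem_centralizer_iff ℂ).1 ha b hbZ).1.symm
  have hcl : IsClosed (A : Set (H →L[ℂ] H)) := Set.isClosed_centralizer _
  let : CommCStarAlgebra A :=
    { (inferInstance : CStarAlgebra A) with mul_comm := hcomm }
  let Γ := gelfandStarTransform A
  refine ⟨WeakDual.characterSpace ℂ A, inferInstance, inferInstance, inferInstance,
    A.subtype.comp (Γ.symm : C(WeakDual.characterSpace ℂ A, ℂ) →⋆ₐ[ℂ] A),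
    Γ ⟨B, hSA (Or.inl rfl)⟩, Γ ⟨C, hSA (Or.inr rfl)⟩, ?_, ?_, ?_⟩
  · exact Subtype.val_injective.comp Γ.symm.injective
  · change ((Γ.symm (Γ ⟨B, _⟩) : A) : H →L[ℂ] H) = B
    rw [StarAlgEquiv.symm_apply_apply]
  · change ((Γ.symm (Γ ⟨C, _⟩) : A) : H →L[ℂ] H) = C
    rw [StarAlgEquiv.symm_apply_apply]

end Gelfand

/-! ### Reduction of an unbounded normal operator to bounded ones. -/

section Resolvent

variable {H : Type u} [NormedAddCommGroup H] [InnerProductSpace ℂ H] [CompleteSpace H]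
variable {N : H →ₗ.[ℂ] H}

theorem mem_adjoint_graph_iff (hd : Dense (N.domain : Set H)) {y z : H} :
    (y, z) ∈ N†.graph ↔ ∀ a b, (a, b) ∈ N.graph → ⟪b, y⟫_ℂ = ⟪a, z⟫_ℂ := by
  rw [LinearPMap.adjoint_graph_eq_graph_adjoint hd, Submodule.mem_adjoint_iff]
  simp only [sub_eq_zero]

/-- The operators `B = (1 + N* N)⁻¹` and `C = N B` of a closed densely defined operator. -/
theorem exists_resolvent (hd : Dense (N.domain : Set H)) (hc : N.IsClosed) :
    ∃ B C : H →L[ℂ] H, ∀ h, (B h, C h) ∈ N.graph ∧ (C h, h - B h) ∈ N†.graph := by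
  let e := WithLp.prodContinuousLinearEquiv 2 ℂ H H
  let G : Submodule ℂ (WithLp 2 (H × H)) := N.graph.comap (e : WithLp 2 (H × H) →ₗ[ℂ] H × H)
  have hG : IsClosed (G : Set (WithLp 2 (H × H))) := IsClosed.preimage e.continuous hc
  have : CompleteSpace G := hG.completeSpace_coe
  -- `(B h, C h)` is the orthogonal projection of `(h, 0)` onto the graph of `N`. Orthogonality of
  -- the residual `(h - B h, -C h)` to the graph says that `N†` sends `C h` to `h - B h`.
  let P : H →L[ℂ] H × H := (e : WithLp 2 (H × H) →L[ℂ] H × H) ∘L G.starProjection ∘L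
    (e.symm : H × H →L[ℂ] WithLp 2 (H × H)) ∘L ContinuousLinearMap.inl ℂ H H
  refine ⟨ContinuousLinearMap.fst ℂ H H ∘L P, ContinuousLinearMap.snd ℂ H H ∘L P, fun h => ?_⟩
  have hmem : e (G.starProjection (e.symm (h, 0))) ∈ N.graph :=
    Submodule.starProjection_apply_mem G (e.symm (h, 0))
  refine ⟨hmem, (mem_adjoint_graph_iff hd).2 fun a b hab => ?_⟩
  have ho := Submodule.sub_starProjection_mem_orthogonal (K := G) (e.symm (h, 0))
  have hab' : e.symm (a, b) ∈ G := by
    change e (e.symm (a, b)) ∈ N.graph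
    simpa using hab
  have h1 := (Submodule.mem_orthogonal G _).1 ho _ hab'
  rw [WithLp.prod_inner_apply] at h1
  change ⟪a, h - (P h).1⟫_ℂ + ⟪b, 0 - (P h).2⟫_ℂ = 0 at h1
  rw [zero_sub, inner_neg_right, add_neg_eq_zero] at h1
  exact h1.symm

theorem resolvent_injective {B C : H →L[ℂ] H}
    (hBC : ∀ h, (B h, C h) ∈ N.graph ∧ (C h, h - B h) ∈ N†.graph) {h : H} (hh : B h = 0) : h = 0 := by
  obtain ⟨h₁, h₂⟩ := hBC h
  rw [hh] at h₁ h₂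
  have h₃ : C h = 0 := N.graph_fst_eq_zero_snd h₁ rfl
  rw [h₃, sub_zero] at h₂
  exact N†.graph_fst_eq_zero_snd h₂ rfl

variable (hN : IsNormalOperator N) {B C : H →L[ℂ] H}
  (hBC : ∀ h, (B h, C h) ∈ N.graph ∧ (C h, h - B h) ∈ N†.graph)
include hN hBC

/-- Injectivity of `1 + N* N`: the difference `u` of two solutions satisfies `N* N u = -u`, hence
`‖N u‖² = -‖u‖²`. -/
theorem resolvent_unique {x y z : H} (h₁ : (x, y) ∈ N.graph) (h₂ : (y, z) ∈ N†.graph) :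
    x = B (x + z) ∧ y = C (x + z) := by
  set h := x + z
  have g₁ := N.graph.sub_mem h₁ (hBC h).1
  have g₂ := N†.graph.sub_mem h₂ (hBC h).2
  rw [Prod.mk_sub_mk] at g₁ g₂
  have g₃ := (mem_adjoint_graph_iff hN.dense_domain).1 g₂ _ _ g₁
  rw [show z - (h - B h) = -(x - B h) by simp only [h]; abel, inner_neg_right,
    inner_self_eq_norm_sq_to_K, inner_self_eq_norm_sq_to_K] at g₃
  have g₄ : ‖y - C h‖ ^ 2 = -‖x - B h‖ ^ 2 := by exact_mod_cast g₃
  have h₃ : ‖x - B h‖ = 0 := by nlinarith [sq_nonneg ‖y - C h‖, sq_nonneg ‖x - B h‖]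
  have h₄ : ‖y - C h‖ = 0 := by nlinarith [sq_nonneg ‖y - C h‖, sq_nonneg ‖x - B h‖]
  exact ⟨sub_eq_zero.1 (norm_eq_zero.1 h₃), sub_eq_zero.1 (norm_eq_zero.1 h₄)⟩

/-- By construction `N N*` sends `C x` to `y - C x`. Normality replaces `N N*` by `N* N`, so `C x`
solves the equation defining `B y`. -/
theorem resolvent_commute {x y : H} (h : (x, y) ∈ N.graph) : C x = B y := by
  have h₁ := N.graph.sub_mem h (hBC x).1
  rw [Prod.mk_sub_mk] at h₁
  obtain ⟨w, hw₁, hw₂⟩ := (hN.comm (C x) (y - C x)).2 ⟨x - B x, (hBC x).2, h₁⟩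
  have := (resolvent_unique hN hBC hw₁ hw₂).1
  rwa [add_sub_cancel] at this

theorem resolvent_inner (h k : H) : ⟪B h, k⟫_ℂ = ⟪B h, B k⟫_ℂ + ⟪C h, C k⟫_ℂ := by
  rw [(mem_adjoint_graph_iff hN.dense_domain).1 (hBC k).2 _ _ (hBC h).1, ← inner_add_right,
    add_sub_cancel]

theorem resolvent_star : star B = B := by
  refine (ContinuousLinearMap.isSelfAdjoint_iff_isSymmetric.2 fun h k => ?_ : IsSelfAdjoint B)
  change ⟪B h, k⟫_ℂ = ⟪h, B k⟫_ℂ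
  rw [← inner_conj_symm h (B k), resolvent_inner hN hBC h k, resolvent_inner hN hBC k h, map_add,
    inner_conj_symm, inner_conj_symm]

theorem resolvent_inner_left (h k : H) : ⟪B h, k⟫_ℂ = ⟪h, B k⟫_ℂ :=
  ContinuousLinearMap.isSelfAdjoint_iff_isSymmetric.1 (resolvent_star hN hBC) h k

theorem resolvent_star_mul_self : star C * C = B - B * B := by
  ext k
  refine ext_inner_left ℂ fun h => ?_
  change ⟪h, ContinuousLinearMap.adjoint C (C k)⟫_ℂ = ⟪h, B k - B (B k)⟫_ℂ
  rw [ContinuousLinearMap.adjoint_inner_right, inner_sub_right, ← resolvent_inner_left hN hBC h k,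
    ← resolvent_inner_left hN hBC h (B k), resolvent_inner hN hBC h k]
  ring

/-- Normality puts `B h` in the domain of `N N*`. The intermediate vector `N* (B h)` is `star C h`,
as seen by pairing with the dense domain. -/
theorem resolvent_star_mem (h : H) : (star C h, h - B h) ∈ N.graph := by
  obtain ⟨w, hw₁, hw₂⟩ := (hN.comm (B h) (h - B h)).1 ⟨C h, hBC h⟩
  have hw : w = star C h := by
    refine hN.dense_domain.eq_of_inner_right ℂ fun k hk => ?_
    have hg : (k, N ⟨k, hk⟩) ∈ N.graph := N.mem_graph ⟨k, hk⟩
    have h₁ := (mem_adjoint_graph_iff hN.dense_domain).1 hw₁ _ _ hg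
    rw [← h₁, ContinuousLinearMap.star_eq_adjoint, ContinuousLinearMap.adjoint_inner_right,
      resolvent_commute hN hBC hg, resolvent_inner_left hN hBC]
  rwa [← hw]

theorem resolvent_mul_star_self : C * star C = B - B * B := by
  ext h
  change C (star C h) = B h - B (B h)
  rw [resolvent_commute hN hBC (resolvent_star_mem hN hBC h), map_sub]

theorem resolvent_mul_comm : B * C = C * B := by
  ext h
  exact (resolvent_commute hN hBC (hBC h).1).symm

/-- The graph of a normal operator in terms of the bounded operators `B` and `C`. -/
theorem mem_graph_iff_resolvent {x v : H} : (x, v) ∈ N.graph ↔ B v = C x := by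
  refine ⟨fun h => (resolvent_commute hN hBC h).symm, fun h => ?_⟩
  have hcomm : B * star C = star C * B := by
    have := congrArg star (resolvent_mul_comm hN hBC)
    rw [star_mul, star_mul, resolvent_star hN hBC] at this
    exact this.symm
  -- Once `star C v = x - B x`, the pair `(x, v)` is the sum of the graph elements `(star C v, v - B
  -- v)` and `(B x, C x)`.
  have h₁ : B (star C v) = B (x - B x) := by
    calc B (star C v) = star C (B v) := congrArg (fun T : H →L[ℂ] H => T v) hcomm
      _ = (star C * C) x := by rw [h]; rfl
      _ = B (x - B x) := by rw [resolvent_star_mul_self hN hBC, map_sub]; rfl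
  have h₂ : star C v = x - B x :=
    sub_eq_zero.1 (resolvent_injective hBC (by rw [map_sub, h₁, sub_self]))
  have h₃ := N.graph.add_mem (resolvent_star_mem hN hBC v) (hBC x).1
  rw [h₂, h, Prod.mk_add_mk, sub_add_cancel, sub_add_cancel] at h₃
  exact h₃

end Resolvent

/-! ### The spectral theorem for unbounded normal operators. -/

section SpectralTheorem

variable {H : Type u} [NormedAddCommGroup H] [InnerProductSpace ℂ H] [CompleteSpace H]

open BorelCalculus in
/-- The **spectral theorem** for unbounded normal operators. -/
theorem IsNormalOperator.exists_spectralMeasure {N : H →ₗ.[ℂ] H} (hN : IsNormalOperator N) :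
    ∃ E : SpectralMeasure H, N = E.integral (fun z => z) measurable_id := by
  obtain ⟨B, C, hBC⟩ := exists_resolvent hN.dense_domain hN.isClosed
  have hCC := resolvent_star_mul_self hN hBC
  obtain ⟨X, _, _, _, ρ, b, c, hρ, hb, hc⟩ := exists_joint_representation B C
    (resolvent_star hN hBC) (hCC.trans (resolvent_mul_star_self hN hBC).symm)
    (resolvent_mul_comm hN hBC)
  let : MeasurableSpace X := borel X
  have : BorelSpace X := ⟨rfl⟩
  -- Injectivity of `ρ` transfers the operator identity to functions; it forces `c = 0` wherever `b
  -- = 0`, so the convention `c / 0 = 0` is compatible with `b * π = c`.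
  have hbc : star c * c = b - b * b := hρ (by
    rw [map_mul, map_star, map_sub, map_mul, hb, hc, hCC])
  have hc0 : ∀ t, b t = 0 → c t = 0 := fun t ht => by
    have := congrArg (fun f : C(X, ℂ) => f t) hbc
    simpa [ht] using this
  let π : X → ℂ := fun t => c t / b t
  have hπ : Measurable π := c.continuous.measurable.div b.continuous.measurable
  have hbπ : ⇑b * π = ⇑c := by
    ext t
    by_cases ht : b t = 0
    · simp [ht, hc0 t ht]
    · simp only [Pi.mul_apply, π]; field_simp
  have hbm : Measurable b := b.continuous.measurable
  have hbC : ∀ t, ‖b t‖ ≤ ‖b‖ := b.norm_coe_le_norm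
  refine ⟨spectralMeasure ρ π hπ, LinearPMap.eq_of_eq_graph ?_⟩
  have hMem : ∀ {x : H}, MemLp π 2 (vectorMeasure ρ x) → B (borelVec ρ π x) = C x := fun hx => by
    rw [← hb, ← hc, ← borelVec_coe, borelVec_borelVec hbm hbC hx, hbπ, borelVec_coe]
  ext ⟨x, v⟩
  rw [mem_graph_iff_resolvent hN hBC, LinearPMap.mem_graph_iff]
  constructor
  · intro h
    -- `κ n` is `b⁻¹` cut off where `b` is small. From `B v = C x` one gets `κ n (c) x = (κ n b) v`,
    -- of norm at most `‖v‖`.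
    let κ : ℕ → X → ℂ := fun n => {t | ((n : ℝ) + 1)⁻¹ ≤ ‖b t‖}.indicator fun t => (b t)⁻¹
    have hκm : ∀ n, Measurable (κ n) := fun n =>
      hbm.inv.indicator (measurableSet_le measurable_const hbm.norm)
    have hκC : ∀ n t, ‖κ n t‖ ≤ (n : ℝ) + 1 := fun n t => by
      by_cases ht : t ∈ {t | ((n : ℝ) + 1)⁻¹ ≤ ‖b t‖}
      · simp only [κ, Set.indicator_of_mem ht, norm_inv]
        exact inv_le_of_inv_le₀ (by positivity) ht
      · simp only [κ, Set.indicator_of_notMem ht, norm_zero]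
        positivity
    have hκ1 : ∀ n t, ‖(κ n * ⇑b) t‖ ≤ 1 := fun n t => by
      by_cases ht : t ∈ {t | ((n : ℝ) + 1)⁻¹ ≤ ‖b t‖}
      · simp only [κ, Pi.mul_apply, Set.indicator_of_mem ht]
        by_cases h0 : b t = 0 <;> simp [h0]
      · simp [κ, Set.indicator_of_notMem ht]
    have hκc : ∀ n, MemLp (κ n * ⇑c) 2 (vectorMeasure ρ x) := fun n =>
      memLp_bounded_mul (hκm n) (hκC n)
        (c.continuous.memLp_of_hasCompactSupport (HasCompactSupport.of_compactSpace c))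
    have hbound : ∀ n, eLpNorm (κ n * ⇑c) 2 (vectorMeasure ρ x) ≤ ‖v‖ₑ := fun n => by
      rw [← enorm_borelVec (hκc n), ← borelVec_map (hκm n) (hκC n), hc, ← h, ← hb,
        borelVec_map (hκm n) (hκC n), enorm_le_iff_norm_le]
      simpa using norm_borelVec_le (ρ := ρ) ((hκm n).mul hbm) (hκ1 n) v
    have hlim : ∀ t, Tendsto (fun n => (κ n * ⇑c) t) atTop (𝓝 (π t)) := fun t => by
      by_cases ht : b t = 0
      · simp [π, ht, hc0 t ht]
      · refine tendsto_const_nhds.congr' ?_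
        have h1 : Tendsto (fun n : ℕ => ((n : ℝ) + 1)⁻¹) atTop (𝓝 0) := by
          simpa using tendsto_one_div_add_atTop_nhds_zero_nat (𝕜 := ℝ)
        filter_upwards [h1.eventually_lt_const (norm_pos_iff.2 ht)] with n hn
        have : t ∈ {t | ((n : ℝ) + 1)⁻¹ ≤ ‖b t‖} := hn.le
        simp only [κ, π, Pi.mul_apply, Set.indicator_of_mem this]
        rw [div_eq_inv_mul]
    -- Fatou's lemma passes the uniform bound to the pointwise limit `π`.
    have hx : MemLp π 2 (vectorMeasure ρ x) := by
      refine ⟨hπ.aestronglyMeasurable, lt_of_le_of_lt ?_ (enorm_lt_top (x := v))⟩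
      refine (Lp.eLpNorm_lim_le_liminf_eLpNorm (fun n => (hκc n).1) π (ae_of_all _ hlim)).trans ?_
      exact (liminf_le_liminf (Eventually.of_forall hbound)).trans (by simp)
    have hdom : x ∈ ((spectralMeasure ρ π hπ).integral (fun z => z) measurable_id).domain :=
      (mem_integral_spectralMeasure_domain hπ measurable_id).2 hx
    refine ⟨⟨x, hdom⟩, rfl, ?_⟩
    have h2 := integral_spectralMeasure hπ measurable_id ⟨x, hdom⟩
    have h3 : B (borelVec ρ π x) = B v := (hMem hx).trans h.symm
    have h4 : borelVec ρ π x = v :=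
      sub_eq_zero.1 (resolvent_injective hBC (by rw [map_sub, h3, sub_self]))
    exact h2.trans h4
  · rintro ⟨⟨x', hx'⟩, h1, h2⟩
    simp only at h1 h2
    subst h1
    have h3 := integral_spectralMeasure hπ measurable_id ⟨x', hx'⟩
    have h4 := hMem ((mem_integral_spectralMeasure_domain hπ measurable_id).1 hx')
    rw [← h2, ← h4]
    exact congrArg B h3

end SpectralTheorem
end

noncomputable section

/-! ### The norm of a difference, the Hölder seminorm, and functions of a normal operator. -/

section OpNormSub

variable {H : Type*} [NormedAddCommGroup H] [InnerProductSpace ℂ H]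

theorem opNormSub_le {A B : H →ₗ.[ℂ] H} (hdom : A.domain = B.domain) {c : ℝ}
    (h : ∀ x (h₁ : x ∈ A.domain) (h₂ : x ∈ B.domain), ‖A ⟨x, h₁⟩ - B ⟨x, h₂⟩‖ ≤ c * ‖x‖) :
    opNormSub A B ≤ ENNReal.ofReal c := by
  rw [opNormSub, if_pos hdom]
  refine iSup_le fun x => ENNReal.div_le_of_le_mul ?_
  rw [LinearPMap.sub_apply, ← ofReal_norm, ← ofReal_norm]
  refine (ENNReal.ofReal_le_ofReal (h x x.2.1 x.2.2)).trans_eq ?_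
  rw [ENNReal.ofReal_mul' (norm_nonneg _)]

theorem domain_eq_of_opNormSub_ne_top {A B : H →ₗ.[ℂ] H} (h : opNormSub A B ≠ ∞) :
    A.domain = B.domain := by
  by_contra hne
  exact h (if_neg hne)

theorem norm_sub_le_opNormSub {A B : H →ₗ.[ℂ] H} (h : opNormSub A B ≠ ∞) (x : H)
    (h₁ : x ∈ A.domain) (h₂ : x ∈ B.domain) :
    ‖A ⟨x, h₁⟩ - B ⟨x, h₂⟩‖ ≤ (opNormSub A B).toReal * ‖x‖ := by
  by_cases hx : x = 0
  · subst hx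
    have e₁ : A ⟨0, h₁⟩ = 0 := A.map_zero
    have e₂ : B ⟨0, h₂⟩ = 0 := B.map_zero
    simp [e₁, e₂]
  have hle : ‖A ⟨x, h₁⟩ - B ⟨x, h₂⟩‖ₑ / ‖x‖ₑ ≤ opNormSub A B := by
    conv_rhs => rw [opNormSub, if_pos (domain_eq_of_opNormSub_ne_top h)]
    exact le_iSup (fun x : (A - B).domain => ‖(A - B) x‖ₑ / ‖(x : H)‖ₑ) ⟨x, h₁, h₂⟩
  rw [ENNReal.div_le_iff (by simpa using hx) (by simp)] at hle
  have := ENNReal.toReal_mono (ENNReal.mul_ne_top h (by simp)) hle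
  simpa using this

end OpNormSub

theorem norm_sub_le_holderSeminorm {α : ℝ} (hα : 0 < α) {f : ℂ → ℂ} (hf : MemHolderClass α f)
    (z w : ℂ) : ‖f z - f w‖ ≤ (holderSeminorm α f).toReal * ‖z - w‖ ^ α := by
  by_cases h : z = w
  · subst h; simp [Real.zero_rpow hα.ne']
  · have h1 : ENNReal.ofReal (‖f z - f w‖ / ‖z - w‖ ^ α) ≤ holderSeminorm α f :=
      le_iSup_of_le z (le_iSup_of_le w (le_iSup_of_le h le_rfl))
    have h2 : 0 < ‖z - w‖ ^ α := Real.rpow_pos_of_pos (norm_pos_iff.2 (sub_ne_zero.2 h)) _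
    rw [← div_le_iff₀ h2]
    exact (ENNReal.ofReal_le_iff_le_toReal hf.ne).1 h1

section BorelFunction

variable {H : Type*} [NormedAddCommGroup H] [InnerProductSpace ℂ H] [CompleteSpace H]

/-- The main estimate holds for any spectral measures that represent the two operators, so
uniqueness plays no role and the chosen one suffices. -/
theorem IsNormalOperator.exists_borelFunction_eq {N : H →ₗ.[ℂ] H} (hN : IsNormalOperator N) :
    ∃ E : SpectralMeasure H, N = E.integral (fun z => z) measurable_id ∧
      ∀ f hf, borelFunction N f hf = E.integral f hf :=
  ⟨hN.exists_spectralMeasure.choose, hN.exists_spectralMeasure.choose_spec,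
    fun _ _ => dif_pos hN.exists_spectralMeasure⟩

theorem SpectralMeasure.exists_integral_const (E : SpectralMeasure H) {f : ℂ → ℂ}
    (hf : Measurable f) {c : ℂ} (hc : ∀ z, f z = c) (x : H) :
    ∃ h : x ∈ (E.integral f hf).domain, E.integral f hf ⟨x, h⟩ = c • x := by
  have := E.exists_integral_eq_smul_of_eqOn hf MeasurableSet.univ (fun z _ => hc z) x
  simp only [E.proj_univ] at this
  exact this

end BorelFunction

end
-- The Hölder estimate for functions of normal operators.
theorem theorem8p1 :
    ∃ c : ℝ, 0 < c ∧
      ∀ (H : Type*) [NormedAddCommGroup H] [InnerProductSpace ℂ H] [CompleteSpace H]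
        (α : ℝ) (hα₀ : 0 < α) (_hα₁ : α < 1)
        (f : ℂ → ℂ) (hf : MemHolderClass α f)
        (N₁ N₂ : H →ₗ.[ℂ] H), IsNormalOperator N₁ → IsNormalOperator N₂ →
        opNormSub (borelFunction N₁ f (hf.measurable hα₀))
            (borelFunction N₂ f (hf.measurable hα₀)) ≤
          ENNReal.ofReal (c * (1 - α)⁻¹) * holderSeminorm α f * opNormSub N₁ N₂ ^ α := by
  refine ⟨7684, by norm_num, ?_⟩
  intro H _ _ _ α hα₀ hα₁ f hf N₁ N₂ hN₁ hN₂
  have hfm := hf.measurable hα₀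
  have hfL := norm_sub_le_holderSeminorm hα₀ hf
  set L := (holderSeminorm α f).toReal with hL
  have hL0 : 0 ≤ L := ENNReal.toReal_nonneg
  have hLe : holderSeminorm α f = ENNReal.ofReal L := (ENNReal.ofReal_toReal hf.ne).symm
  have hα' : 0 < (1 - α)⁻¹ := inv_pos.2 (by linarith)
  obtain ⟨E₁, e₁, g₁⟩ := hN₁.exists_borelFunction_eq
  obtain ⟨E₂, e₂, g₂⟩ := hN₂.exists_borelFunction_eq
  -- The right-hand side is `0` here even for `opNormSub N₁ N₂ = ∞`, because `0 * ∞ = 0`; `f` is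
  -- constant and both functions are the same everywhere defined scalar operator.
  by_cases hL1 : L = 0
  · have hconst : ∀ z, f z = f 0 := fun z => by
      have := hfL z 0
      rw [hL1, zero_mul] at this
      exact sub_eq_zero.1 (norm_le_zero_iff.1 this)
    have hdom : (E₁.integral f hfm).domain = (E₂.integral f hfm).domain := by
      ext x
      exact ⟨fun _ => (E₂.exists_integral_const hfm hconst x).choose,
        fun _ => (E₁.exists_integral_const hfm hconst x).choose⟩
    rw [g₁, g₂]
    refine (opNormSub_le hdom (c := 0) fun x h₁ h₂ => ?_).trans (by simp)
    obtain ⟨_, k₁⟩ := E₁.exists_integral_const hfm hconst x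
    obtain ⟨_, k₂⟩ := E₂.exists_integral_const hfm hconst x
    rw [k₁, k₂]
    simp
  have hLpos : 0 < L := lt_of_le_of_ne hL0 (Ne.symm hL1)
  by_cases htop : opNormSub N₁ N₂ = ∞
  · rw [htop, ENNReal.top_rpow_of_pos hα₀, ENNReal.mul_top]
    · exact le_top
    · rw [hLe]
      simp only [ne_eq, mul_eq_zero, ENNReal.ofReal_eq_zero, not_or, not_le]
      exact ⟨by positivity, hLpos⟩
  set δ := (opNormSub N₁ N₂).toReal with hδ
  have hδe : opNormSub N₁ N₂ = ENNReal.ofReal δ := (ENNReal.ofReal_toReal htop).symm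
  have hb := norm_sub_le_opNormSub htop
  have hdom := domain_eq_of_opNormSub_ne_top htop
  -- The mesh has to be positive, so `N₁ = N₂` is treated apart.
  by_cases hδ0 : δ = 0
  · have hEq : N₁ = N₂ := by
      refine LinearPMap.ext hdom fun x hx hx' => ?_
      have := hb x hx hx'
      rw [← hδ, hδ0, zero_mul] at this
      exact sub_eq_zero.1 (norm_le_zero_iff.1 this)
    subst hEq
    refine (opNormSub_le rfl (c := 0) fun x _ _ => ?_).trans (by simp)
    simp
  have hδpos : 0 < δ := lt_of_le_of_ne ENNReal.toReal_nonneg (Ne.symm hδ0)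
  rw [g₁, g₂]
  have hdense := hN₁.dense_domain
  have hdense' := hN₂.dense_domain
  rw [e₁] at hdense
  rw [e₂] at hdense'
  simp only [← hδ] at hb
  rw [e₁, e₂] at hdom
  have hbE : ∀ x h₁ h₂, ‖E₁.integral (fun z => z) measurable_id ⟨x, h₁⟩ -
      E₂.integral (fun z => z) measurable_id ⟨x, h₂⟩‖ ≤ δ * ‖x‖ := by
    clear_value δ
    subst e₁ e₂
    exact hb
  -- Each application gives one inclusion of the domains; exchanging the two operators gives the
  -- other.
  have main₁ := fun {x} hx => E₁.exists_integral_sub_le E₂ hδpos hdense hdom hbE hL0 hα₀.le hα₁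
    hfm hfL (x := x) hx
  have main₂ := fun {x} hx => E₂.exists_integral_sub_le E₁ hδpos hdense' hdom.symm
    (fun x h₂ h₁ => by rw [norm_sub_rev]; exact hbE x h₁ h₂) hL0 hα₀.le hα₁
    hfm hfL (x := x) hx
  have hdomf : (E₁.integral f hfm).domain = (E₂.integral f hfm).domain := by
    ext x
    exact ⟨fun hx => (main₂ hx).choose, fun hx => (main₁ hx).choose⟩
  refine (opNormSub_le hdomf (c := 7684 * (1 - α)⁻¹ * L * δ ^ α) fun x h₁ h₂ => ?_).trans_eq ?_
  · exact (main₁ h₂).choose_spec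
  · rw [hLe, hδe, ENNReal.ofReal_rpow_of_pos hδpos, ← ENNReal.ofReal_mul (by positivity),
      ← ENNReal.ofReal_mul (by positivity)]
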